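/- Conventions. All graphs are simple and may be infinite. Let $M$ be a perfect matching of a graph $G$, and let $\mathrm{Perf}(G,M)$ be the set of all perfect matchings of $G$ with finite symmetric difference to $M$. The graph $G$ is matching covered with respect to $M$ if it is connected and every edge of $G$ lies in some element of $\mathrm{Perf}(G,M)$. Fix such a pair $(G,M)$. For $X\subseteq V(G)$ let $\partial(X)$ be the set of edges with exactly one endpoint in $X$; $X$ is tight, and $\partial(X)$ is a tight cut, if every $M'\in\mathrm{Perf}(G,M)$ has exactly one edge in $\partial(X)$. Two tight cuts are nested if they can be written as $\partial(X_1)$ and $\partial(X_2)$ with $X_1\cap X_2=\emptyset$. A brick or brace (BoB) is a matching covered graph in which every tight set is a singleton or the complement of a singleton. A set $S$ is passable for $P$ if $P\setminus S$ and $P\cup S$ are tight. Torsos. A tight set partition is a partition $\mathcal P$ of $V(G)$ into tight sets. Its collapse is the graph with vertex set $\mathcal P$ in which distinct $P,Q$ are adjacent iff $G$ has an edge between $P$ and $Q$; it is considered with the perfect matching inherited from $M$, in which $P,Q$ are matched iff $M$ has an edge between them. A torso in $G$ is the collapse of a tight set partition $\mathcal P$ with $|\mathcal P|\ge 4$ whose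 collapse is a BoB and for which there is an inclusion-maximal family $\mathcal C$ of pairwise nested tight cuts of $G$ with $\partial(P)\in\mathcal C$ for all $P\in\mathcal P$. Torsoids. A torsoid in $G$ is a pair $(H,\varepsilon)$ of a graph $H$ and a map $\varepsilon\colon E(H)\to 2^{V(G)}$ such that: 1. $H$ has at least $4$ vertices, and $H$ is matching covered and is a BoB or a (finite) cycle. Here the vertices of $H$ are subsets of $V(G)$ by (2), and $H$ is considered with the perfect matching inherited from $M$, in which $vw\in E(H)$ is matched iff $M$ has an edge between $v\cup\varepsilon(vw)$ and $w$ or between $v$ and $w\cup\varepsilon(vw)$; 2. every vertex of $H$ is a tight set of $G$; 3. the distinct members of $V(H)\cup\{\varepsilon(e): e\in E(H)\}$ are pairwise disjoint and have union $V(G)$ (empty sets $\varepsilon(e)$ are allowed); 4. for every $vw\in E(H)$ there is an edge of $G$ from $v\cup\varepsilon(vw)$ to $w$, and $\varepsilon(vw)$ is the largest among all subsets of $v\cup\varepsilon(vw)\cup w$ that are passable for both $v$ and $w$; 5. for distinct $v,w\in V(H)$ with $vw\notin E(H)$ there is no edge of $G$ from $v$ to $w$; 6. if $H$ is a cycle and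 $v$ is a vertex of $H$ with neighbours $u\ne w$, then there is no partition of $\varepsilon(uv)\cup v\cup\varepsilon(vw)$ into tight sets $P_1,P_2,P_3$ such that both $u\cup P_1\cup P_2$ and $P_2\cup P_3\cup w$ are tight. A torso $\mathcal S$ cleaves a torsoid $(H,\varepsilon)$ if every vertex of $\mathcal S$ contains (as a subset) a vertex of $H$. Lemma. Let $G$ be matching covered with respect to $M$ and let $\mathcal S$ be a torso in $G$. There exists exactly one torsoid $\mathcal T$ in $G$ such that $\mathcal S$ cleaves $\mathcal T$. -/

import Mathlib

namespace TightCuts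

/-- `PerfNear M`: the perfect matchings of `G` whose symmetric difference with the perfect
matching `M` is finite. -/
def PerfNear {W : Type*} {G : SimpleGraph W} (M : G.Subgraph) : Set G.Subgraph :=
  {N | N.IsPerfectMatching ∧ (symmDiff N.edgeSet M.edgeSet).Finite}

/-- `G` is (connected and) matching covered with respect to the perfect matching `M`. -/
structure IsMatchingCovered {W : Type*} (G : SimpleGraph W) (M : G.Subgraph) : Prop where
  connected : G.Connected
  isPerfectMatching : M.IsPerfectMatching
  covered : ∀ e ∈ G.edgeSet, ∃ N ∈ PerfNear M, e ∈ N.edgeSet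

/-- The cut induced by `X`: all edges with exactly one endpoint in `X`. -/
def cut {W : Type*} (G : SimpleGraph W) (X : Set W) : Set (Sym2 W) :=
  {e | e ∈ G.edgeSet ∧ ∃ x ∈ X, ∃ y ∉ X, e = s(x, y)}

/-- `X` is a tight set: every perfect matching with finite symmetric difference to `M` has exactly
one edge in the cut induced by `X`. -/
def IsTight {W : Type*} (G : SimpleGraph W) (M : G.Subgraph) (X : Set W) : Prop :=
  ∀ N ∈ PerfNear M, ∃! e, e ∈ N.edgeSet ∧ e ∈ cut G X

/-- A tight cut. -/
def IsTightCut {W : Type*} (G : SimpleGraph W) (M : G.Subgraph) (C : Set (Sym2 W)) : Prop :=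
  ∃ X, IsTight G M X ∧ C = cut G X

/-- Two cuts are nested if they are induced by disjoint vertex sets. -/
def NestedCuts {W : Type*} (G : SimpleGraph W) (C D : Set (Sym2 W)) : Prop :=
  ∃ X Y : Set W, Disjoint X Y ∧ C = cut G X ∧ D = cut G Y

/-- A family of pairwise nested tight cuts. -/
def IsNestedFamily {W : Type*} (G : SimpleGraph W) (M : G.Subgraph)
    (𝒞 : Set (Set (Sym2 W))) : Prop :=
  (∀ C ∈ 𝒞, IsTightCut G M C) ∧ ∀ C ∈ 𝒞, ∀ D ∈ 𝒞, NestedCuts G C D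

/-- An inclusion-maximal family of pairwise nested tight cuts. -/
def IsMaximalNestedFamily {W : Type*} (G : SimpleGraph W) (M : G.Subgraph)
    (𝒞 : Set (Set (Sym2 W))) : Prop :=
  Maximal (IsNestedFamily G M) 𝒞

/-- Brick or brace: no tight set other than those that, or whose complements, are singletons. -/
def IsBrickOrBrace {W : Type*} (G : SimpleGraph W) (M : G.Subgraph) : Prop :=
  ∀ X, IsTight G M X → (∃ w, X = {w}) ∨ ∃ w, Xᶜ = {w}

/-- `G` is a (finite) cycle. -/
def IsCycleGraph {W : Type*} (G : SimpleGraph W) : Prop :=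
  ∃ n, 3 ≤ n ∧ Nonempty (G ≃g SimpleGraph.cycleGraph n)

/-- A graph whose vertices are subsets of `V`. -/
structure SetGraph (V : Type*) where
  verts : Set (Set V)
  graph : SimpleGraph verts

/-- A partition of the vertex set into tight sets. -/
def IsTightSetPartition {V : Type*} (G : SimpleGraph V) (M : G.Subgraph)
    (P : Set (Set V)) : Prop :=
  Setoid.IsPartition P ∧ ∀ X ∈ P, IsTight G M X

/-- The collapse of `P`: its vertices are the classes, and two distinct classes are adjacent if
there is an edge of `G` between them. -/
def collapse {V : Type*} (G : SimpleGraph V) (P : Set (Set V)) : SetGraph V where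
  verts := P
  graph :=
    { Adj := fun X Y => X ≠ Y ∧ ∃ x ∈ X.1, ∃ y ∈ Y.1, G.Adj x y
      symm := ⟨fun _ _ h =>
        ⟨h.1.symm, by obtain ⟨x, hx, y, hy, a⟩ := h.2; exact ⟨y, hy, x, hx, a.symm⟩⟩⟩
      loopless := ⟨fun _ h => h.1 rfl⟩ }

/-- The matching of the collapse inherited from `M`: two distinct classes are matched if there is
an edge of `M` between them. -/
def collapseMatching {V : Type*} {G : SimpleGraph V} (M : G.Subgraph) (P : Set (Set V)) :
    (collapse G P).graph.Subgraph where
  verts := Set.univ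
  Adj := fun X Y => X ≠ Y ∧ ∃ x ∈ X.1, ∃ y ∈ Y.1, M.Adj x y
  adj_sub := fun h =>
    ⟨h.1, by obtain ⟨x, hx, y, hy, a⟩ := h.2; exact ⟨x, hx, y, hy, a.adj_sub⟩⟩
  edge_vert := fun _ => Set.mem_univ _
  symm := ⟨fun _ _ h =>
    ⟨h.1.symm, by obtain ⟨x, hx, y, hy, a⟩ := h.2; exact ⟨y, hy, x, hx, a.symm⟩⟩⟩

/-- A maximal star of `𝒞`. -/
structure IsMaximalStar {V : Type*} (G : SimpleGraph V) (M : G.Subgraph)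
    (𝒞 : Set (Set (Sym2 V))) (P : Set (Set V)) : Prop where
  isTightSetPartition : IsTightSetPartition G M P
  four_le : 4 ≤ P.encard
  isBrickOrBrace : IsBrickOrBrace (collapse G P).graph (collapseMatching M P)
  cut_mem : ∀ X ∈ P, cut G X ∈ 𝒞

/-- `S` is a torso of `𝒞`: the collapse of a maximal star of `𝒞`. -/
def IsTorsoOf {V : Type*} (G : SimpleGraph V) (M : G.Subgraph)
    (𝒞 : Set (Set (Sym2 V))) (S : SetGraph V) : Prop :=
  ∃ P, IsMaximalStar G M 𝒞 P ∧ S = collapse G P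

/-- `S` is a torso in `G`: a torso of some maximal family of nested tight cuts in `G`. -/
def IsTorso {V : Type*} (G : SimpleGraph V) (M : G.Subgraph) (S : SetGraph V) : Prop :=
  ∃ 𝒞, IsMaximalNestedFamily G M 𝒞 ∧ IsTorsoOf G M 𝒞 S

/-- `S` is passable for `P`. -/
def IsPassable {V : Type*} (G : SimpleGraph V) (M : G.Subgraph) (S P : Set V) : Prop :=
  IsTight G M (P \ S) ∧ IsTight G M (P ∪ S)

/-- A pair `(H, ε)` of a graph `H` whose vertices are subsets of `V` and a map
`ε : E(H) → 2 ^ V`. -/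
structure PreTorsoid (V : Type*) extends SetGraph V where
  edgeFn : graph.edgeSet → Set V

/-- The value of `ε` at the edge `vw`. -/
def PreTorsoid.eps {V : Type*} (T : PreTorsoid V) {v w : T.verts} (h : T.graph.Adj v w) : Set V :=
  T.edgeFn ⟨s(v, w), h⟩

/-- The matching of `H` inherited from `M`: an edge `vw` of `H` is matched if some edge of `M` joins
`v ∪ ε(vw)` to `w` or `v` to `w ∪ ε(vw)`. -/
def PreTorsoid.inheritedMatching {V : Type*} {G : SimpleGraph V} (T : PreTorsoid V)
    (M : G.Subgraph) : T.graph.Subgraph where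
  verts := Set.univ
  Adj := fun v w => ∃ h : T.graph.Adj v w,
    (∃ x ∈ v.1 ∪ T.eps h, ∃ y ∈ w.1, M.Adj x y) ∨ (∃ x ∈ v.1, ∃ y ∈ w.1 ∪ T.eps h, M.Adj x y)
  adj_sub := fun h => h.1
  edge_vert := fun _ => Set.mem_univ _
  symm := ⟨by
    rintro v w ⟨h, hh⟩
    have e : T.eps h.symm = T.eps h := by
      unfold PreTorsoid.eps
      congr 1
      exact Subtype.ext Sym2.eq_swap
    refine ⟨h.symm, ?_⟩
    rw [e]
    rcases hh with ⟨x, hx, y, hy, a⟩ | ⟨x, hx, y, hy, a⟩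
    · exact Or.inr ⟨y, hy, x, hx, a.symm⟩
    · exact Or.inl ⟨y, hy, x, hx, a.symm⟩⟩

/-- `T` is a torsoid in `G`. -/
structure IsTorsoid {V : Type*} (G : SimpleGraph V) (M : G.Subgraph) (T : PreTorsoid V) :
    Prop where
  four_le : 4 ≤ T.verts.encard
  matchingCovered : IsMatchingCovered T.graph (T.inheritedMatching M)
  brickOrBrace_or_cycle :
    IsBrickOrBrace T.graph (T.inheritedMatching M) ∨ IsCycleGraph T.graph
  tight : ∀ v ∈ T.verts, IsTight G M v
  /-- The vertices of `H` and the values of `ε` form a near partition of `V`, that is, a partition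
  up to the possible presence of the empty set. -/
  nearPartition_disjoint : (T.verts ∪ Set.range T.edgeFn).PairwiseDisjoint id
  nearPartition_cover : ⋃₀ (T.verts ∪ Set.range T.edgeFn) = Set.univ
  edge_of_adj : ∀ (v w : T.verts) (h : T.graph.Adj v w),
    ∃ x ∈ v.1 ∪ T.eps h, ∃ y ∈ w.1, G.Adj x y
  eps_greatest : ∀ (v w : T.verts) (h : T.graph.Adj v w),
    IsGreatest {S | S ⊆ v.1 ∪ T.eps h ∪ w.1 ∧ IsPassable G M S v.1 ∧ IsPassable G M S w.1}
      (T.eps h)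
  no_edge_of_not_adj : ∀ v w : T.verts, v ≠ w → ¬ T.graph.Adj v w →
    ¬ ∃ x ∈ v.1, ∃ y ∈ w.1, G.Adj x y
  cycle_maximal : IsCycleGraph T.graph →
    ∀ (u v w : T.verts) (huv : T.graph.Adj u v) (hvw : T.graph.Adj v w), u ≠ w →
      ¬ ∃ P₁ P₂ P₃ : Set V, IsTight G M P₁ ∧ IsTight G M P₂ ∧ IsTight G M P₃ ∧
        Disjoint P₁ P₂ ∧ Disjoint P₁ P₃ ∧ Disjoint P₂ P₃ ∧
        P₁ ∪ P₂ ∪ P₃ = T.eps huv ∪ v.1 ∪ T.eps hvw ∧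
        IsTight G M (u.1 ∪ P₁ ∪ P₂) ∧ IsTight G M (P₂ ∪ P₃ ∪ w.1)

/-- `S` cleaves `T`: every vertex of `S` contains a vertex of `T`. -/
def Cleaves {V : Type*} (S : SetGraph V) (T : PreTorsoid V) : Prop :=
  ∀ X ∈ S.verts, ∃ v ∈ T.verts, v ⊆ X

end TightCuts

/-!
The maximal nested family behind a torso is irrelevant: the theorem holds for the collapse of every
tight set partition `q` with at least four members of which the collapse `K` is a brick or a brace.

*Uncrossing.* A perfect matching near `M` is encoded by its partner function. A parity `par` on
arbitrary vertex sets, obtained by linear algebra over `ZMod 2` (`exists_parity`), is odd on tight sets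
and even on sets closed under a matching. It replaces counting in a possibly infinite graph: tight
sets `X`, `Y` can be uncrossed into `X ∩ Y`, `X ∪ Y` or into `X \ Y`, `Y \ X` depending on
`par (X ∩ Y)`, and the corresponding pair of corners has no edges between it.

*Frames.* Collapses of partitions and torsoids are both graphs whose vertices carry tight sets and
whose edges carry (possibly empty) even sets; `IsFrame` is this common shape. Matchings of `G` induce
matchings of the frame, and all matchings of the frame near the given one arise in this way
(`IsFrame.exists_lift`), so that tight sets of `G` can be compared with those of the frame. That
`ε` chooses greatest passable sets becomes irreducibility (`Irred`). In a torsoid, no tight set cuts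
an edge set lengthwise (`NoSplit`): for cycles this is the maximality condition, for bricks and braces
of minimum degree three it follows from the absence of tight sets.

*Existence.* A part of `q i` is movable to `q j` if it is even and has neighbours only in `q i ∪ q j`;
let `mov` be the largest such part. If the parts of `q i` movable to different members are disjoint
(`NoOverlap`), then removing them all from `q i` leaves a tight set, the core, and the cores together
with what was removed between `q i` and `q j` form a torsoid (`IsFrame.isTorsoid_core`).

*Uniqueness.* Let a torsoid be cleaved by `q`. Each member `q i` meets all its edge sets evenly. The
vertices met oddly by `q i` form a tight set of the torsoid, so in a brick or brace there is just
one; in a cycle they form a segment, and a segment with more than one vertex yields an overlap. Hence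
the vertices of the torsoid correspond to the members of `q`, and vertices and edge sets must be the
cores and the moved parts (`IsTorsoid.eq_ofFrame`).

*Overlaps.* An overlap in `q i` forces `q i` to have at most two neighbours, and then the collapse is a
four-cycle. For a partition with a cycle as quotient, a member with an overlap splits into three
tight sets in a row (`Movable.split`). The refined partition again has a cycle as quotient and cleaves
the same torsoids (`Splits.cleaves`). Two matchings of `G` that induce the two perfect matchings of
the cycle differ on every member, while they differ on finitely many vertices only; so refining
comes to an end at a partition without overlap.
-/

namespace TightCuts

/-! ### Perfect matchings as partner functions, and parity -/

section Basic

variable {V : Type*} {G : SimpleGraph V} {m : V → V}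

/-- The perfect matchings with finite symmetric difference to a reference matching `m`, where a
perfect matching is encoded by the involution that maps each vertex to its partner. -/
def Mates (G : SimpleGraph V) (m : V → V) : Set (V → V) :=
  {f | (∀ x, G.Adj x (f x)) ∧ (∀ x, f (f x) = x) ∧ {x | f x ≠ m x}.Finite}

/-- Tightness in terms of partner functions: a unique vertex of `X` has its partner
outside `X`. -/
def Tight (G : SimpleGraph V) (m : V → V) (X : Set V) : Prop :=
  ∀ f ∈ Mates G m, ∃! x, x ∈ X ∧ f x ∉ X

/-- `G` is matching covered with respect to the matching with partner function `m`. -/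
structure MatchCov (G : SimpleGraph V) (m : V → V) : Prop where
  conn : G.Connected
  mem : m ∈ Mates G m
  cov : ∀ x y, G.Adj x y → ∃ f ∈ Mates G m, f x = y

/-- `m` is the partner function of the perfect matching `M`. -/
def IsMate (M : G.Subgraph) (m : V → V) : Prop :=
  M.verts = Set.univ ∧ ∀ x y, M.Adj x y ↔ m x = y

/-- Every perfect matching has a partner function. -/
theorem exists_isMate {M : G.Subgraph} (h : M.IsPerfectMatching) : ∃ m, IsMate M m := by
  have h1 : ∀ x, ∃! y, M.Adj x y := fun x => h.1 (h.2 x)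
  choose m hm hu using h1
  refine ⟨m, Set.eq_univ_of_forall h.2, fun x y => ⟨fun a => (hu x y a).symm, ?_⟩⟩
  rintro rfl
  exact hm x

theorem IsMate.isPerfectMatching {M : G.Subgraph} (h : IsMate M m) : M.IsPerfectMatching := by
  refine ⟨fun x _ => ⟨m x, (h.2 _ _).2 rfl, fun y hy => ((h.2 _ _).1 hy).symm⟩, fun x => ?_⟩
  rw [h.1]; trivial

theorem IsMate.invol {M : G.Subgraph} (h : IsMate M m) (x : V) : m (m x) = x :=
  (h.2 _ _).1 ((h.2 x (m x)).2 rfl).symm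

theorem IsMate.adj {M : G.Subgraph} (h : IsMate M m) (x : V) : G.Adj x (m x) :=
  ((h.2 x (m x)).2 rfl).adj_sub

theorem IsMate.mem_mates {M : G.Subgraph} (h : IsMate M m) : m ∈ Mates G m :=
  ⟨h.adj, h.invol, by simp⟩

theorem IsMate.mem_edgeSet {M : G.Subgraph} (h : IsMate M m) {e : Sym2 V} :
    e ∈ M.edgeSet ↔ ∃ x, e = s(x, m x) := by
  induction e with | _ x y =>
  rw [SimpleGraph.Subgraph.mem_edgeSet, h.2]
  constructor
  · rintro rfl; exact ⟨x, rfl⟩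
  · rintro ⟨z, hz⟩
    rcases Sym2.eq_iff.1 hz with ⟨rfl, rfl⟩ | ⟨rfl, rfl⟩
    · rfl
    · exact h.invol _

theorem finite_symmDiff_iff {M N : G.Subgraph} {f : V → V} (hm : IsMate M m) (hf : IsMate N f) :
    (symmDiff N.edgeSet M.edgeSet).Finite ↔ {x | f x ≠ m x}.Finite := by
  have key : symmDiff N.edgeSet M.edgeSet =
      (fun x => s(x, f x)) '' {x | f x ≠ m x} ∪ (fun x => s(x, m x)) '' {x | f x ≠ m x} := by
    ext e
    simp only [Set.mem_symmDiff, hm.mem_edgeSet, hf.mem_edgeSet, Set.mem_union, Set.mem_image,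
      Set.mem_ofPred_eq]
    constructor
    · rintro (⟨⟨x, rfl⟩, h⟩ | ⟨⟨x, rfl⟩, h⟩)
      · exact Or.inl ⟨x, fun h' => h ⟨x, by rw [h']⟩, rfl⟩
      · exact Or.inr ⟨x, fun h' => h ⟨x, by rw [h']⟩, rfl⟩
    · rintro (⟨x, hx, rfl⟩ | ⟨x, hx, rfl⟩)
      · refine Or.inl ⟨⟨x, rfl⟩, ?_⟩
        rintro ⟨z, hz⟩
        rcases Sym2.eq_iff.1 hz with ⟨rfl, h⟩ | ⟨h, h'⟩
        · exact hx h
        · apply hx; rw [h', h, hm.invol]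
      · refine Or.inr ⟨⟨x, rfl⟩, ?_⟩
        rintro ⟨z, hz⟩
        rcases Sym2.eq_iff.1 hz with ⟨rfl, h⟩ | ⟨h, h'⟩
        · exact hx h.symm
        · apply hx; rw [h', h, hf.invol]
  rw [key]
  constructor
  · intro h
    have h1 := h.subset Set.subset_union_left
    -- each edge is hit by at most two vertices
    refine Set.Finite.of_finite_fibers (fun x => s(x, f x)) h1 ?_
    rintro e -
    refine Set.Finite.subset (s := {x | x ∈ e}) ?_ ?_
    · induction e with | _ a b =>
      simp only [Sym2.mem_iff]
      exact (Set.toFinite {a, b}).subset (by intro x; simp)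
    · rintro x ⟨-, hx⟩
      simp only [Set.mem_preimage, Set.mem_singleton_iff] at hx
      rw [← hx]; simp
  · intro h
    exact (h.image _).union (h.image _)

theorem mem_perfNear_iff {M N : G.Subgraph} (hm : IsMate M m) :
    N ∈ PerfNear M ↔ ∃ f ∈ Mates G m, IsMate N f := by
  constructor
  · rintro ⟨h1, h2⟩
    obtain ⟨f, hf⟩ := exists_isMate h1
    exact ⟨f, ⟨hf.adj, hf.invol, (finite_symmDiff_iff hm hf).1 h2⟩, hf⟩
  · rintro ⟨f, hf, h⟩
    exact ⟨h.isPerfectMatching, (finite_symmDiff_iff hm h).2 hf.2.2⟩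

theorem exists_subgraph {f : V → V} (hf : f ∈ Mates G m) : ∃ N : G.Subgraph, IsMate N f := by
  refine ⟨⟨Set.univ, fun x y => f x = y, ?_, fun _ => trivial, ⟨?_⟩⟩, rfl, fun _ _ => Iff.rfl⟩
  · rintro x y rfl; exact hf.1 x
  · rintro x y rfl; exact hf.2.1 x

/-- Edges of a perfect matching in the cut of `X` correspond to vertices of `X` with partner outside
`X`. -/
theorem existsUnique_cut_iff {N : G.Subgraph} {f : V → V} (hf : IsMate N f) (X : Set V) :
    (∃! e, e ∈ N.edgeSet ∧ e ∈ cut G X) ↔ ∃! x, x ∈ X ∧ f x ∉ X := by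
  have key : ∀ e, (e ∈ N.edgeSet ∧ e ∈ cut G X) ↔ ∃ x, (x ∈ X ∧ f x ∉ X) ∧ e = s(x, f x) := by
    intro e
    constructor
    · rintro ⟨h, -, x, hx, y, hy, rfl⟩
      have := (hf.2 _ _).1 (SimpleGraph.Subgraph.mem_edgeSet.1 h)
      subst this
      exact ⟨x, ⟨hx, hy⟩, rfl⟩
    · rintro ⟨x, hx, rfl⟩
      exact ⟨hf.mem_edgeSet.2 ⟨x, rfl⟩, hf.adj x, x, hx.1, _, hx.2, rfl⟩
  simp only [key]
  constructor
  · rintro ⟨e, ⟨x, hx, rfl⟩, hu⟩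
    refine ⟨x, hx, fun y hy => ?_⟩
    have := hu _ ⟨y, hy, rfl⟩
    rcases Sym2.eq_iff.1 this with ⟨h, -⟩ | ⟨h, -⟩
    · exact h
    · rw [h] at hy; exact absurd hy.1 hx.2
  · rintro ⟨x, hx, hu⟩
    refine ⟨_, ⟨x, hx, rfl⟩, ?_⟩
    rintro e ⟨y, hy, rfl⟩
    rw [hu y hy]

/-- `Tight` is `IsTight` in terms of partner functions. -/
theorem isTight_iff {M : G.Subgraph} (hm : IsMate M m) (X : Set V) :
    IsTight G M X ↔ Tight G m X := by
  constructor
  · intro h f hf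
    obtain ⟨N, hN⟩ := exists_subgraph hf
    exact (existsUnique_cut_iff hN X).1 (h N ((mem_perfNear_iff hm).2 ⟨f, hf, hN⟩))
  · intro h N hN
    obtain ⟨f, hf, hN⟩ := (mem_perfNear_iff hm).1 hN
    exact (existsUnique_cut_iff hN X).2 (h f hf)

/-- `MatchCov` is `IsMatchingCovered` in terms of partner functions. -/
theorem isMatchingCovered_iff {M : G.Subgraph} (hm : IsMate M m) :
    IsMatchingCovered G M ↔ MatchCov G m := by
  constructor
  · intro h
    refine ⟨h.connected, hm.mem_mates, fun x y hxy => ?_⟩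
    obtain ⟨N, hN, he⟩ := h.covered s(x, y) hxy
    obtain ⟨f, hf, hN⟩ := (mem_perfNear_iff hm).1 hN
    exact ⟨f, hf, (hN.2 _ _).1 he⟩
  · intro h
    refine ⟨h.conn, hm.isPerfectMatching, fun e => ?_⟩
    induction e with | _ x y =>
    intro he
    obtain ⟨f, hf, hxy⟩ := h.cov x y he
    obtain ⟨N, hN⟩ := exists_subgraph hf
    exact ⟨N, (mem_perfNear_iff hm).2 ⟨f, hf, hN⟩, (hN.2 _ _).2 hxy⟩

/-- A linear functional on `V → ZMod 2` that vanishes on `m`-invariant functions and is `1` on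
every indicator of a vertex: it extends the parity of the number of crossing edges of `m`. -/
theorem exists_functional (hm : ∀ x, m (m x) = x) (hne : ∀ x, m x ≠ x) :
    ∃ L : (V → ZMod 2) →ₗ[ZMod 2] ZMod 2, (∀ χ, (∀ x, χ (m x) = χ x) → L χ = 0) ∧
      ∀ x, L (Set.indicator {x} 1) = 1 := by
  classical
  -- `T` contains exactly one vertex of each edge of `m`
  obtain ⟨T, hT⟩ : ∃ T : Set V, ∀ x, x ∈ T ↔ m x ∉ T := by
    let q : V → Sym2 V := fun x => s(x, m x)
    have hq : ∀ x, q (m x) = q x := fun x => by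
      simp only [q, hm]; exact Sym2.eq_swap
    refine ⟨{x | (q x).out.1 = x}, fun x => ?_⟩
    have hx : (q x).out.1 ∈ q x := Sym2.out_fst_mem _
    have : (q x).out.1 = x ∨ (q x).out.1 = m x := by simpa [q] using hx
    simp only [Set.mem_ofPred_eq, hq]
    rcases this with h | h <;> rw [h]
    · simp [(hne x).symm]
    · simp [hne x]
  -- `lam` is a linear projection of all functions on `V` to those of finite support; `ψ` assigns to the
  -- end in `T` of an edge of `m` the sum of the values at its ends
  obtain ⟨lam, hlam⟩ := LinearMap.exists_leftInverse_of_injective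
    (Finsupp.lcoeFun (R := ZMod 2) (M := ZMod 2) (α := V))
    (LinearMap.ker_eq_bot.2 DFunLike.coe_injective)
  let ψ : (V → ZMod 2) →ₗ[ZMod 2] (V → ZMod 2) :=
    { toFun := fun χ x => if x ∈ T then χ x + χ (m x) else 0
      map_add' := fun a b => by ext x; by_cases h : x ∈ T <;> simp [h]; ring
      map_smul' := fun c a => by ext x; by_cases h : x ∈ T <;> simp [h]; ring }
  refine ⟨(Finsupp.lsum (ZMod 2) fun _ => LinearMap.id) ∘ₗ lam ∘ₗ ψ, fun χ h => ?_, fun x => ?_⟩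
  · have : ψ χ = 0 := by
      ext x
      simp only [ψ, LinearMap.coe_mk, AddHom.coe_mk, h, Pi.zero_apply]
      split_ifs
      · exact CharTwo.add_self_eq_zero _
      · rfl
    simp [this]
  · obtain ⟨t, ht⟩ : ∃ t, ψ (Set.indicator {x} 1) =
        Finsupp.lcoeFun (R := ZMod 2) (Finsupp.single t (1 : ZMod 2)) := by
      by_cases hx : x ∈ T
      · refine ⟨x, ?_⟩
        ext y
        by_cases hy : y = x
        · subst hy; simp [ψ, hx, hne]
        · have : y ∈ T → m y ≠ x := by
            rintro h rfl; exact (hT y).1 h hx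
          by_cases h : y ∈ T
          · simp [ψ, h, hy, this h]
          · simp [ψ, h, Ne.symm hy]
      · have hmx : m x ∈ T := by rw [hT, hm]; exact hx
        refine ⟨m x, ?_⟩
        ext y
        by_cases hy : y = m x
        · subst hy; simp [ψ, hmx, hm, hne]
        · have h1 : m y ≠ x := by rintro rfl; exact hy (hm y).symm
          have h2 : y ∈ T → y ≠ x := by rintro h rfl; exact hx h
          by_cases h : y ∈ T
          · simp [ψ, h, h1, h2 h, Ne.symm hy]
          · simp [ψ, h, Ne.symm hy]
    have h2 := LinearMap.congr_fun hlam (Finsupp.single t 1)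
    simp only [LinearMap.comp_apply, LinearMap.id_apply] at h2
    simp only [LinearMap.comp_apply]
    rw [ht, h2]
    simp

/-- A finite set closed under a fixed-point free involution has even size. -/
theorem sum_one_eq_zero_of_involution {f : V → V} (h1 : ∀ x, f x ≠ x) (h2 : ∀ x, f (f x) = x)
    (s : Finset V) (hs : ∀ x ∈ s, f x ∈ s) : ∑ _x ∈ s, (1 : ZMod 2) = 0 := by
  refine Finset.sum_involution (fun x _ => f x) ?_ ?_ ?_ ?_
  · intros; decide
  · intro x _ _; exact h1 x
  · exact hs
  · intro x _; exact h2 x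

/-- A parity on all sets of vertices: additive on disjoint unions, `1` on singletons and `0` on
sets closed under some matching near `m`. On a set crossed by finitely many edges of a matching
near `m` it is the parity of their number; elsewhere its values carry no information. -/
theorem exists_parity (h : m ∈ Mates G m) :
    ∃ p : Set V → ZMod 2, (∀ A B, Disjoint A B → p (A ∪ B) = p A + p B) ∧
      (∀ f ∈ Mates G m, ∀ X, (∀ x ∈ X, f x ∈ X) → p X = 0) ∧ ∀ x, p {x} = 1 := by
  classical
  obtain ⟨L, hL, hL1⟩ := exists_functional h.2.1 (fun x => (h.1 x).ne')
  have hadd : ∀ A B : Set V, Disjoint A B →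
      L (Set.indicator (A ∪ B) 1) = L (Set.indicator A 1) + L (Set.indicator B 1) := by
    intro A B hAB
    rw [Set.indicator_union_of_disjoint hAB]
    exact map_add L _ _
  refine ⟨fun X => L (Set.indicator X 1), hadd, fun f hf X hX => ?_, hL1⟩
  set D := {x | f x ≠ m x} with hD
  have hDf : ∀ x ∈ D, f x ∈ D := by
    intro x hx hx'
    rw [hf.2.1] at hx'
    apply hx
    rw [hx', h.2.1, ← hx']
  have hDm : ∀ x, x ∉ D → m x ∉ D := by
    intro x hx hx'
    apply hx'
    have : f x = m x := not_not.1 hx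
    rw [← this, hf.2.1, this, h.2.1]
  have e : X = (X \ D) ∪ (X ∩ D) := by rw [Set.sdiff_union_inter]
  have hdis : Disjoint (X \ D) (X ∩ D) := Set.disjoint_sdiff_inter
  change L (Set.indicator X 1) = 0
  rw [e, hadd _ _ hdis, hL, zero_add]
  · have hfin : (X ∩ D).Finite := hf.2.2.subset Set.inter_subset_right
    have hsum : ∀ s : Finset V, L (Set.indicator (s : Set V) 1) = ∑ _x ∈ s, (1 : ZMod 2) := by
      intro s
      induction s using Finset.induction_on with
      | empty =>
        rw [Finset.coe_empty, Set.indicator_empty, Finset.sum_empty]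
        exact map_zero L
      | insert a s ha ih =>
        rw [Finset.coe_insert, Set.insert_eq, hadd _ _ (by simpa using ha), hL1, ih,
          Finset.sum_insert ha]
    have := hsum hfin.toFinset
    rw [hfin.coe_toFinset] at this
    rw [this]
    refine sum_one_eq_zero_of_involution (fun x => (hf.1 x).ne') hf.2.1 _ fun x hx => ?_
    simp only [Set.Finite.mem_toFinset, Set.mem_inter_iff] at hx ⊢
    exact ⟨hX x hx.1, hDf x hx.2⟩
  · have h1 : ∀ x ∈ X \ D, m x ∈ X \ D := by
      intro x hx
      refine ⟨?_, hDm x hx.2⟩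
      have : f x = m x := not_not.1 hx.2
      rw [← this]; exact hX x hx.1
    intro x
    by_cases hx : x ∈ X \ D
    · rw [Set.indicator_of_mem hx, Set.indicator_of_mem (h1 x hx)]; rfl
    · rw [Set.indicator_of_notMem hx, Set.indicator_of_notMem]
      intro h'
      apply hx
      have := h1 _ h'
      rwa [h.2.1] at this

end Basic

/-! ### Tight sets and uncrossing -/

section Uncrossing

variable {V : Type*} {G : SimpleGraph V} {m : V → V}

/-- The parity of vertex sets given by `exists_parity`. -/
noncomputable def par (h : MatchCov G m) : Set V → ZMod 2 := (exists_parity h.mem).choose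

theorem ZMod2.eq_one_of_ne {a : ZMod 2} (h : a ≠ 0) : a = 1 := by
  revert h; revert a; decide

theorem ZMod2.eq_zero_or_one (a : ZMod 2) : a = 0 ∨ a = 1 := by
  revert a; decide

theorem par_union (h : MatchCov G m) {A B : Set V} (hd : Disjoint A B) :
    par h (A ∪ B) = par h A + par h B := (exists_parity h.mem).choose_spec.1 A B hd

theorem par_closed (h : MatchCov G m) {f : V → V} (hf : f ∈ Mates G m) {X : Set V}
    (hX : ∀ x ∈ X, f x ∈ X) : par h X = 0 := (exists_parity h.mem).choose_spec.2.1 f hf X hX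

/-- A set that some matching leaves at exactly one vertex is odd. -/
theorem par_of_cross (h : MatchCov G m) {f : V → V} (hf : f ∈ Mates G m) {X : Set V} {c : V}
    (hc : c ∈ X) (hfc : f c ∉ X) (hu : ∀ y ∈ X, f y ∉ X → y = c) : par h X = 1 := by
  have e : X = {c} ∪ (X \ {c}) := by rw [Set.union_sdiff_cancel]; simpa using hc
  have h1 : par h {c} = 1 := (exists_parity h.mem).choose_spec.2.2 c
  rw [e, par_union h Set.disjoint_sdiff_right, h1, par_closed h hf, add_zero]
  have := hf.2.1
  rintro x ⟨hx, hxc⟩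
  refine ⟨by_contra fun h' => hxc (hu x hx h'), fun h' => ?_⟩
  rw [Set.mem_singleton_iff] at h'
  rw [← h', this] at hfc
  exact hfc hx

theorem par_empty (h : MatchCov G m) : par h ∅ = 0 := par_closed h h.mem (by simp)

theorem par_univ (h : MatchCov G m) : par h Set.univ = 0 := par_closed h h.mem (by simp)

theorem par_split (h : MatchCov G m) (X Y : Set V) :
    par h X = par h (X ∩ Y) + par h (X \ Y) := by
  rw [← par_union h Set.disjoint_sdiff_inter.symm, Set.inter_union_sdiff]

theorem par_compl (h : MatchCov G m) (X : Set V) : par h Xᶜ = par h X := by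
  have := par_split h Set.univ X
  rw [par_univ, Set.univ_inter, ← Set.compl_eq_univ_sdiff] at this
  grind

theorem Tight.cross {X : Set V} (hX : Tight G m X) {f : V → V} (hf : f ∈ Mates G m) :
    ∃ c ∈ X, f c ∉ X ∧ ∀ y ∈ X, f y ∉ X → y = c := by
  obtain ⟨c, hc, hu⟩ := hX f hf
  exact ⟨c, hc.1, hc.2, fun y hy hy' => hu y ⟨hy, hy'⟩⟩

theorem Tight.unique {X : Set V} (hX : Tight G m X) {f : V → V} (hf : f ∈ Mates G m) {x y : V}
    (hx : x ∈ X) (hfx : f x ∉ X) (hy : y ∈ X) (hfy : f y ∉ X) : x = y :=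
  (hX f hf).unique ⟨hx, hfx⟩ ⟨hy, hfy⟩

theorem Tight.par (h : MatchCov G m) {X : Set V} (hX : Tight G m X) : par h X = 1 := by
  obtain ⟨c, h1, h2, h3⟩ := hX.cross h.mem
  exact par_of_cross h h.mem h1 h2 h3

theorem Tight.nonempty (h : MatchCov G m) {X : Set V} (hX : Tight G m X) : X.Nonempty := by
  obtain ⟨c, h1, -⟩ := hX.cross h.mem
  exact ⟨c, h1⟩

theorem Tight.compl {X : Set V} (hX : Tight G m X) : Tight G m Xᶜ := by
  intro f hf
  obtain ⟨c, h1, h2, h3⟩ := hX.cross hf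
  have := hf.2.1
  refine ⟨f c, ⟨h2, by simpa [this] using h1⟩, ?_⟩
  rintro y ⟨hy, hy'⟩
  have h4 := h3 (f y) (by simpa using hy') (by rw [this]; exact hy)
  rw [← h4, this]

/-- A crossing vertex exists in sets of parity one. -/
theorem exists_cross (h : MatchCov G m) {f : V → V} (hf : f ∈ Mates G m) {X : Set V}
    (hX : par h X = 1) : ∃ x ∈ X, f x ∉ X := by
  by_contra! hc
  rw [par_closed h hf hc] at hX
  exact absurd hX (by decide)

/-- In a set of parity zero, crossing vertices do not come alone. -/
theorem exists_cross_ne (h : MatchCov G m) {f : V → V} (hf : f ∈ Mates G m) {X : Set V}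
    (hX : par h X = 0) {x : V} (hx : x ∈ X) (hfx : f x ∉ X) : ∃ y ∈ X, f y ∉ X ∧ y ≠ x := by
  by_contra! hc
  rw [par_of_cross h hf hx hfx hc] at hX
  exact absurd hX (by decide)

/-- A set without edges to its complement is empty or everything. -/
theorem eq_empty_of_closed (h : MatchCov G m) {X : Set V} (hX : ∀ x ∈ X, ∀ y, G.Adj x y → y ∈ X)
    {z : V} (hz : z ∉ X) : X = ∅ := by
  by_contra hne
  obtain ⟨x, hx⟩ := Set.nonempty_iff_ne_empty.2 hne
  apply hz
  obtain ⟨w⟩ := h.conn.preconnected x z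
  induction w with
  | nil => exact hx
  | cons a _ ih => exact ih hz (hX _ hx _ a)

/-- A nonempty proper subset that no matching leaves twice is tight: if it were even, it would never
be left and could not be connected to its complement. -/
theorem tight_of_le_one (h : MatchCov G m) {X : Set V} (hX : X.Nonempty) {z : V} (hz : z ∉ X)
    (hc : ∀ f ∈ Mates G m, ∀ x ∈ X, f x ∉ X → ∀ y ∈ X, f y ∉ X → x = y) : Tight G m X := by
  have h1 : par h X = 1 := by
    apply ZMod2.eq_one_of_ne
    intro h0
    have := eq_empty_of_closed h (X := X) ?_ hz
    · rw [this] at hX; exact Set.not_nonempty_empty hX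
    · intro x hx y hxy
      obtain ⟨f, hf, rfl⟩ := h.cov x y hxy
      by_contra hy
      obtain ⟨z, hz, hfz, hne⟩ := exists_cross_ne h hf h0 hx hy
      exact hne (hc f hf z hz hfz x hx hy)
  intro f hf
  obtain ⟨x, hx, hfx⟩ := exists_cross h hf h1
  exact ⟨x, ⟨hx, hfx⟩, fun y hy => hc f hf y hy.1 hy.2 x hx hfx⟩

theorem tight_of_par (h : MatchCov G m) {X : Set V} (hX : par h X = 1)
    (hc : ∀ f ∈ Mates G m, ∀ x ∈ X, f x ∉ X → ∀ y ∈ X, f y ∉ X → x = y) : Tight G m X := by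
  intro f hf
  obtain ⟨x, hx, hfx⟩ := exists_cross h hf hX
  exact ⟨x, ⟨hx, hfx⟩, fun y hy => hc f hf y hy.1 hy.2 x hx hfx⟩

/-- If tight sets meet oddly, every matching leaves both `X ∩ Y` and the complement of `X ∪ Y`. -/
theorem exists_cross_inter_compl_union (h : MatchCov G m) {X Y : Set V} (hX : Tight G m X)
    (hY : Tight G m Y) (hp : par h (X ∩ Y) = 1) {f : V → V} (hf : f ∈ Mates G m) :
    (∃ a ∈ X ∩ Y, f a ∉ X ∩ Y) ∧ ∃ b, b ∉ X ∪ Y ∧ f b ∈ X ∪ Y := by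
  refine ⟨exists_cross h hf hp, ?_⟩
  have h1 : par h (X ∪ Y)ᶜ = 1 := by
    rw [par_compl]
    have h2 := par_split h (X ∪ Y) X
    rw [Set.union_inter_cancel_left, Set.union_sdiff_left] at h2
    have h3 := par_split h Y X
    rw [Set.inter_comm] at h3
    rw [hX.par h] at h2
    rw [hY.par h] at h3
    grind
  obtain ⟨b, hb, hfb⟩ := exists_cross h hf h1
  exact ⟨b, hb, not_not.1 hfb⟩

/-- Uncrossing: tight sets that meet oddly have a tight intersection. -/
theorem inter_tight (h : MatchCov G m) {X Y : Set V} (hX : Tight G m X) (hY : Tight G m Y)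
    (hp : par h (X ∩ Y) = 1) : Tight G m (X ∩ Y) := by
  refine tight_of_par h hp fun f hf x hx hfx y hy hfy => ?_
  obtain ⟨-, b, hb, hfb⟩ := exists_cross_inter_compl_union h hX hY hp hf
  obtain ⟨c, hc, hfc, hcu⟩ := hX.cross hf
  obtain ⟨d, hd, hfd, hdu⟩ := hY.cross hf
  have := hf.2.1
  grind

/-- Uncrossing: if tight sets meet oddly, there are no edges between their differences. -/
theorem no_edge_of_inter (h : MatchCov G m) {X Y : Set V} (hX : Tight G m X) (hY : Tight G m Y)
    (hp : par h (X ∩ Y) = 1) {x y : V} (hx : x ∈ X) (hx' : x ∉ Y) (hy : y ∈ Y) (hy' : y ∉ X) :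
    ¬ G.Adj x y := by
  intro a
  obtain ⟨f, hf, rfl⟩ := h.cov _ _ a
  obtain ⟨z, hz, hfz⟩ := exists_cross h hf hp
  have hxx := hf.2.1 x
  have h1 : z ∈ X → f z ∉ X → z = x := fun h1 h2 => hX.unique hf h1 h2 hx hy'
  have h2 : z ∈ Y → f z ∉ Y → z = f x := fun h1 h2 => hY.unique hf h1 h2 hy (by rwa [hxx])
  grind

theorem par_inter_compl (h : MatchCov G m) {X Y : Set V} (hX : Tight G m X)
    (hp : par h (X ∩ Y) = 0) : par h (X ∩ Yᶜ) = 1 := by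
  have := par_split h X Y
  rw [hX.par h, hp, zero_add] at this
  exact this.symm

/-- Uncrossing: tight sets that meet oddly have a tight union. -/
theorem union_tight (h : MatchCov G m) {X Y : Set V} (hX : Tight G m X) (hY : Tight G m Y)
    (hp : par h (X ∩ Y) = 1) : Tight G m (X ∪ Y) := by
  have : X ∪ Y = (Xᶜ ∩ Yᶜ)ᶜ := by rw [← Set.compl_union, compl_compl]
  rw [this]
  refine (inter_tight h hX.compl hY.compl ?_).compl
  rw [← Set.compl_union, par_compl]
  have h2 := par_split h (X ∪ Y) X
  rw [Set.union_inter_cancel_left, Set.union_sdiff_left] at h2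
  have h3 := par_split h Y X
  rw [Set.inter_comm] at h3
  rw [hX.par h] at h2
  rw [hY.par h] at h3
  grind

/-- Uncrossing: tight sets that meet evenly have tight differences. -/
theorem sdiff_tight (h : MatchCov G m) {X Y : Set V} (hX : Tight G m X) (hY : Tight G m Y)
    (hp : par h (X ∩ Y) = 0) : Tight G m (X \ Y) :=
  inter_tight h hX hY.compl (par_inter_compl h hX hp)

/-- Uncrossing: if tight sets meet evenly, no edge leads from their intersection out of their union.
-/
theorem no_edge_of_sdiff (h : MatchCov G m) {X Y : Set V} (hX : Tight G m X) (hY : Tight G m Y)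
    (hp : par h (X ∩ Y) = 0) {x y : V} (hx : x ∈ X) (hx' : x ∈ Y) (hy : y ∉ X) (hy' : y ∉ Y) :
    ¬ G.Adj x y :=
  no_edge_of_inter h hX hY.compl (par_inter_compl h hX hp) hx (by simpa using hx')
    (by simpa using hy') hy

/-- An even part `S` of a tight set `y` that sends no edge out of `y` is empty. -/
theorem eq_empty_of_nbr_subset (h : MatchCov G m) {y S : Set V} (hy : Tight G m y) (hS : S ⊆ y)
    (hyS : Tight G m (y \ S)) (hN : ∀ x ∈ S, ∀ z, G.Adj x z → z ∈ y) : S = ∅ := by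
  obtain ⟨z, hz⟩ := hyS.nonempty h
  refine eq_empty_of_closed h ?_ hz.2
  intro x hx z a
  by_contra hzS
  obtain ⟨f, hf, rfl⟩ := h.cov _ _ a
  obtain ⟨c, hc, hfc, hcu⟩ := hy.cross hf
  have hcS : c ∉ S := fun hcS => hfc (hN c hcS _ (hf.1 c))
  have h1 := hyS.unique hf ⟨hc, hcS⟩ (fun h' => hfc h'.1) ⟨hN x hx _ a, hzS⟩
    (by rw [hf.2.1]; exact fun h' => h'.2 hx)
  rw [h1, hf.2.1] at hfc
  exact hfc (hS hx)

/-- Moving an even part `S` of the tight set `y` to a tight set `X` that, together with `y`,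
receives all edges from `S`. -/
theorem union_tight_of_nbr_subset (h : MatchCov G m) {y S X : Set V} (hy : Tight G m y)
    (hS : S ⊆ y) (hyS : Tight G m (y \ S)) (hX : Tight G m X) (hd : Disjoint X y)
    (hN : ∀ x ∈ S, ∀ z, G.Adj x z → z ∈ y ∪ X) : Tight G m (X ∪ S) := by
  have hp : par h (X ∪ S) = 1 := by
    rw [par_union h (hd.mono_right hS), hX.par h]
    have := par_split h y S
    rw [hy.par h, hyS.par h, Set.inter_eq_right.2 hS] at this
    grind
  refine tight_of_par h hp fun f hf a ha hfa b hb hfb => ?_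
  obtain ⟨c, hc, hfc, hcu⟩ := hX.cross hf
  obtain ⟨d, hd', hfd, hdu⟩ := hy.cross hf
  obtain ⟨e, he, hfe, heu⟩ := hyS.cross hf
  have := hf.2.1
  have h1 := fun x hx => hN x hx _ (hf.1 x)
  have h2 := Set.disjoint_left.1 hd
  grind

/-- Removing from a tight set several disjoint parts, each of which can be removed. -/
theorem sdiff_iUnion_tight (h : MatchCov G m) {κ : Type*} {B : Set V} {D : κ → Set V}
    (hB : Tight G m B) (hD : ∀ i, D i ⊆ B) (hBD : ∀ i, Tight G m (B \ D i))
    (hdis : ∀ i j, i ≠ j → Disjoint (D i) (D j)) (hne : (B \ ⋃ i, D i).Nonempty) :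
    Tight G m (B \ ⋃ i, D i) := by
  obtain ⟨z, hz⟩ := hB.compl.nonempty h
  refine tight_of_le_one h hne (z := z) (fun h' => hz h'.1) ?_
  have h0 : ∀ i, par h (D i) = 0 := by
    intro i
    have := par_split h B (D i)
    rw [hB.par h, (hBD i).par h, Set.inter_eq_right.2 (hD i)] at this
    grind
  have h2 : ∀ i j, Tight G m (B \ (D i ∪ D j)) := by
    intro i j
    by_cases hij : i = j
    · subst hij; rw [Set.union_self]; exact hBD i
    · have h5 : B \ (D i ∪ D j) = (B \ D i) ∩ (B \ D j) := by grind
      rw [h5]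
      refine inter_tight h (hBD i) (hBD j) ?_
      have h1 := par_split h (B \ D i) (D j)
      have h3 : (B \ D i) ∩ D j = D j := by
        have := hD j; have := hdis i j hij; grind
      rw [h3, h0, (hBD i).par h] at h1
      have h4 : B \ D i ∩ (B \ D j) = (B \ D i) \ D j := by grind
      rw [h4]; grind
  intro f hf x hx hfx y hy hfy
  have key : ∀ x, x ∈ B \ ⋃ i, D i → f x ∉ B \ ⋃ i, D i → f x ∉ B ∨ ∃ i, f x ∈ D i := by
    intro x hx hfx
    by_cases hb : f x ∈ B
    · right
      by_contra! hcon
      exact hfx ⟨hb, by simpa using hcon⟩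
    · exact Or.inl hb
  have hm : ∀ x, x ∈ B \ ⋃ i, D i → ∀ i j, x ∈ B \ (D i ∪ D j) := by
    intro x hx i j
    refine ⟨hx.1, ?_⟩
    have := hx.2
    simp only [Set.mem_iUnion, not_exists] at this
    simp [this]
  rcases key x hx hfx with h3 | ⟨i, h3⟩ <;> rcases key y hy hfy with h4 | ⟨j, h4⟩
  · exact hB.unique hf hx.1 h3 hy.1 h4
  · exact (h2 j j).unique hf (hm x hx _ _) (fun h' => h3 h'.1) (hm y hy _ _) (by simp [h4])
  · exact (h2 i i).unique hf (hm x hx _ _) (by simp [h3]) (hm y hy _ _) (fun h' => h4 h'.1)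
  · exact (h2 i j).unique hf (hm x hx _ _) (by simp [h3]) (hm y hy _ _) (by simp [h4])

end Uncrossing

/-! ### Frames: the common shape of collapses and torsoids -/

section Frames

variable {V ι : Type*} {G : SimpleGraph V} {m : V → V} {H : SimpleGraph ι} {v : ι → Set V}
  {E : ι → ι → Set V}

/-- A graph `H` whose vertices `i` carry disjoint tight sets `v i` and whose edges `ij` carry
disjoint, possibly empty sets `E i j`, all of them together covering `V`, such that `H` is the
adjacency of the sets. The set `E i j` can be added to either end without losing tightness. Both
the collapse of a tight set partition (with `E = ∅`) and a torsoid are of this kind. -/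
structure IsFrame (G : SimpleGraph V) (m : V → V) (H : SimpleGraph ι) (v : ι → Set V)
    (E : ι → ι → Set V) : Prop where
  tight : ∀ i, Tight G m (v i)
  tight_union : ∀ i j, H.Adj i j → Tight G m (v i ∪ E i j)
  symm : ∀ i j, E i j = E j i
  adj_of_mem : ∀ i j x, x ∈ E i j → H.Adj i j
  eq_of_mem : ∀ i j x, x ∈ v i → x ∈ v j → i = j
  notMem : ∀ i j k x, x ∈ v i → x ∉ E j k
  edge_eq_of_mem : ∀ i j k l x, x ∈ E i j → x ∈ E k l → s(i, j) = s(k, l)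
  cover : ∀ x, (∃ i, x ∈ v i) ∨ ∃ i j, x ∈ E i j
  edge : ∀ i j, H.Adj i j → ∃ x ∈ v i ∪ E i j, ∃ y ∈ v j, G.Adj x y
  no_edge : ∀ i j, i ≠ j → ¬ H.Adj i j → ∀ x ∈ v i, ∀ y ∈ v j, ¬ G.Adj x y

/-- The matching `f` uses the edge `ij` of the frame, that is, it matches `i` to `j`. -/
def Uses (H : SimpleGraph ι) (v : ι → Set V) (E : ι → ι → Set V) (f : V → V) (i j : ι) : Prop :=
  H.Adj i j ∧ ∃ x ∈ v i, f x ∈ v j ∪ E i j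

theorem IsFrame.disjoint_vert (F : IsFrame G m H v E) {i j : ι} (hij : i ≠ j) :
    Disjoint (v i) (v j) := Set.disjoint_left.2 fun _ hx hy => hij (F.eq_of_mem _ _ _ hx hy)

namespace IsFrame

variable (h : MatchCov G m) (F : IsFrame G m H v E)

include h F

theorem par_edge (i j : ι) : par h (E i j) = 0 := by
  by_cases a : H.Adj i j
  · have h1 := (F.tight_union i j a).par h
    rw [par_union h (Set.disjoint_left.2 fun x hx => F.notMem i i j x hx), (F.tight i).par h] at h1
    grind
  · have : E i j = ∅ := Set.eq_empty_of_forall_notMem fun x hx => a (F.adj_of_mem i j x hx)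
    rw [this, par_empty]

/-- The neighbours of `E i j` outside of it lie in `v i` and `v j`: uncross `v i ∪ E i j` and `v j ∪
E i j`. -/
theorem nbr_edge {i j : ι} {x y : V} (hx : x ∈ E i j) (a : G.Adj x y) :
    y ∈ v i ∨ y ∈ v j ∨ y ∈ E i j := by
  have hij := F.adj_of_mem i j x hx
  by_contra! hc
  have hji : E j i = E i j := F.symm j i
  have e : (v i ∪ E i j) ∩ (v j ∪ E j i) = E i j := by
    have h1 := F.notMem
    have h2 := fun x hi hj => hij.ne (F.eq_of_mem i j x hi hj)
    ext z; have := h1 i i j z; have := h1 j i j z; have := h2 z; grind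
  refine no_edge_of_sdiff h (F.tight_union i j hij) (F.tight_union j i hij.symm) ?_
    (Or.inr hx) (Or.inr (hji ▸ hx)) ?_ ?_ a
  · rw [e, F.par_edge h]
  · grind
  · grind

theorem nbr_vert {i : ι} {x y : V} (hx : x ∈ v i) (a : G.Adj x y) :
    y ∈ v i ∨ ∃ j, H.Adj i j ∧ (y ∈ v j ∨ y ∈ E i j) := by
  rcases F.cover y with ⟨j, hj⟩ | ⟨j, k, hjk⟩
  · by_cases hij : i = j
    · subst hij; exact Or.inl hj
    · refine Or.inr ⟨j, ?_, Or.inl hj⟩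
      by_contra hn
      exact F.no_edge i j hij hn x hx y hj a
  · right
    rcases F.nbr_edge h hjk a.symm with h1 | h1 | h1
    · obtain rfl := F.eq_of_mem _ _ _ hx h1
      exact ⟨k, F.adj_of_mem _ _ _ hjk, Or.inr hjk⟩
    · obtain rfl := F.eq_of_mem _ _ _ hx h1
      exact ⟨j, (F.adj_of_mem _ _ _ hjk).symm, Or.inr (F.symm i j ▸ hjk)⟩
    · exact absurd h1 (F.notMem _ _ _ _ hx)

theorem exists_uses {f : V → V} (hf : f ∈ Mates G m) (i : ι) : ∃ j, Uses H v E f i j := by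
  obtain ⟨c, hc, hfc, -⟩ := (F.tight i).cross hf
  rcases F.nbr_vert h hc (hf.1 c) with h1 | ⟨j, hj, h1⟩
  · exact absurd h1 hfc
  · exact ⟨j, hj, c, hc, h1⟩

omit h in
theorem uses_unique {f : V → V} (hf : f ∈ Mates G m) {i j k : ι} (h1 : Uses H v E f i j)
    (h2 : Uses H v E f i k) : j = k := by
  obtain ⟨a1, x, hx, hfx⟩ := h1
  obtain ⟨a2, y, hy, hfy⟩ := h2
  have key : ∀ z j, H.Adj i j → f z ∈ v j ∪ E i j → f z ∉ v i := by
    rintro z j a hz hz'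
    rcases hz with hz | hz
    · exact a.ne (F.eq_of_mem _ _ _ hz' hz)
    · exact F.notMem _ _ _ _ hz' hz
  obtain rfl := (F.tight i).unique hf hx (key x j a1 hfx) hy (key y k a2 hfy)
  rcases hfx with h1 | h1 <;> rcases hfy with h2 | h2
  · exact F.eq_of_mem _ _ _ h1 h2
  · exact absurd h2 (F.notMem _ _ _ _ h1)
  · exact absurd h1 (F.notMem _ _ _ _ h2)
  · have := F.edge_eq_of_mem _ _ _ _ _ h1 h2
    rcases Sym2.eq_iff.1 this with ⟨-, h⟩ | ⟨h, h'⟩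
    · exact h
    · rw [h', h]

/-- That `f` matches `i` to `j` is symmetric, although its definition is not: if `f` leads from `v
i` into the even set `E i j`, then it also leads from `E i j` to `v j`. -/
theorem uses_symm {f : V → V} (hf : f ∈ Mates G m) {i j : ι} (h1 : Uses H v E f i j) :
    Uses H v E f j i := by
  obtain ⟨a, x, hx, hfx⟩ := h1
  rcases hfx with hfx | hfx
  · exact ⟨a.symm, f x, hfx, by rw [hf.2.1]; exact Or.inl hx⟩
  · obtain ⟨c, hc, hfc, -⟩ := (F.tight_union i j a).cross hf
    have hx' : f x ∉ v i := fun h' => F.notMem _ _ _ _ h' hfx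
    rcases hc with hc | hc
    · obtain rfl := (F.tight i).unique hf hx hx' hc (fun h' => hfc (Or.inl h'))
      exact absurd (Or.inr hfx) hfc
    · rcases F.nbr_edge h hc (hf.1 c) with h2 | h2 | h2
      · exact absurd (Or.inl h2) hfc
      · refine ⟨a.symm, f c, h2, ?_⟩
        rw [hf.2.1, F.symm j i]; exact Or.inr hc
      · exact absurd (Or.inr h2) hfc

/-- A used edge together with its ends is closed under the matching. -/
theorem uses_closed {f : V → V} (hf : f ∈ Mates G m) {i j : ι} (h1 : Uses H v E f i j) :
    ∀ x ∈ v i ∪ v j ∪ E i j, f x ∈ v i ∪ v j ∪ E i j := by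
  have key : ∀ i j, Uses H v E f i j → ∀ x ∈ v i, f x ∈ v i ∪ v j ∪ E i j := by
    intro i j h1 x hx
    rcases F.nbr_vert h hx (hf.1 x) with h2 | ⟨k, hk, h2⟩
    · exact Or.inl (Or.inl h2)
    · obtain rfl := F.uses_unique hf h1 ⟨hk, x, hx, h2⟩
      rcases h2 with h2 | h2
      · exact Or.inl (Or.inr h2)
      · exact Or.inr h2
  rintro x ((hx | hx) | hx)
  · exact key i j h1 x hx
  · have := key j i (F.uses_symm h hf h1) x hx
    rwa [Set.union_comm (v j), F.symm j i] at this
  · rcases F.nbr_edge h hx (hf.1 x) with h2 | h2 | h2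
    · exact Or.inl (Or.inl h2)
    · exact Or.inl (Or.inr h2)
    · exact Or.inr h2

/-- An unused edge is closed under the matching. -/
theorem closed_of_not_uses {f : V → V} (hf : f ∈ Mates G m) {i j : ι}
    (h1 : ¬ Uses H v E f i j) : ∀ x ∈ E i j, f x ∈ E i j := by
  intro x hx
  have a := F.adj_of_mem _ _ _ hx
  rcases F.nbr_edge h hx (hf.1 x) with h2 | h2 | h2
  · exact absurd ⟨a, f x, h2, by rw [hf.2.1]; exact Or.inr hx⟩ h1
  · refine absurd (F.uses_symm h hf ⟨a.symm, f x, h2, ?_⟩) h1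
    rw [hf.2.1, F.symm j i]; exact Or.inr hx
  · exact h2

theorem exists_uses_of_adj {i j : ι} (a : H.Adj i j) : ∃ f ∈ Mates G m, Uses H v E f i j := by
  obtain ⟨x, hx, y, hy, hxy⟩ := F.edge i j a
  obtain ⟨f, hf, rfl⟩ := h.cov x y hxy
  refine ⟨f, hf, F.uses_symm h hf ⟨a.symm, f x, hy, ?_⟩⟩
  rw [hf.2.1, F.symm j i]; exact hx

/-- The graph of a frame is connected because `G` is. -/
theorem connected : H.Connected := by
  have hne : Nonempty ι := by
    obtain ⟨x⟩ := h.conn.nonempty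
    rcases F.cover x with ⟨i, -⟩ | ⟨i, -, -⟩ <;> exact ⟨i⟩
  refine ⟨fun i k => ?_⟩
  by_contra hk
  obtain ⟨z, hz⟩ := (F.tight k).nonempty h
  obtain ⟨y, hy⟩ := (F.tight i).nonempty h
  have hcl := eq_empty_of_closed h
    (X := {x | ∃ j, H.Reachable i j ∧ (x ∈ v j ∨ ∃ k, x ∈ E j k)}) ?_ (z := z) ?_
  · have : y ∈ {x | ∃ j, H.Reachable i j ∧ (x ∈ v j ∨ ∃ k, x ∈ E j k)} := ⟨i, .refl _, Or.inl hy⟩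
    rw [hcl] at this
    exact this
  · rintro x ⟨j, hj, hx | ⟨l, hx⟩⟩ y a
    · rcases F.nbr_vert h hx a with h2 | ⟨l, hl, h2 | h2⟩
      · exact ⟨j, hj, Or.inl h2⟩
      · exact ⟨l, hj.trans hl.reachable, Or.inl h2⟩
      · exact ⟨j, hj, Or.inr ⟨l, h2⟩⟩
    · have hl := F.adj_of_mem _ _ _ hx
      rcases F.nbr_edge h hx a with h2 | h2 | h2
      · exact ⟨j, hj, Or.inl h2⟩
      · exact ⟨l, hj.trans hl.reachable, Or.inl h2⟩
      · exact ⟨j, hj, Or.inr ⟨l, h2⟩⟩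
  · rintro ⟨j, hj, h2 | ⟨l, h2⟩⟩
    · obtain rfl := F.eq_of_mem _ _ _ hz h2
      exact hk hj
    · exact F.notMem _ _ _ _ hz h2

end IsFrame

/-- The matching `f` of `G` induces the matching `g` of the frame. -/
def Induces (H : SimpleGraph ι) (v : ι → Set V) (E : ι → ι → Set V) (f : V → V) (g : ι → ι) :
    Prop := ∀ i, Uses H v E f i (g i)

namespace IsFrame

variable (h : MatchCov G m) (F : IsFrame G m H v E)

include h F

theorem exists_induces {f : V → V} (hf : f ∈ Mates G m) : ∃ g, Induces H v E f g := by
  choose g hg using F.exists_uses h hf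
  exact ⟨g, hg⟩

omit h in
theorem uses_iff {f : V → V} (hf : f ∈ Mates G m) {g : ι → ι} (hg : Induces H v E f g) (i j : ι) :
    Uses H v E f i j ↔ g i = j :=
  ⟨fun hu => F.uses_unique hf (hg i) hu, by rintro rfl; exact hg i⟩

theorem induces_mem_mates {μ g : ι → ι} {f : V → V} (hμ : Induces H v E m μ)
    (hf : f ∈ Mates G m) (hg : Induces H v E f g) : g ∈ Mates H μ := by
  refine ⟨fun i => (hg i).1, fun i => ?_, ?_⟩
  · exact (F.uses_iff hf hg _ _).1 (F.uses_symm h hf (hg i))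
  · -- where `g` and `μ` differ, `f` and `m` differ at the crossing vertex of `f`
    choose c hc hfc using fun i => (hg i).2
    refine Set.Finite.of_injOn (f := c) (t := {x | f x ≠ m x}) ?_ ?_ hf.2.2
    · intro i hi he
      apply hi
      refine ((F.uses_iff h.mem hμ _ _).1 ⟨(hg i).1, c i, hc i, ?_⟩).symm
      rw [← he]; exact hfc i
    · intro i _ j _ hij
      exact F.eq_of_mem _ _ (c i) (hc i) (hij ▸ hc j)

/-- Every matching of the frame lifts to `G`: on each vertex and edge of the frame one restricts
a matching of `G` that treats the edge in question as prescribed, taking `m` whenever it does. -/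
theorem exists_lift {μ g : ι → ι} (hμ : Induces H v E m μ) (hg : g ∈ Mates H μ) :
    ∃ f ∈ Mates G m, Induces H v E f g := by
  classical
  let U : (V → V) → Sym2 ι → Prop := fun f e => ∃ i j, e = s(i, j) ∧ Uses H v E f i j
  have hU : ∀ f ∈ Mates G m, ∀ i j, U f s(i, j) ↔ Uses H v E f i j := by
    intro f hf i j
    constructor
    · rintro ⟨k, l, he, hu⟩
      rcases Sym2.eq_iff.1 he with ⟨rfl, rfl⟩ | ⟨rfl, rfl⟩
      · exact hu
      · exact F.uses_symm h hf hu
    · intro hu; exact ⟨i, j, rfl, hu⟩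
  let b : Sym2 ι → Prop := fun e => ∃ i, e = s(i, g i)
  have hb : ∀ i j, b s(i, j) ↔ g i = j := by
    intro i j
    constructor
    · rintro ⟨k, he⟩
      rcases Sym2.eq_iff.1 he with ⟨rfl, rfl⟩ | ⟨rfl, rfl⟩
      · rfl
      · exact hg.2.1 _
    · rintro rfl; exact ⟨i, rfl⟩
  have hW : ∀ e : Sym2 ι, ∃ w ∈ Mates G m, ((∃ f ∈ Mates G m, (U f e ↔ b e)) → (U w e ↔ b e)) ∧
      ((U m e ↔ b e) → w = m) := by
    intro e
    by_cases h1 : U m e ↔ b e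
    · exact ⟨m, h.mem, fun _ => h1, fun _ => rfl⟩
    · by_cases h2 : ∃ f ∈ Mates G m, (U f e ↔ b e)
      · obtain ⟨f, hf, hfe⟩ := h2
        exact ⟨f, hf, fun _ => hfe, fun h' => absurd h' h1⟩
      · exact ⟨m, h.mem, fun h' => absurd h' h2, fun _ => rfl⟩
  choose w hwm hw1 hw2 using hW
  have hw : ∀ i j, H.Adj i j → (Uses H v E (w s(i, j)) i j ↔ g i = j) := by
    intro i j a
    rw [← hU _ (hwm _), ← hb]
    apply hw1
    by_cases hgi : g i = j
    · obtain ⟨f, hf, hu⟩ := F.exists_uses_of_adj h a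
      exact ⟨f, hf, by rw [hU f hf, hb]; exact ⟨fun _ => hgi, fun _ => hu⟩⟩
    · obtain ⟨f, hf, hu⟩ := F.exists_uses_of_adj h (hg.1 i)
      refine ⟨f, hf, ?_⟩
      rw [hU f hf, hb]
      exact ⟨fun h' => F.uses_unique hf hu h', fun h' => absurd h' hgi⟩
  have hex : ∀ x, ∃ e : Sym2 ι, (∃ i, x ∈ v i ∧ e = s(i, g i)) ∨
      ∃ i j, x ∈ E i j ∧ e = s(i, j) := by
    intro x
    rcases F.cover x with ⟨i, hi⟩ | ⟨i, j, hij⟩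
    · exact ⟨_, Or.inl ⟨i, hi, rfl⟩⟩
    · exact ⟨_, Or.inr ⟨i, j, hij, rfl⟩⟩
  choose e he using hex
  have he1 : ∀ i x, x ∈ v i → e x = s(i, g i) := by
    intro i x hx
    rcases he x with ⟨j, hj, h1⟩ | ⟨j, k, hj, h1⟩
    · rw [h1, F.eq_of_mem _ _ _ hx hj]
    · exact absurd hj (F.notMem _ _ _ _ hx)
  have he2 : ∀ i j x, x ∈ E i j → e x = s(i, j) := by
    intro i j x hx
    rcases he x with ⟨k, hj, h1⟩ | ⟨k, l, hj, h1⟩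
    · exact absurd hx (F.notMem _ _ _ _ hj)
    · rw [h1, F.edge_eq_of_mem _ _ _ _ _ hx hj]
  have hblock : ∀ i y, y ∈ v i ∪ v (g i) ∪ E i (g i) → e y = s(i, g i) := by
    rintro i y ((hy | hy) | hy)
    · exact he1 _ _ hy
    · rw [he1 _ _ hy, hg.2.1, Sym2.eq_swap]
    · exact he2 _ _ _ hy
  have hinv : ∀ x, e (w (e x) x) = e x := by
    intro x
    rcases he x with ⟨i, hi, h1⟩ | ⟨i, j, hij, h1⟩
    · rw [h1]
      exact hblock i _
        (F.uses_closed h (hwm _) ((hw i (g i) (hg.1 i)).2 rfl) x (Or.inl (Or.inl hi)))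
    · have a := F.adj_of_mem _ _ _ hij
      rw [h1]
      by_cases hgi : g i = j
      · subst hgi
        exact hblock i _ (F.uses_closed h (hwm _) ((hw i (g i) a).2 rfl) x (Or.inr hij))
      · exact he2 _ _ _ (F.closed_of_not_uses h (hwm _) (fun h' => hgi ((hw i j a).1 h')) x hij)
  refine ⟨fun x => w (e x) x, ⟨fun x => (hwm _).1 x, fun x => ?_, ?_⟩, fun i => ?_⟩
  · change w (e (w (e x) x)) (w (e x) x) = x
    rw [hinv]; exact (hwm _).2.1 x
  · have hbad : {e | w e ≠ m}.Finite := by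
      refine ((hg.2.2.image fun i => s(i, g i)).union (hg.2.2.image fun i => s(i, μ i))).subset ?_
      intro e he
      have h1 : ¬ (U m e ↔ b e) := fun h' => he (hw2 e h')
      by_cases hbe : b e
      · left
        obtain ⟨i, rfl⟩ := hbe
        refine ⟨i, fun h' => h1 ⟨fun _ => ⟨i, rfl⟩, fun _ => ?_⟩, rfl⟩
        rw [hU m h.mem, h']; exact hμ i
      · right
        have hue : U m e := by
          by_contra h'
          exact h1 ⟨fun h'' => absurd h'' h', fun h'' => absurd h'' hbe⟩
        obtain ⟨i, j, rfl, hu⟩ := hue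
        obtain rfl := (F.uses_iff h.mem hμ _ _).1 hu
        exact ⟨i, fun h' => hbe ⟨i, by rw [h']⟩, rfl⟩
    refine (hbad.biUnion fun e _ => (hwm e).2.2).subset fun x hx => ?_
    simp only [Set.mem_iUnion]
    exact ⟨e x, fun h' => hx (by simp [h']), hx⟩
  · obtain ⟨a, x, hx, hfx⟩ := (hw i (g i) (hg.1 i)).2 rfl
    refine ⟨a, x, hx, ?_⟩
    change w (e x) x ∈ _
    rw [he1 i x hx]; exact hfx

/-- The graph of a frame is matching covered with respect to the induced matching. -/
theorem matchCov {μ : ι → ι} (hμ : Induces H v E m μ) : MatchCov H μ := by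
  refine ⟨F.connected h, F.induces_mem_mates h hμ h.mem hμ, fun i j a => ?_⟩
  obtain ⟨f, hf, hu⟩ := F.exists_uses_of_adj h a
  obtain ⟨g, hg⟩ := F.exists_induces h hf
  exact ⟨g, F.induces_mem_mates h hμ hf hg, (F.uses_iff hf hg _ _).1 hu⟩

/-- Tightness in the graph of a frame can be tested on matchings of `G`. -/
theorem tight_iff {μ : ι → ι} (hμ : Induces H v E m μ) (X : Set ι) :
    Tight H μ X ↔ ∀ f ∈ Mates G m, ∀ g, Induces H v E f g → ∃! i, i ∈ X ∧ g i ∉ X := by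
  constructor
  · intro hX f hf g hg
    exact hX g (F.induces_mem_mates h hμ hf hg)
  · intro hX g hg
    obtain ⟨f, hf, hfg⟩ := F.exists_lift h hμ hg
    exact hX f hf g hfg

end IsFrame

section Parity

variable (h : MatchCov G m) (F : IsFrame G m H v E)

include h F

/-- If neither end of an edge meets `Z`, then an odd part of the edge set can only belong to a
tight set `Z` inside the edge set. -/
theorem IsFrame.subset_edge {i j : ι} (a : H.Adj i j) {Z : Set V} (hZ : Tight G m Z)
    (hi : Disjoint (v i) Z) (hj : Disjoint (v j) Z) (hE : par h (E i j ∩ Z) = 1) : Z ⊆ E i j := by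
  have hji := F.symm j i
  have hA := F.tight_union i j a
  have hB := F.tight_union j i a.symm
  rw [hji] at hB
  have hpA : par h ((v i ∪ E i j) ∩ Z) = 1 := by
    rw [show (v i ∪ E i j) ∩ Z = E i j ∩ Z by grind, hE]
  have hpB : par h ((v j ∪ E i j) ∩ Z) = 1 := by
    rw [show (v j ∪ E i j) ∩ Z = E i j ∩ Z by grind, hE]
  have hAZ := union_tight h hA hZ hpA
  have hBZ := union_tight h hB hZ hpB
  have hdij : Disjoint (v i) (v j) := F.disjoint_vert a.ne
  have hpI : par h (((v i ∪ E i j) ∪ Z) ∩ ((v j ∪ E i j) ∪ Z)) = 0 := by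
    rw [show ((v i ∪ E i j) ∪ Z) ∩ ((v j ∪ E i j) ∪ Z) = E i j ∪ Z by grind]
    have h1 := par_split h (E i j ∪ Z) Z
    have h2 := par_split h (E i j) Z
    rw [F.par_edge h, hE] at h2
    rw [Set.union_inter_cancel_right, Set.union_sdiff_right, hZ.par h] at h1
    grind
  obtain ⟨z, hz⟩ := (F.tight i).nonempty h
  have hcl := eq_empty_of_closed h (X := Z \ E i j) (z := z) ?_ (fun h' => hi.le_bot ⟨hz, h'.1⟩)
  · exact Set.sdiff_eq_empty.1 hcl
  · rintro x ⟨hx, hxE⟩ y hxy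
    have hxi : x ∉ v i := fun h' => hi.le_bot ⟨h', hx⟩
    have hxj : x ∉ v j := fun h' => hj.le_bot ⟨h', hx⟩
    by_contra hy
    by_cases hyE : y ∈ E i j
    · rcases F.nbr_edge h hyE hxy.symm with h1 | h1 | h1 <;> contradiction
    · have hyZ : y ∉ Z := fun h' => hy ⟨h', hyE⟩
      by_cases hyi : y ∈ v i
      · exact no_edge_of_inter h hA hZ hpA (Or.inl hyi) hyZ hx (by grind) hxy.symm
      by_cases hyj : y ∈ v j
      · exact no_edge_of_inter h hB hZ hpB (Or.inl hyj) hyZ hx (by grind) hxy.symm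
      exact no_edge_of_sdiff h hAZ hBZ hpI (Or.inr hx) (Or.inr hx) (by grind) (by grind) hxy

/-- A tight set that meets an edge set oddly and both ends evenly lies within the edge set and its
ends. -/
theorem IsFrame.subset_of_odd {i j : ι} (a : H.Adj i j) {Z : Set V} (hZ : Tight G m Z)
    (hi : par h (v i ∩ Z) = 0) (hj : par h (v j ∩ Z) = 0) (hE : par h (E i j ∩ Z) = 1) :
    Z ⊆ v i ∪ v j ∪ E i j := by
  have hdij : Disjoint (v i) (v j) := F.disjoint_vert a.ne
  have h1 := sdiff_tight h hZ (F.tight i) (by rwa [Set.inter_comm])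
  have h2 := sdiff_tight h h1 (F.tight j) (by
    rw [show (Z \ v i) ∩ v j = v j ∩ Z by grind, hj])
  have h3 := F.subset_edge h a h2 (by grind) (by grind) (by
    have := F.notMem i i j
    have := F.notMem j i j
    rw [show E i j ∩ ((Z \ v i) \ v j) = E i j ∩ Z by ext x; grind, hE])
  grind

/-- A tight set that misses both ends of an edge and meets the edge set evenly misses the edge
set. -/
theorem IsFrame.inter_edge_eq_empty {i j : ι} (a : H.Adj i j) {Z : Set V} (hZ : Tight G m Z)
    (hi : Disjoint (v i) Z) (hj : Disjoint (v j) Z) (hE : par h (E i j ∩ Z) = 0) :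
    E i j ∩ Z = ∅ := by
  have hdij : Disjoint (v i) (v j) := F.disjoint_vert a.ne
  have key : ∀ i j, H.Adj i j → Disjoint (v i) Z → Disjoint (v j) Z → par h (E i j ∩ Z) = 0 →
      ∀ x ∈ E i j ∩ Z, ∀ y ∈ v j, ¬ G.Adj x y := by
    intro i j a hi hj hE x hx y hy
    have hdij : Disjoint (v i) (v j) :=
      F.disjoint_vert a.ne
    have := F.notMem j i j y hy
    refine no_edge_of_sdiff h (F.tight_union i j a) hZ ?_ (Or.inr hx.1) hx.2 (by grind) (by grind)
    rw [show (v i ∪ E i j) ∩ Z = E i j ∩ Z by grind, hE]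
  have k1 := key i j a hi hj hE
  have k2 := key j i a.symm hj hi (by rwa [F.symm j i])
  rw [F.symm j i] at k2
  refine eq_empty_of_nbr_subset h (F.tight_union i j a) (by grind) ?_ ?_
  · rw [show (v i ∪ E i j) \ (E i j ∩ Z) = (v i ∪ E i j) \ Z by grind]
    refine sdiff_tight h (F.tight_union i j a) hZ ?_
    rw [show (v i ∪ E i j) ∩ Z = E i j ∩ Z by grind, hE]
  · intro x hx z hxz
    rcases F.nbr_edge h hx.1 hxz with h1 | h1 | h1
    · exact Or.inl h1
    · exact absurd hxz (k1 x hx z h1)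
    · exact Or.inr h1

/-- For a matching `f` and a set `Z`, the edges of the frame in which `f` has to cross `Z` for
parity reasons. -/
def Bad (h : MatchCov G m) (H : SimpleGraph ι) (v : ι → Set V) (E : ι → ι → Set V) (f : V → V)
    (Z : Set V) (i j : ι) : Prop :=
  (¬ Uses H v E f i j ∧ par h (E i j ∩ Z) = 1) ∨
    (Uses H v E f i j ∧ par h ((v i ∪ v j ∪ E i j) ∩ Z) = 1)

/-- As `f` crosses a tight set only once, there is at most one bad edge. -/
theorem IsFrame.bad_unique {f : V → V} (hf : f ∈ Mates G m) {Z : Set V} (hZ : Tight G m Z)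
    {i j k l : ι} (h1 : Bad h H v E f Z i j) (h2 : Bad h H v E f Z k l) : s(i, j) = s(k, l) := by
  have key : ∀ i j, Bad h H v E f Z i j → ∃ c ∈ Z, f c ∉ Z ∧ ((¬ Uses H v E f i j ∧ c ∈ E i j) ∨
      (Uses H v E f i j ∧ c ∈ v i ∪ v j ∪ E i j)) := by
    rintro i j (⟨hu, hp⟩ | ⟨hu, hp⟩)
    · obtain ⟨c, hc, hfc⟩ := exists_cross h hf hp
      exact ⟨c, hc.2, fun h' => hfc ⟨F.closed_of_not_uses h hf hu c hc.1, h'⟩, Or.inl ⟨hu, hc.1⟩⟩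
    · obtain ⟨c, hc, hfc⟩ := exists_cross h hf hp
      exact ⟨c, hc.2, fun h' => hfc ⟨F.uses_closed h hf hu c hc.1, h'⟩, Or.inr ⟨hu, hc.1⟩⟩
  obtain ⟨c, hc, hfc, h3⟩ := key _ _ h1
  obtain ⟨d, hd, hfd, h4⟩ := key _ _ h2
  obtain rfl := hZ.unique hf hc hfc hd hfd
  have h5 : ∀ i j k l, Uses H v E f i j → Uses H v E f k l → c ∈ v i → c ∈ v k →
      s(i, j) = s(k, l) := by
    intro i j k l h1 h2 h3 h4
    obtain rfl := F.eq_of_mem _ _ _ h3 h4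
    rw [F.uses_unique hf h1 h2]
  have h6 := fun i j => F.uses_symm h hf (i := i) (j := j)
  rcases h3 with ⟨hu, h3⟩ | ⟨hu, (h3 | h3) | h3⟩ <;>
    rcases h4 with ⟨hw, h4⟩ | ⟨hw, (h4 | h4) | h4⟩ <;>
    first
    | exact F.edge_eq_of_mem _ _ _ _ _ h3 h4
    | exact absurd h3 (F.notMem _ _ _ _ h4)
    | exact absurd h4 (F.notMem _ _ _ _ h3)
    | exact h5 _ _ _ _ hu hw h3 h4
    | (rw [Sym2.eq_swap]; exact h5 _ _ _ _ (h6 _ _ hu) hw h3 h4)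
    | (rw [Sym2.eq_swap (a := k)]; exact h5 _ _ _ _ hu (h6 _ _ hw) h3 h4)
    | (rw [Sym2.eq_swap, Sym2.eq_swap (a := k)]; exact h5 _ _ _ _ (h6 _ _ hu) (h6 _ _ hw) h3 h4)

end Parity

end Frames

/-! ### Matching covered graphs with vertices of degree two -/

section Degrees

variable {ι : Type*} {H : SimpleGraph ι} {μ : ι → ι}

/-- Every vertex has exactly two neighbours. -/
def Deg2 (H : SimpleGraph ι) : Prop :=
  ∀ i, ∃ j k, j ≠ k ∧ H.Adj i j ∧ H.Adj i k ∧ ∀ l, H.Adj i l → l = j ∨ l = k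

/-- A matching covered graph with at least four vertices has minimum degree two. -/
theorem exists_two_nbrs (hH : MatchCov H μ) (h4 : ∀ a b c : ι, ∃ d, d ≠ a ∧ d ≠ b ∧ d ≠ c) (i : ι) :
    ∃ j k, j ≠ k ∧ H.Adj i j ∧ H.Adj i k := by
  by_contra! hc
  have a := hH.mem.1 i
  obtain ⟨d, hd1, hd2, -⟩ := h4 i (μ i) i
  have := eq_empty_of_closed hH (X := {i, μ i}) ?_ (z := d) (by simp [hd1, hd2])
  · exact Set.eq_empty_iff_forall_notMem.1 this i (by simp)
  · rintro x (rfl | rfl) y hxy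
    · exact Or.inr (by_contra fun h' => hc y (μ x) h' hxy a)
    · left
      obtain ⟨g, hg, rfl⟩ := hH.cov _ _ hxy
      have h1 : g i = μ i := by_contra fun h' => hc _ _ h' (hg.1 i) a
      rw [← h1, hg.2.1]

/-- A brick or brace with at least four vertices and a vertex of degree at most two has exactly
four vertices, all of degree two. -/
theorem deg2_of_brickOrBrace (hH : MatchCov H μ)
    (h4 : ∀ a b c : ι, ∃ d, d ≠ a ∧ d ≠ b ∧ d ≠ c)
    (hB : ∀ X, Tight H μ X → (∃ w, X = {w}) ∨ ∃ w, Xᶜ = {w}) {i j k : ι}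
    (hi : ∀ l, H.Adj i l → l = j ∨ l = k) : Finite ι ∧ Deg2 H := by
  have h2 := exists_two_nbrs hH h4
  obtain ⟨hjk, hij, hik⟩ : j ≠ k ∧ H.Adj i j ∧ H.Adj i k := by
    obtain ⟨j', k', hne, h1, h2⟩ := h2 i
    have := hi _ h1; have := hi _ h2; grind
  have hnij := hij.ne
  have hnik := hik.ne
  obtain ⟨l, hli, hlj, hlk⟩ := h4 i j k
  have ht : Tight H μ {i, j, k} := by
    refine tight_of_le_one hH ⟨i, by simp⟩ (z := l) (by simp [hli, hlj, hlk]) ?_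
    intro g hg x hx hgx y hy hgy
    have h1 := hi _ (hg.1 i)
    have := hg.2.1 i
    simp only [Set.mem_insert_iff, Set.mem_singleton_iff] at *
    grind
  have hl : ∀ x, x = i ∨ x = j ∨ x = k ∨ x = l := by
    rcases hB _ ht with ⟨w, hw⟩ | ⟨w, hw⟩
    · have h1 : i ∈ ({w} : Set ι) := hw ▸ by simp
      have h2 : j ∈ ({w} : Set ι) := hw ▸ by simp
      simp only [Set.mem_singleton_iff] at h1 h2
      exact absurd (h1.trans h2.symm) hnij
    · have h1 : l ∈ ({w} : Set ι) := hw ▸ by simp [hli, hlj, hlk]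
      simp only [Set.mem_singleton_iff] at h1
      subst h1
      intro x
      by_contra! hx
      have h1 : x ∈ ({l} : Set ι) := hw ▸ by simp [hx]
      exact hx.2.2.2 h1
  have hnjk : ¬ H.Adj j k := by
    intro a
    obtain ⟨g, hg, hgj⟩ := hH.cov _ _ a
    have h2 := hg.2.1
    rcases hi _ (hg.1 i) with h1 | h1
    · have := h2 i; grind
    · have := h2 i; have := h2 j; grind
  have hnil : ¬ H.Adj i l := fun a => by rcases hi l a <;> contradiction
  have hup : ∀ x, ∃ b c, ∀ y, H.Adj x y → y = b ∨ y = c := by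
    intro x
    rcases hl x with rfl | rfl | rfl | rfl
    · exact ⟨j, k, hi⟩
    · refine ⟨i, l, fun y a => ?_⟩
      have := hl y; have := a.ne; grind
    · refine ⟨i, l, fun y a => ?_⟩
      have := hl y; have := a.ne; have := a.symm; grind
    · refine ⟨j, k, fun y a => ?_⟩
      have := hl y; have := a.ne; have := a.symm; grind
  refine ⟨?_, fun x => ?_⟩
  · refine Set.finite_univ_iff.1 ((Set.toFinite {i, j, k, l}).subset fun x _ => ?_)
    simpa using hl x
  · obtain ⟨b, c, hbc⟩ := hup x
    obtain ⟨b', c', hne, h1, h2⟩ := h2 x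
    have := hbc _ h1; have := hbc _ h2
    exact ⟨b, c, by grind⟩

theorem isCycleGraph_of_deg2 [Finite ι] (hc : H.Connected) (h2 : Deg2 H) : IsCycleGraph H := by
  classical
  have := Fintype.ofFinite ι
  have hn : ∀ i, (H.neighborSet i).ncard = 2 := by
    intro i
    obtain ⟨j, k, hjk, h1, h2, h3⟩ := h2 i
    rw [Set.ncard_eq_two]
    refine ⟨j, k, hjk, ?_⟩
    ext l
    simp only [SimpleGraph.mem_neighborSet, Set.mem_insert_iff, Set.mem_singleton_iff]
    exact ⟨h3 l, by rintro (rfl | rfl) <;> assumption⟩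
  have hcyc : H.IsCycles := fun i _ => hn i
  obtain ⟨i⟩ := hc.nonempty
  obtain ⟨p, hp, hpv⟩ := hcyc.exists_cycle_toSubgraph_verts_eq_connectedComponentSupp
    (c := H.connectedComponentMk i) (v := i) rfl (by
      rw [Set.nonempty_iff_ne_empty]
      intro h'; have := hn i; rw [h'] at this; simp at this)
  have hall : ∀ j, j ∈ p.support := by
    intro j
    have : j ∈ p.toSubgraph.verts := by
      rw [hpv]
      exact SimpleGraph.ConnectedComponent.sound (hc.preconnected j i)
    simpa using this
  have hlen := hp.three_le_length
  have hcard : p.length = Fintype.card ι := by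
    have h1 : p.support.tail.length = p.length := by simp
    have h2 : p.support.tail.toFinset = Finset.univ := by
      ext j
      simp only [List.mem_toFinset, Finset.mem_univ, iff_true]
      have := hall j
      rw [SimpleGraph.Walk.mem_support_iff] at this
      rcases this with rfl | h'
      · exact SimpleGraph.Walk.end_mem_tail_support hp.not_nil
      · exact h'
    rw [← h1, ← List.toFinset_card_of_nodup hp.support_nodup, h2, Finset.card_univ]
  have hcont := (SimpleGraph.cycleGraph_isContained_iff (G := H) (n := p.length) (by omega)).2
    ⟨i, p, hp, rfl⟩
  obtain ⟨φ⟩ := hcont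
  have hbij : Function.Bijective φ := by
    rw [Fintype.bijective_iff_injective_and_card]
    exact ⟨φ.injective, by rw [Fintype.card_fin, hcard]⟩
  refine ⟨p.length, hlen, ⟨(RelIso.symm ⟨Equiv.ofBijective _ hbij, ?_⟩)⟩⟩
  intro a b
  simp only [Equiv.ofBijective_apply]
  refine ⟨fun hab => ?_, fun hab => φ.toHom.map_adj hab⟩
  -- both graphs are 2-regular, so there is no further edge in `H`
  have e : φ '' ((SimpleGraph.cycleGraph p.length).neighborSet a) = H.neighborSet (φ a) := by
    refine Set.eq_of_subset_of_ncard_le ?_ ?_ (Set.toFinite _)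
    · rintro _ ⟨c, hc, rfl⟩
      exact φ.toHom.map_adj hc
    · rw [hn, Set.ncard_image_of_injective _ hbij.1]
      obtain ⟨n, hn'⟩ : ∃ n, p.length = n + 3 := ⟨p.length - 3, by omega⟩
      have : ∀ N, N = n + 3 → ∀ a : Fin N, 2 ≤ ((SimpleGraph.cycleGraph N).neighborSet a).ncard := by
        rintro N rfl a
        have := SimpleGraph.cycleGraph_degree_three_le (v := a)
        rw [← SimpleGraph.card_neighborSet_eq_degree, ← Nat.card_eq_fintype_card] at this
        exact this.ge
      exact this _ hn' a
  have : φ b ∈ φ '' ((SimpleGraph.cycleGraph p.length).neighborSet a) := by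
    rw [e]; exact hab
  obtain ⟨c, hc, hcb⟩ := this
  rwa [← hbij.1 hcb]

theorem deg2_of_isCycleGraph (hc : IsCycleGraph H) : Finite ι ∧ Deg2 H := by
  obtain ⟨n, hn, ⟨φ⟩⟩ := hc
  refine ⟨Finite.of_equiv _ φ.toEquiv.symm, fun i => ?_⟩
  obtain ⟨n, rfl⟩ : ∃ k, n = k + 3 := ⟨n - 3, by omega⟩
  have h1 := SimpleGraph.cycleGraph_degree_three_le (v := φ i)
  rw [← SimpleGraph.card_neighborSet_eq_degree, ← Nat.card_eq_fintype_card] at h1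
  obtain ⟨a, b, hab, he⟩ := Set.ncard_eq_two.1 h1
  have hmem : ∀ x, (SimpleGraph.cycleGraph (n + 3)).Adj (φ i) x ↔ x = a ∨ x = b := by
    intro x
    rw [← SimpleGraph.mem_neighborSet, he]; simp
  refine ⟨φ.symm a, φ.symm b, by simpa using hab, ?_, ?_, fun l hl => ?_⟩
  · rw [← φ.map_adj_iff]; simpa using (hmem a).2 (Or.inl rfl)
  · rw [← φ.map_adj_iff]; simpa using (hmem b).2 (Or.inr rfl)
  · rcases (hmem (φ l)).1 (φ.map_adj_iff.2 hl) with h | h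
    · left; rw [← h]; simp
    · right; rw [← h]; simp

end Degrees

/-! ### Edge sets cut lengthwise, and irreducible frames -/

section Splits

variable {V ι : Type*} {G : SimpleGraph V} {m : V → V} {H : SimpleGraph ι} {v : ι → Set V}
  {E : ι → ι → Set V} {μ : ι → ι}

/-- No tight set cuts an edge set `E i j` into two odd parts while separating `i` from `j`. -/
def NoSplit (h : MatchCov G m) (H : SimpleGraph ι) (v : ι → Set V) (E : ι → ι → Set V) : Prop :=
  ∀ i j, H.Adj i j → ∀ Z, Tight G m Z → par h (E i j ∩ Z) = 1 → par h (v i ∩ Z) = 1 →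
    par h (v j ∩ Z) = 0 → False

/-- No even part of a vertex set `v i` can be moved into an edge set at `i`: this is what the
choice of the edge sets as greatest passable sets provides. -/
def Irred (G : SimpleGraph V) (m : V → V) (H : SimpleGraph ι) (v : ι → Set V)
    (E : ι → ι → Set V) : Prop :=
  ∀ i j, H.Adj i j → ∀ S ⊆ v i, Tight G m (v i \ S) →
    (∀ x ∈ S, ∀ z, G.Adj x z → z ∈ v i ∪ (v j ∪ E i j)) → S = ∅

/-- The maximality condition on torsoids that are cycles. -/
def CycleMax (G : SimpleGraph V) (m : V → V) (H : SimpleGraph ι) (v : ι → Set V)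
    (E : ι → ι → Set V) : Prop :=
  ∀ i j k, H.Adj i j → H.Adj j k → i ≠ k → ¬ ∃ P₁ P₂ P₃ : Set V,
    Tight G m P₁ ∧ Tight G m P₂ ∧ Tight G m P₃ ∧
      Disjoint P₁ P₂ ∧ Disjoint P₁ P₃ ∧ Disjoint P₂ P₃ ∧
      P₁ ∪ P₂ ∪ P₃ = E i j ∪ v j ∪ E j k ∧
      Tight G m (v i ∪ P₁ ∪ P₂) ∧ Tight G m (P₂ ∪ P₃ ∪ v k)

variable (h : MatchCov G m) (F : IsFrame G m H v E)

include h

theorem par_compl_inter (A Z : Set V) : par h (A ∩ Zᶜ) = par h A + par h (A ∩ Z) := by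
  have := par_split h A Z
  rw [show A ∩ Zᶜ = A \ Z from rfl]; grind

include F

/-- The structure along an edge that is cut lengthwise. -/
theorem split_facts {i j : ι} (a : H.Adj i j) {Z : Set V} (hZ : Tight G m Z)
    (hE : par h (E i j ∩ Z) = 1) (hi : par h (v i ∩ Z) = 1) (hj : par h (v j ∩ Z) = 0) :
    Tight G m (E i j ∩ Z) ∧ Tight G m (E i j \ Z) ∧
      ∀ x ∈ v i, ∀ y ∈ v j ∪ (E i j \ Z), ¬ G.Adj x y := by
  have hdij : Disjoint (v i) (v j) := F.disjoint_vert a.ne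
  have hEi : Disjoint (v i) (E i j) := Set.disjoint_left.2 (F.notMem i i j)
  have hEj : Disjoint (v j) (E i j) := Set.disjoint_left.2 (F.notMem j i j)
  have hA := F.tight_union i j a
  have hB := F.tight_union j i a.symm
  rw [F.symm j i] at hB
  have h1 := sdiff_tight h hZ (F.tight j) (by rwa [Set.inter_comm])
  have h2 := union_tight h h1 (F.tight i) (by
    rw [show (Z \ v j) ∩ v i = v i ∩ Z by grind, hi])
  have hp2 : par h ((v j ∪ E i j) ∩ (Z \ v j ∪ v i)) = 1 := by
    rw [show (v j ∪ E i j) ∩ (Z \ v j ∪ v i) = E i j ∩ Z by grind, hE]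
  have hp1 : par h ((v i ∪ E i j) ∩ (Z \ v j ∪ v i)) = 0 := by
    rw [show (v i ∪ E i j) ∩ (Z \ v j ∪ v i) = v i ∪ E i j ∩ Z by grind,
      par_union h (by grind), (F.tight i).par h, hE]; decide
  refine ⟨?_, ?_, ?_⟩
  · have := inter_tight h hB h2 hp2
    rwa [show (v j ∪ E i j) ∩ (Z \ v j ∪ v i) = E i j ∩ Z by grind] at this
  · have := sdiff_tight h hA h2 hp1
    rwa [show (v i ∪ E i j) \ (Z \ v j ∪ v i) = E i j \ Z by grind] at this
  · intro x hx y hy hxy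
    exact no_edge_of_inter h hB h2 hp2 (x := y) (y := x) (by grind) (by grind) (by grind) (by grind)
      hxy.symm

/-- In a cycle, a lengthwise cut of an edge set contradicts maximality. -/
theorem noSplit_of_cycleMax (h2 : Deg2 H) (hc : CycleMax G m H v E) : NoSplit h H v E := by
  intro j i a Z hZ hE hj hi
  obtain ⟨hP2, hP1, hno⟩ := split_facts h F a hZ hE hj hi
  obtain ⟨k, hk, hki⟩ : ∃ k, H.Adj j k ∧ i ≠ k := by
    obtain ⟨b, c, hbc, h1, h2, -⟩ := h2 j
    by_cases hb : i = b
    · exact ⟨c, h2, by grind⟩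
    · exact ⟨b, h1, hb⟩
  have hjk : ∀ l, H.Adj j l → l = i ∨ l = k := by
    obtain ⟨b, c, hbc, h1, h2, h3⟩ := h2 j
    intro l hl
    have := h3 l hl; have := h3 i a; have := h3 k hk; grind
  have hsy := F.symm i j
  have hdi : ∀ x, x ∈ v i → x ∉ v j := fun x hx hy => a.ne (F.eq_of_mem _ _ _ hy hx)
  have hdk : ∀ x, x ∈ v k → x ∉ v j := fun x hx hy => hk.ne (F.eq_of_mem _ _ _ hy hx)
  have hdik : ∀ x, x ∈ v i → x ∉ v k := fun x hx hy => hki (F.eq_of_mem _ _ _ hx hy)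
  have e1 := F.notMem i j i
  have e2 := F.notMem j j i
  have e3 := F.notMem k j i
  have e4 := F.notMem i j k
  have e5 := F.notMem j j k
  have e6 := F.notMem k j k
  have e7 : ∀ x, x ∈ E j i → x ∉ E j k := by
    intro x hx hy
    have := F.edge_eq_of_mem _ _ _ _ _ hx hy
    have := a.ne; have := hk.ne
    simp only [Sym2.eq_iff] at *
    grind
  refine hc i j k a.symm hk hki ⟨E j i \ Z, E j i ∩ Z, v j ∪ E j k, hP1, hP2,
    F.tight_union j k hk, by grind, by grind, by grind, by grind, ?_, ?_⟩
  · have := F.tight_union i j a.symm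
    rwa [show v i ∪ E j i \ Z ∪ E j i ∩ Z = v i ∪ E i j by grind]
  · refine tight_of_par h ?_ ?_
    · rw [par_union h (by grind), par_union h (by grind), (F.tight_union j k hk).par h,
        (F.tight k).par h, hP2.par h]; decide
    intro f hf x hx hfx y hy hfy
    obtain ⟨p, hp, hfp, hpu⟩ := hP2.cross hf
    have hinv := hf.2.1
    by_cases hu : Uses H v E f j k
    · have hcl := F.uses_closed h hf hu
      have hx' : x ∈ E j i ∩ Z := by
        by_contra hx'
        have := hcl x (by grind); grind
      have hy' : y ∈ E j i ∩ Z := by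
        by_contra hy'
        have := hcl y (by grind); grind
      rw [hpu x hx' (by grind), hpu y hy' (by grind)]
    · have hui : Uses H v E f j i := by
        obtain ⟨l, hl⟩ := F.exists_uses h hf j
        rcases hjk l hl.1 with rfl | rfl
        · exact hl
        · exact absurd hl hu
      have hEk := F.closed_of_not_uses h hf hu
      obtain ⟨c, hc, hfc, hcu⟩ := (F.tight j).cross hf
      obtain ⟨d, hd, hfd, hdu⟩ := (F.tight k).cross hf
      have hcP : f c ∈ E j i ∩ Z := by
        have h1 := F.uses_closed h hf hui c (by grind)
        have h2 := fun hy => hno c hc (f c) hy (hf.1 c)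
        grind
      have hpc : p = f c := (hpu (f c) hcP (by grind)).symm
      have key : ∀ x, x ∈ E j i ∩ Z ∪ (v j ∪ E j k) ∪ v k →
          f x ∉ E j i ∩ Z ∪ (v j ∪ E j k) ∪ v k → x = d := by
        intro x hx hfx
        have := hpu x; have := hcu x; have := hdu x; have := hEk x
        grind
      rw [key x hx hfx, key y hy hfy]

/-- In a brick or brace with minimum degree three no edge set is cut lengthwise. Were `ij` such
an edge, let `O` consist of the vertices that `Z` meets oddly and that lie on no edge that `Z` meets
oddly. No matching of `H` leaves `O` or `O ∪ {i, j}` twice, so these sets are empty, full, singletons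
or complements of singletons. This leaves only four vertices, and a matching that uses another edge
at `i` would cross `Z` twice. -/
theorem noSplit_of_brickOrBrace (hμ : Induces H v E m μ)
    (h4 : ∀ a b c : ι, ∃ d, d ≠ a ∧ d ≠ b ∧ d ≠ c)
    (hB : ∀ X, Tight H μ X → (∃ w, X = {w}) ∨ ∃ w, Xᶜ = {w})
    (h3 : ∀ i j k, ∃ l, H.Adj i l ∧ l ≠ j ∧ l ≠ k) : NoSplit h H v E := by
  intro i j a Z hZ hE hi hj
  have hH := F.matchCov h hμ
  -- the parities of `Z` at vertices, and its odd edges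
  set P : ι → ZMod 2 := fun x => par h (v x ∩ Z) with hP
  let odd : ι → ι → Prop := fun x y => H.Adj x y ∧ par h (E x y ∩ Z) = 1
  have hodd_symm : ∀ x y, odd x y → odd y x := fun x y hxy => ⟨hxy.1.symm, F.symm x y ▸ hxy.2⟩
  have hij : odd i j := ⟨a, hE⟩
  have haux : ∀ Z, Tight G m Z → par h (E i j ∩ Z) = 1 → par h (v i ∩ Z) ≠ par h (v j ∩ Z) →
      ∀ x y, H.Adj x y → par h (E x y ∩ Z) = 1 → par h (v x ∩ Z) = 0 → par h (v y ∩ Z) = 0 →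
      False := by
    intro Z hZ hE hne x y hxy hE' hx hy
    have hsub := F.subset_of_odd h hxy hZ hx hy hE'
    obtain ⟨c, hc, -⟩ := exists_cross h h.mem hE
    rcases hsub hc.2 with (h1 | h1) | h1
    · exact F.notMem _ _ _ _ h1 hc.1
    · exact F.notMem _ _ _ _ h1 hc.1
    · rcases Sym2.eq_iff.1 (F.edge_eq_of_mem _ _ _ _ _ hc.1 h1) with ⟨rfl, rfl⟩ | ⟨rfl, rfl⟩
      · exact hne (by rw [hx, hy])
      · exact hne (by rw [hx, hy])
  have hPodd : ∀ x y, odd x y → P x ≠ P y := by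
    rintro x y ⟨hxy, hE'⟩ he
    rcases ZMod2.eq_zero_or_one (P x) with h0 | h1
    · exact haux Z hZ hE (by rw [hi, hj]; decide) x y hxy hE' h0 (he.symm.trans h0)
    · have e1 := fun A => par_compl_inter h A Z
      have h2 : P y = 1 := he ▸ h1
      simp only [hP] at h1 h2
      refine haux Zᶜ hZ.compl ?_ ?_ x y hxy ?_ ?_ ?_
      · rw [e1, F.par_edge h, hE]; decide
      · rw [e1, e1, (F.tight i).par h, (F.tight j).par h, hi, hj]; decide
      · rw [e1, F.par_edge h, hE']; decide
      · rw [e1, (F.tight x).par h, h1]; decide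
      · rw [e1, (F.tight y).par h, h2]; decide
  have hPij : P i = 1 ∧ P j = 0 := ⟨hi, hj⟩
  have hblock : ∀ x y, H.Adj x y → par h ((v x ∪ v y ∪ E x y) ∩ Z) =
      P x + P y + par h (E x y ∩ Z) := by
    intro x y hxy
    have hd : Disjoint (v x) (v y) :=
      F.disjoint_vert hxy.ne
    have h1 : Disjoint (v x) (E x y) := Set.disjoint_left.2 (F.notMem x x y)
    have h2 : Disjoint (v y) (E x y) := Set.disjoint_left.2 (F.notMem y x y)
    rw [Set.union_inter_distrib_right, Set.union_inter_distrib_right, par_union h (by grind),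
      par_union h (by grind)]
  -- the odd edges form a matching, as some `f` avoids any two of them at a common vertex
  have huniq : ∀ x y z, odd x y → odd x z → y = z := by
    intro x y z hxy hxz
    by_contra hne
    obtain ⟨l, hl, hly, hlz⟩ := h3 x y z
    obtain ⟨f, hf, hu⟩ := F.exists_uses_of_adj h hl
    have h1 : Bad h H v E f Z x y := Or.inl ⟨fun h' => hly (F.uses_unique hf hu h'), hxy.2⟩
    have h2 : Bad h H v E f Z x z := Or.inl ⟨fun h' => hlz (F.uses_unique hf hu h'), hxz.2⟩
    have := F.bad_unique h hf hZ h1 h2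
    simp only [Sym2.eq_iff] at this
    have := hxy.1.ne; grind
  let O : Set ι := {x | P x = 1 ∧ ∀ y, ¬ odd x y}
  have hiO : i ∉ O := fun h' => h'.2 j hij
  have hjO : j ∉ O := fun h' => h'.2 i (hodd_symm _ _ hij)
  -- at each crossing vertex of `O` there is a bad edge
  have item : ∀ f ∈ Mates G m, ∀ g, Induces H v E f g → g ∈ Mates H μ → ∀ x ∈ O, g x ∉ O →
      (P (g x) = 0 ∧ Bad h H v E f Z x (g x)) ∨
        (P (g x) = 1 ∧ ∃ y, odd (g x) y ∧ Bad h H v E f Z (g x) y ∧ y ≠ x) := by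
    intro f hf g hg hgm x hx hgx
    rcases ZMod2.eq_zero_or_one (P (g x)) with h0 | h1
    · refine Or.inl ⟨h0, Or.inr ⟨hg x, ?_⟩⟩
      have : par h (E x (g x) ∩ Z) = 0 := by
        by_contra h'
        exact hx.2 _ ⟨hgm.1 x, ZMod2.eq_one_of_ne h'⟩
      rw [hblock _ _ (hgm.1 x), hx.1, h0, this]; decide
    · obtain ⟨y, hy⟩ : ∃ y, odd (g x) y := by
        by_contra! h'
        exact hgx ⟨h1, h'⟩
      have hyx : y ≠ x := by
        rintro rfl; exact hx.2 _ (hodd_symm _ _ hy)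
      refine Or.inr ⟨h1, y, hy, Or.inl ⟨fun hu => hyx ?_, hy.2⟩, hyx⟩
      rw [F.uses_iff hf hg, hgm.2.1] at hu
      exact hu.symm
  have hO1 : ∀ g ∈ Mates H μ, ∀ x ∈ O, g x ∉ O → ∀ y ∈ O, g y ∉ O → x = y := by
    intro g hgm x hx hgx y hy hgy
    obtain ⟨f, hf, hg⟩ := F.exists_lift h hμ hgm
    have hinj : ∀ x y, g x = g y → x = y := fun x y he => by rw [← hgm.2.1 x, he, hgm.2.1]
    rcases item f hf g hg hgm x hx hgx with ⟨h1, b1⟩ | ⟨h1, z, hz, b1, hzx⟩ <;>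
      rcases item f hf g hg hgm y hy hgy with ⟨h2, b2⟩ | ⟨h2, w, hw, b2, hwy⟩ <;>
      rcases Sym2.eq_iff.1 (F.bad_unique h hf hZ b1 b2) with ⟨e1, e2⟩ | ⟨e1, e2⟩
    · exact e1
    · have := hx.1; rw [e1, h2] at this; exact absurd this (by decide)
    · rw [e1] at hx; exact absurd hw (hx.2 _)
    · rw [e1] at hx; exact absurd (hodd_symm _ _ hw) (hx.2 _)
    · rw [← e1] at hy; exact absurd hz (hy.2 _)
    · rw [← e2] at hy; exact absurd (hodd_symm _ _ hz) (hy.2 _)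
    · exact hinj _ _ e1
    · rw [e2] at hz; exact absurd (h1.trans h2.symm) (hPodd _ _ hz)
  have hO2 : ∀ g ∈ Mates H μ, ∀ x ∈ O ∪ {i, j}, g x ∉ O ∪ {i, j} → ∀ y ∈ O ∪ {i, j},
      g y ∉ O ∪ {i, j} → x = y := by
    intro g hgm
    obtain ⟨f, hf, hg⟩ := F.exists_lift h hμ hgm
    have hbij : g i ≠ j → Bad h H v E f Z i j := fun hne =>
      Or.inl ⟨fun hu => hne ((F.uses_iff hf hg _ _).1 hu), hE⟩
    have hi' : g i ∉ O ∪ {i, j} → False := by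
      intro hgi
      have hgij : g i ≠ j := by rintro e; exact hgi (by simp [e])
      have hgii : g i ≠ i := (hgm.1 i).ne'
      rcases ZMod2.eq_zero_or_one (P (g i)) with h0 | h1
      · have hE0 : par h (E i (g i) ∩ Z) = 0 := by
          by_contra h'
          exact hgij (huniq i _ _ ⟨hgm.1 i, ZMod2.eq_one_of_ne h'⟩ hij)
        have b : Bad h H v E f Z i (g i) := Or.inr ⟨hg i, by
          rw [hblock _ _ (hgm.1 i), hPij.1, h0, hE0]; decide⟩
        have := F.bad_unique h hf hZ b (hbij hgij)
        simp only [Sym2.eq_iff] at this; grind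
      · obtain ⟨y, hy⟩ : ∃ y, odd (g i) y := by
          by_contra! h'
          exact hgi (Or.inl ⟨h1, h'⟩)
        have hyi : y ≠ i := by
          rintro rfl
          exact hgij (huniq _ _ _ (hodd_symm _ _ hy) hij)
        have b : Bad h H v E f Z (g i) y := Or.inl ⟨fun hu => hyi (by
          rw [F.uses_iff hf hg, hgm.2.1] at hu; exact hu.symm), hy.2⟩
        have := F.bad_unique h hf hZ b (hbij hgij)
        simp only [Sym2.eq_iff] at this; grind
    have hj' : ∀ x ∈ O, g x ∉ O ∪ {i, j} → g j ∉ O ∪ {i, j} → False := by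
      intro x hx hgx hgj
      have hgij : g i ≠ j := by
        intro e
        apply hgj
        rw [← e, hgm.2.1]; simp
      rcases item f hf g hg hgm x hx (fun h' => hgx (Or.inl h')) with ⟨h1, b1⟩ | ⟨h1, z, hz, b1, -⟩
      · have := F.bad_unique h hf hZ b1 (hbij hgij)
        simp only [Sym2.eq_iff] at this
        rcases this with ⟨rfl, -⟩ | ⟨rfl, -⟩
        · exact hiO hx
        · exact hjO hx
      · have := F.bad_unique h hf hZ b1 (hbij hgij)
        simp only [Sym2.eq_iff] at this
        rcases this with ⟨e, -⟩ | ⟨e, -⟩ <;> exact hgx (by simp [e])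
    intro x hx hgx y hy hgy
    have hcase : ∀ x ∈ O ∪ {i, j}, g x ∉ O ∪ {i, j} → x ∈ O ∨ x = j := by
      rintro x (hx | rfl | rfl) hgx
      · exact Or.inl hx
      · exact (hi' hgx).elim
      · exact Or.inr rfl
    rcases hcase x hx hgx with hx' | hx' <;> rcases hcase y hy hgy with hy' | hy'
    · exact hO1 g hgm x hx' (fun h' => hgx (Or.inl h')) y hy' (fun h' => hgy (Or.inl h'))
    · exact (hj' x hx' hgx (hy' ▸ hgy)).elim
    · exact (hj' y hy' hgy (hx' ▸ hgx)).elim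
    · rw [hx', hy']
  -- hence `O` has at most one element and `O ∪ {i, j}` lacks at most one
  have hO : O = ∅ ∨ ∃ w, O = {w} := by
    by_cases hne : O.Nonempty
    · right
      rcases hB O (tight_of_le_one hH hne hiO hO1) with hw | ⟨w, hw⟩
      · exact hw
      · have h1 : i ∈ ({w} : Set ι) := hw ▸ hiO
        have h2 : j ∈ ({w} : Set ι) := hw ▸ hjO
        exact absurd (h1.trans h2.symm) a.ne
    · exact Or.inl (Set.not_nonempty_iff_eq_empty.1 hne)
  have hO' : ∀ x y, x ∉ O ∪ {i, j} → y ∉ O ∪ {i, j} → x = y := by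
    intro x y hx hy
    rcases hB _ (tight_of_le_one hH ⟨i, by simp⟩ hx hO2) with ⟨w, hw⟩ | ⟨w, hw⟩
    · have h1 : i ∈ ({w} : Set ι) := hw ▸ by simp
      have h2 : j ∈ ({w} : Set ι) := hw ▸ by simp
      exact absurd (h1.trans h2.symm) a.ne
    · have h1 : x ∈ ({w} : Set ι) := hw ▸ hx
      have h2 : y ∈ ({w} : Set ι) := hw ▸ hy
      exact h1.trans h2.symm
  rcases hO with hO | ⟨w, hO⟩
  · obtain ⟨x, hxi, hxj, -⟩ := h4 i j j
    obtain ⟨y, hyi, hyj, hyx⟩ := h4 i j x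
    exact hyx (hO' y x (by simp [hO, hyi, hyj]) (by simp [hO, hxi, hxj]))
  · obtain ⟨b, hb, hbj, hbw⟩ := h3 i j w
    have hbi := hb.ne'
    have hbO : b ∉ O := by rw [hO]; exact hbw
    have hall : ∀ y, y = i ∨ y = j ∨ y = w ∨ y = b := by
      intro y
      by_contra! hy
      exact hy.2.2.2 (hO' y b (by simp [hO, hy]) (by simp [hO, hbi, hbj, hbw]))
    have hwO : w ∈ O := by rw [hO]; rfl
    have hPb : P b = 0 := by
      by_contra h'
      obtain ⟨y, hy⟩ : ∃ y, odd b y := by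
        by_contra! h''
        exact hbO ⟨ZMod2.eq_one_of_ne h', h''⟩
      rcases hall y with rfl | rfl | rfl | rfl
      · exact hbj (huniq _ _ _ (hodd_symm _ _ hy) hij)
      · exact hbi (huniq _ _ _ (hodd_symm _ _ hy) (hodd_symm _ _ hij))
      · exact hwO.2 _ (hodd_symm _ _ hy)
      · exact hy.1.ne rfl
    obtain ⟨f, hf, hu⟩ := F.exists_uses_of_adj h hb
    have hE0 : par h (E i b ∩ Z) = 0 := by
      by_contra h'
      exact hbj (huniq i _ _ ⟨hb, ZMod2.eq_one_of_ne h'⟩ hij)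
    have b1 : Bad h H v E f Z i b := Or.inr ⟨hu, by
      rw [hblock _ _ hb, hPij.1, hPb, hE0]; decide⟩
    have b2 : Bad h H v E f Z i j := Or.inl ⟨fun h' => hbj (F.uses_unique hf hu h'), hE⟩
    have := F.bad_unique h hf hZ b1 b2
    simp only [Sym2.eq_iff] at this; grind

/-- A vertex set of degree two that meets a tight set evenly is disjoint from it as soon as this
also holds, in terms of parities, for a neighbour and the edge set in between. -/
theorem inter_vert_eq_empty (hI : Irred G m H v E) {i j k : ι} (aj : H.Adj i j) (ak : H.Adj i k)
    (hi : ∀ l, H.Adj i l → l = j ∨ l = k) {Z : Set V} (hZ : Tight G m Z)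
    (h1 : par h (v i ∩ Z) = 0) (h2 : par h (v j ∩ Z) = 0) (h3 : par h (E i j ∩ Z) = 0) :
    v i ∩ Z = ∅ := by
  have hdij : Disjoint (v i) (v j) := F.disjoint_vert aj.ne
  have hEi : Disjoint (v i) (E i j) := Set.disjoint_left.2 (F.notMem i i j)
  have hEj : Disjoint (v j) (E i j) := Set.disjoint_left.2 (F.notMem j i j)
  have hZi := sdiff_tight h hZ (F.tight i) (by rwa [Set.inter_comm])
  have hju := F.tight_union j i aj.symm
  rw [F.symm j i] at hju
  refine hI i k ak (v i ∩ Z) Set.inter_subset_left ?_ ?_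
  · rw [Set.sdiff_self_inter]; exact sdiff_tight h (F.tight i) hZ h1
  · intro x hx z hxz
    rcases F.nbr_vert h hx.1 hxz with h5 | ⟨l, hl, h5⟩
    · exact Or.inl h5
    · rcases hi l hl with rfl | rfl
      · exfalso
        have hz : z ∈ v l ∪ E i l := h5
        by_cases hzZ : z ∈ Z
        · refine no_edge_of_sdiff h hju hZi ?_ (x := z) (y := x) hz (by grind) (by grind) (by grind)
            hxz.symm
          rw [show (v l ∪ E i l) ∩ (Z \ v i) = (v l ∩ Z) ∪ (E i l ∩ Z) by grind,
            par_union h (by grind), h2, h3]; decide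
        · exact no_edge_of_sdiff h (F.tight i) hZ h1 hx.1 hx.2 (by grind) hzZ hxz
      · exact Or.inr h5

end Splits

/-! ### Torsoids as frames -/

section Torsoids

variable {V : Type*} {G : SimpleGraph V} {m : V → V} {M : G.Subgraph}

/-- The edge sets of a pre-torsoid as a function of two vertices, empty for nonadjacent pairs. -/
def PreTorsoid.edgeSets (T : PreTorsoid V) (i j : T.verts) : Set V :=
  {x | ∃ a : T.graph.Adj i j, x ∈ T.eps a}

theorem PreTorsoid.edgeSets_of_adj (T : PreTorsoid V) {i j : T.verts} (a : T.graph.Adj i j) :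
    T.edgeSets i j = T.eps a := by
  ext x; exact ⟨fun ⟨_, hx⟩ => hx, fun hx => ⟨a, hx⟩⟩

theorem PreTorsoid.eps_symm (T : PreTorsoid V) {i j : T.verts} (a : T.graph.Adj i j) :
    T.eps a.symm = T.eps a := by
  unfold PreTorsoid.eps
  congr 1
  exact Subtype.ext Sym2.eq_swap

theorem PreTorsoid.edgeSets_symm (T : PreTorsoid V) (i j : T.verts) :
    T.edgeSets i j = T.edgeSets j i := by
  ext x
  constructor
  · rintro ⟨a, hx⟩; exact ⟨a.symm, by rwa [T.eps_symm a]⟩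
  · rintro ⟨a, hx⟩; exact ⟨a.symm, by rwa [T.eps_symm a]⟩

theorem PreTorsoid.eps_mem (T : PreTorsoid V) {i j : T.verts}
    (a : T.graph.Adj i j) : T.eps a ∈ T.verts ∪ Set.range T.edgeFn := Or.inr ⟨_, rfl⟩

/-- Pre-torsoids with the same vertices, edges and edge sets are equal. -/
theorem PreTorsoid.ext_of {T T' : PreTorsoid V} (hv : T.verts = T'.verts)
    (ha : ∀ A B (h1 : A ∈ T.verts) (h2 : B ∈ T.verts) (h3 : A ∈ T'.verts) (h4 : B ∈ T'.verts),
      T.graph.Adj ⟨A, h1⟩ ⟨B, h2⟩ ↔ T'.graph.Adj ⟨A, h3⟩ ⟨B, h4⟩)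
    (he : ∀ A B (h1 : A ∈ T.verts) (h2 : B ∈ T.verts) (h3 : A ∈ T'.verts) (h4 : B ∈ T'.verts),
      T.edgeSets ⟨A, h1⟩ ⟨B, h2⟩ = T'.edgeSets ⟨A, h3⟩ ⟨B, h4⟩) : T = T' := by
  obtain ⟨⟨verts, graph⟩, edgeFn⟩ := T
  obtain ⟨⟨verts', graph'⟩, edgeFn'⟩ := T'
  simp only at hv
  subst hv
  obtain rfl : graph = graph' := by
    ext ⟨A, hA⟩ ⟨B, hB⟩
    exact ha A B hA hB hA hB
  obtain rfl : edgeFn = edgeFn' := by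
    ext1 ⟨e, hmem⟩
    induction e with | _ a b =>
    have h1 := he a.1 b.1 a.2 b.2 a.2 b.2
    rw [PreTorsoid.edgeSets_of_adj _ (show graph.Adj a b from hmem),
      PreTorsoid.edgeSets_of_adj _ (show graph.Adj a b from hmem)] at h1
    exact h1
  rfl

variable (h : MatchCov G m) (hM : IsMate M m)

include hM

/-- The matching inherited by `H` is the one induced on the frame of the torsoid. -/
theorem uses_iff_inherited {T : PreTorsoid V}
    (hs : ∀ i j, Uses T.graph Subtype.val T.edgeSets m i j →
      Uses T.graph Subtype.val T.edgeSets m j i) (i j : T.verts) :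
    (T.inheritedMatching M).Adj i j ↔ Uses T.graph Subtype.val T.edgeSets m i j := by
  have key : ∀ i j, (∃ a : T.graph.Adj i j, ∃ x ∈ i.1, ∃ y ∈ j.1 ∪ T.eps a, M.Adj x y) ↔
      Uses T.graph Subtype.val T.edgeSets m i j := by
    intro i j
    constructor
    · rintro ⟨a, x, hx, y, hy, hxy⟩
      refine ⟨a, x, hx, ?_⟩
      rwa [(hM.2 _ _).1 hxy, T.edgeSets_of_adj a]
    · rintro ⟨a, x, hx, hy⟩
      refine ⟨a, x, hx, m x, ?_, (hM.2 _ _).2 rfl⟩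
      rwa [← T.edgeSets_of_adj a]
  constructor
  · rintro ⟨a, ⟨x, hx, y, hy, hxy⟩ | h1⟩
    · refine hs _ _ ((key _ _).1 ⟨a.symm, y, hy, x, ?_, hxy.symm⟩)
      rwa [T.eps_symm a]
    · exact (key _ _).1 ⟨a, h1⟩
  · intro hu
    obtain ⟨a, h1⟩ := (key _ _).2 hu
    exact ⟨a, Or.inr h1⟩

include h

omit h in
theorem IsTorsoid.passable {T : PreTorsoid V} (hT : IsTorsoid G M T) {i j : T.verts}
    (a : T.graph.Adj i j) : Tight G m (i.1 \ T.eps a) ∧ Tight G m (i.1 ∪ T.eps a) := by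
  have := (hT.eps_greatest i j a).1.2.1
  exact ⟨(isTight_iff hM _).1 this.1, (isTight_iff hM _).1 this.2⟩

/-- A vertex of a torsoid is disjoint from all edge sets; the near partition alone does not exclude
that it equals one. -/
theorem IsTorsoid.disjoint_eps {T : PreTorsoid V} (hT : IsTorsoid G M T) {i j k : T.verts}
    (a : T.graph.Adj i j) : Disjoint k.1 (T.eps a) := by
  by_contra hd
  have hke : k.1 = T.eps a := by
    by_contra hne
    exact hd (hT.nearPartition_disjoint (Or.inl k.2) (T.eps_mem a) hne)
  have hk := (isTight_iff hM _).1 (hT.tight k.1 k.2)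
  have hi := (isTight_iff hM _).1 (hT.tight i.1 i.2)
  obtain ⟨h1, h2⟩ := hT.passable hM a
  rw [← hke] at h1 h2
  by_cases hik : i.1 = k.1
  · rw [hik, Set.sdiff_self] at h1
    exact Set.not_nonempty_empty (h1.nonempty h)
  · have h3 := h2.par h
    have hd' : Disjoint i.1 k.1 := hT.nearPartition_disjoint (Or.inl i.2) (Or.inl k.2) hik
    rw [par_union h hd', hi.par h, hk.par h] at h3
    exact absurd h3 (by decide)

/-- The vertices and edge sets of a torsoid form a frame. -/
theorem IsTorsoid.isFrame {T : PreTorsoid V} (hT : IsTorsoid G M T) :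
    IsFrame G m T.graph Subtype.val T.edgeSets := by
  have hv : ∀ i : T.verts, Tight G m i.1 := fun i => (isTight_iff hM _).1 (hT.tight i.1 i.2)
  have hdv : ∀ i j : T.verts, ∀ x, x ∈ i.1 → x ∈ j.1 → i = j := by
    intro i j x hi hj
    by_contra hne
    exact Set.disjoint_left.1 (hT.nearPartition_disjoint (Or.inl i.2) (Or.inl j.2)
      (fun h' => hne (Subtype.ext h'))) hi hj
  have hpar : ∀ i j (a : T.graph.Adj i j), par h (T.eps a) = 0 := by
    intro i j a
    have h1 := (hT.passable hM a).2.par h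
    rw [par_union h (hT.disjoint_eps h hM a), (hv i).par h] at h1
    grind
  have hnbr : ∀ i j (a : T.graph.Adj i j), ∀ x ∈ T.eps a, ∀ y, G.Adj x y →
      y ∈ i.1 ∪ j.1 ∪ T.eps a := by
    intro i j a x hx y hxy
    by_contra hy
    have h1 := hT.disjoint_eps h hM a (k := i)
    have h2 := hT.disjoint_eps h hM a (k := j)
    have h3 : ∀ z, z ∈ i.1 → z ∉ j.1 := fun z hi hj => a.ne (hdv _ _ z hi hj)
    have h4 := (hT.passable hM a.symm).2
    rw [T.eps_symm a] at h4
    refine no_edge_of_sdiff h (hT.passable hM a).2 h4 ?_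
      (Or.inr hx) (Or.inr hx) (by grind) (by grind) hxy
    rw [show (i.1 ∪ T.eps a) ∩ (j.1 ∪ T.eps a) = T.eps a by grind, hpar]
  -- a nonempty edge set belongs to only one edge
  have hemp : ∀ i j k l (a : T.graph.Adj i j) (b : T.graph.Adj k l), T.eps a = T.eps b →
      j ≠ k → j ≠ l → T.eps a = ∅ := by
    intro i j k l a b hab hjk hjl
    have h1 := hT.disjoint_eps h hM a (k := i)
    refine eq_empty_of_nbr_subset h (hT.passable hM a).2 Set.subset_union_right ?_ ?_
    · rw [show (i.1 ∪ T.eps a) \ T.eps a = i.1 by grind]; exact hv i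
    · intro x hx z hxz
      have h2 := hnbr i j a x hx z hxz
      have h3 := hnbr k l b x (hab ▸ hx) z hxz
      have h4 := hdv j k z
      have h5 := hdv j l z
      have h6 := hT.disjoint_eps h hM a (k := j)
      grind
  refine ⟨hv, ?_, T.edgeSets_symm, ?_, hdv, ?_, ?_, ?_, ?_, ?_⟩
  · intro i j a
    rw [T.edgeSets_of_adj a]; exact (hT.passable hM a).2
  · rintro i j x ⟨a, -⟩; exact a
  · rintro i j k x hx ⟨a, hx'⟩
    exact Set.disjoint_left.1 (hT.disjoint_eps h hM a (k := i)) hx hx'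
  · rintro i j k l x ⟨a, hx⟩ ⟨b, hx'⟩
    have hab : T.eps a = T.eps b := by
      by_contra hne
      exact Set.disjoint_left.1 (hT.nearPartition_disjoint (T.eps_mem a)
        (T.eps_mem b) hne) hx hx'
    by_contra hne
    have hor : (j ≠ k ∧ j ≠ l) ∨ (i ≠ k ∧ i ≠ l) := by
      have := a.ne
      simp only [Sym2.eq_iff] at hne
      grind
    rcases hor with ⟨h1, h2⟩ | ⟨h1, h2⟩
    · rw [hemp i j k l a b hab h1 h2] at hx; exact hx
    · rw [← T.eps_symm a, hemp j i k l a.symm b (by rw [T.eps_symm a, hab]) h1 h2] at hx; exact hx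
  · intro x
    have : x ∈ ⋃₀ (T.verts ∪ Set.range T.edgeFn) := hT.nearPartition_cover ▸ Set.mem_univ x
    obtain ⟨A, hA | ⟨⟨e, he⟩, rfl⟩, hx⟩ := this
    · exact Or.inl ⟨⟨A, hA⟩, hx⟩
    · right
      induction e with | _ a b =>
      exact ⟨a, b, he, hx⟩
  · intro i j a
    obtain ⟨x, hx, y, hy, hxy⟩ := hT.edge_of_adj i j a
    exact ⟨x, by rwa [T.edgeSets_of_adj a], y, hy, hxy⟩
  · intro i j hij ha x hx y hy hxy
    exact hT.no_edge_of_not_adj i j hij ha ⟨x, hx, y, hy, hxy⟩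

/-- A movable part of a vertex could be added to the greatest passable set. -/
theorem IsTorsoid.irred {T : PreTorsoid V} (hT : IsTorsoid G M T) :
    Irred G m T.graph Subtype.val T.edgeSets := by
  have F := hT.isFrame h hM
  intro i j a S hS hiS hN
  have hE := T.edgeSets_of_adj a
  have hd1 : Disjoint i.1 (T.eps a) := hT.disjoint_eps h hM a
  have hd2 : Disjoint j.1 (T.eps a) := hT.disjoint_eps h hM a
  have hd3 : ∀ z, z ∈ i.1 → z ∉ j.1 := fun z hi hj => a.ne (F.eq_of_mem _ _ z hi hj)
  rw [hE] at hN
  have hju := (hT.passable hM a.symm).2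
  rw [T.eps_symm a] at hju
  have h1 := union_tight_of_nbr_subset h (F.tight i) hS hiS hju (by grind) hN
  have h2 : S ∪ T.eps a ⊆ T.eps a := by
    refine (hT.eps_greatest i j a).2 ⟨by grind, ⟨?_, ?_⟩, ?_, ?_⟩ <;> rw [isTight_iff hM]
    · rwa [show i.1 \ (S ∪ T.eps a) = i.1 \ S by grind]
    · have := (hT.passable hM a).2
      rwa [show i.1 ∪ (S ∪ T.eps a) = i.1 ∪ T.eps a by grind]
    · have := (hT.passable hM a.symm).1
      rw [T.eps_symm a] at this
      rwa [show j.1 \ (S ∪ T.eps a) = j.1 \ T.eps a by grind]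
    · rwa [show j.1 ∪ (S ∪ T.eps a) = j.1 ∪ T.eps a ∪ S by grind]
  grind

omit h in
theorem IsTorsoid.cycleMax {T : PreTorsoid V} (hT : IsTorsoid G M T)
    (hc : IsCycleGraph T.graph) : CycleMax G m T.graph Subtype.val T.edgeSets := by
  rintro i j k a b hik ⟨P₁, P₂, P₃, h1, h2, h3, h4, h5, h6, h7, h8, h9⟩
  refine hT.cycle_maximal hc i j k a b hik ⟨P₁, P₂, P₃, ?_⟩
  simp only [isTight_iff hM]
  rw [T.edgeSets_of_adj a, T.edgeSets_of_adj b] at h7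
  exact ⟨h1, h2, h3, h4, h5, h6, h7, h8, h9⟩

theorem IsTorsoid.brickOrBrace {T : PreTorsoid V} (hT : IsTorsoid G M T)
    (hc : ¬ IsCycleGraph T.graph) {μ : T.verts → T.verts}
    (hμ : Induces T.graph Subtype.val T.edgeSets m μ) (X : Set T.verts)
    (hX : Tight T.graph μ X) : (∃ w, X = {w}) ∨ ∃ w, Xᶜ = {w} := by
  have F := hT.isFrame h hM
  refine (hT.brickOrBrace_or_cycle.resolve_right hc) X ((isTight_iff ?_ X).2 hX)
  refine ⟨rfl, fun i j => ?_⟩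
  rw [uses_iff_inherited hM (fun i j hu => F.uses_symm h h.mem hu), F.uses_iff h.mem hμ]

/-- A frame on sets with enough vertices and of the right shape is a torsoid if it is irreducible and,
in case of a cycle, maximal. Irreducibility makes its edge sets the greatest passable sets. -/
theorem isTorsoid_of_isFrame {T : PreTorsoid V} (F : IsFrame G m T.graph Subtype.val T.edgeSets)
    (h4 : 4 ≤ T.verts.encard) {μ : T.verts → T.verts}
    (hμ : Induces T.graph Subtype.val T.edgeSets m μ)
    (hB : (∀ X, Tight T.graph μ X → (∃ w, X = {w}) ∨ ∃ w, Xᶜ = {w}) ∨ IsCycleGraph T.graph)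
    (hI : Irred G m T.graph Subtype.val T.edgeSets)
    (hC : IsCycleGraph T.graph → CycleMax G m T.graph Subtype.val T.edgeSets) :
    IsTorsoid G M T := by
  have hmate : IsMate (T.inheritedMatching M) μ := by
    refine ⟨rfl, fun i j => ?_⟩
    rw [uses_iff_inherited hM (fun i j hu => F.uses_symm h h.mem hu), F.uses_iff h.mem hμ]
  have hE := fun {i j : T.verts} (a : T.graph.Adj i j) => T.edgeSets_of_adj a
  have hdE : ∀ {i j : T.verts} (a : T.graph.Adj i j) (k : T.verts), Disjoint k.1 (T.eps a) := by
    intro i j a k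
    rw [← hE a]; exact Set.disjoint_left.2 (F.notMem k i j)
  refine ⟨h4, (isMatchingCovered_iff hmate).2 (F.matchCov h hμ), ?_, ?_, ?_, ?_, ?_, ?_, ?_, ?_⟩
  · exact hB.imp_left fun hB X hX => hB X ((isTight_iff hmate X).1 hX)
  · intro v hv; exact (isTight_iff hM _).2 (F.tight ⟨v, hv⟩)
  · rintro A hA B hB hne
    have hmem : ∀ A ∈ Set.range T.edgeFn, ∃ i j, ∃ a : T.graph.Adj i j, A = T.edgeSets i j := by
      rintro A ⟨⟨e, he⟩, rfl⟩
      induction e with | _ a b =>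
      exact ⟨a, b, he, (hE _).symm⟩
    refine Set.disjoint_left.2 fun x hx hy => hne ?_
    simp only [id] at hx hy
    rcases hA with hA | hA <;> rcases hB with hB | hB
    · exact congrArg Subtype.val (F.eq_of_mem ⟨A, hA⟩ ⟨B, hB⟩ x hx hy)
    · obtain ⟨i, j, a, rfl⟩ := hmem B hB
      exact absurd hy (F.notMem ⟨A, hA⟩ _ _ x hx)
    · obtain ⟨i, j, a, rfl⟩ := hmem A hA
      exact absurd hx (F.notMem ⟨B, hB⟩ _ _ x hy)
    · obtain ⟨i, j, a, rfl⟩ := hmem A hA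
      obtain ⟨k, l, b, rfl⟩ := hmem B hB
      rcases Sym2.eq_iff.1 (F.edge_eq_of_mem _ _ _ _ x hx hy) with ⟨rfl, rfl⟩ | ⟨rfl, rfl⟩
      · rfl
      · exact T.edgeSets_symm _ _
  · refine Set.eq_univ_of_forall fun x => ?_
    rcases F.cover x with ⟨i, hi⟩ | ⟨i, j, a, hx⟩
    · exact ⟨i.1, Or.inl i.2, hi⟩
    · exact ⟨_, T.eps_mem a, hx⟩
  · intro i j a
    have := F.edge i j a
    rwa [hE a] at this
  · intro i j a
    have hij : ∀ z, z ∈ i.1 → z ∉ j.1 := fun z hi hj => a.ne (F.eq_of_mem _ _ z hi hj)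
    have hdi := hdE a i
    have hdj := hdE a j
    have hti := F.tight_union i j a
    have htj := F.tight_union j i a.symm
    rw [hE a.symm, T.eps_symm a] at htj
    rw [hE a] at hti
    constructor
    · refine ⟨by grind, ⟨?_, ?_⟩, ?_, ?_⟩ <;> rw [isTight_iff hM]
      · rw [show i.1 \ T.eps a = i.1 by grind]; exact F.tight i
      · exact hti
      · rw [show j.1 \ T.eps a = j.1 by grind]; exact F.tight j
      · exact htj
    · rintro S ⟨hS, hSi, hSj⟩
      simp only [IsPassable, isTight_iff hM] at hSi hSj
      have key : ∀ i j (a : T.graph.Adj i j), S ⊆ i.1 ∪ T.eps a ∪ j.1 → Tight G m (i.1 \ S) →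
          Tight G m (j.1 ∪ S) → S ∩ i.1 = ∅ := by
        intro i j a hS h1 h2
        have hij : ∀ z, z ∈ i.1 → z ∉ j.1 := fun z hi hj => a.ne (F.eq_of_mem _ _ z hi hj)
        have hp : par h (i.1 ∩ S) = 0 := by
          have := par_split h i.1 S
          rw [(F.tight i).par h, h1.par h] at this
          grind
        refine hI i j a _ Set.inter_subset_right ?_ ?_
        · rwa [show i.1 \ (S ∩ i.1) = i.1 \ S by grind]
        · intro x hx z hxz
          by_contra hz
          rw [hE a] at hz
          refine no_edge_of_sdiff h h2 (F.tight i) ?_ (x := x) (y := z) (by grind) hx.2 (by grind)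
            (by grind) hxz
          rw [show (j.1 ∪ S) ∩ i.1 = i.1 ∩ S by grind, hp]
      have k1 := key i j a hS hSi.1 hSj.2
      have k2 := key j i a.symm (by rw [T.eps_symm a]; grind) hSj.1 hSi.2
      intro x hx
      rcases hS hx with (hx' | hx') | hx'
      · exact absurd (k1 ▸ ⟨hx, hx'⟩ : x ∈ (∅ : Set V)) (Set.notMem_empty x)
      · exact hx'
      · exact absurd (k2 ▸ ⟨hx, hx'⟩ : x ∈ (∅ : Set V)) (Set.notMem_empty x)
  · rintro i j hij ha ⟨x, hx, y, hy, hxy⟩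
    exact F.no_edge i j hij ha x hx y hy hxy
  · rintro hc i j k a b hik ⟨P₁, P₂, P₃, h1⟩
    simp only [isTight_iff hM] at h1
    rw [← hE a, ← hE b] at h1
    exact hC hc i j k a b hik ⟨P₁, P₂, P₃, h1⟩

end Torsoids

/-! ### Movable parts and cores -/

section Movable

variable {V ι : Type*} {G : SimpleGraph V} {m : V → V} {Q R S S' : Set V}

/-- `S` is an even part of `Q` that has neighbours only in `Q` and `R`, so that it can be moved from
`Q` to `R`. -/
def Movable (G : SimpleGraph V) (m : V → V) (Q R S : Set V) : Prop :=
  S ⊆ Q ∧ Tight G m (Q \ S) ∧ ∀ x ∈ S, ∀ z, G.Adj x z → z ∈ Q ∪ R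

/-- The largest part of `Q` that can be moved to `R`. -/
def mov (G : SimpleGraph V) (m : V → V) (Q R : Set V) : Set V := ⋃₀ {S | Movable G m Q R S}

theorem mov_subset : mov G m Q R ⊆ Q := Set.sUnion_subset fun _ hS => hS.1

theorem Movable.subset_mov (hS : Movable G m Q R S) : S ⊆ mov G m Q R := Set.subset_sUnion_of_mem hS

theorem mov_nbr {x z : V} (hx : x ∈ mov G m Q R) (a : G.Adj x z) : z ∈ Q ∪ R := by
  obtain ⟨S, hS, hx⟩ := hx
  exact hS.2.2 x hx z a

variable (h : MatchCov G m) (hQ : Tight G m Q)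

include h hQ

theorem Movable.par (hS : Movable G m Q R S) : par h S = 0 := by
  have := par_split h Q S
  rw [hQ.par h, hS.2.1.par h, Set.inter_eq_right.2 hS.1] at this
  grind

theorem mov_eq_empty_of_no_edge (hn : ∀ x ∈ Q, ∀ y ∈ R, ¬ G.Adj x y) : mov G m Q R = ∅ := by
  refine Set.eq_empty_of_forall_notMem fun x ⟨S, hS, hx⟩ => ?_
  rw [eq_empty_of_nbr_subset h hQ hS.1 hS.2.1] at hx
  · exact hx
  · intro x hx z a
    exact (hS.2.2 x hx z a).resolve_right fun hz => hn x (hS.1 hx) z hz a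

/-- Two even parts of a tight set meet evenly if and only if their complements meet oddly. -/
theorem par_sdiff_inter_sdiff (hS : Movable G m Q R S) {R' : Set V} (hS' : Movable G m Q R' S') :
    TightCuts.par h ((Q \ S) ∩ (Q \ S')) = 1 + TightCuts.par h (S ∩ S') := by
  have h1 := par_split h (Q \ S) S'
  have h2 := par_split h S' S
  rw [hS'.par h hQ] at h2
  rw [hS.2.1.par h, show (Q \ S) ∩ S' = S' \ S by have := hS'.1; grind] at h1
  rw [show (Q \ S) ∩ (Q \ S') = (Q \ S) \ S' by grind, show S ∩ S' = S' ∩ S by grind]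
  grind

/-- Between disjoint movable parts there are no edges. -/
theorem Movable.no_edge {R' : Set V} (hS : Movable G m Q R S) (hS' : Movable G m Q R' S')
    (hd : Disjoint S S') {x y : V} (hx : x ∈ S) (hy : y ∈ S') : ¬ G.Adj x y := by
  have h1 := par_sdiff_inter_sdiff h hQ hS hS'
  rw [hd.inter_eq, par_empty, add_zero] at h1
  have := hS.1
  have := hS'.1
  intro a
  exact no_edge_of_inter h hS.2.1 hS'.2.1 h1 (x := y) (y := x) (by grind) (by grind) (by grind)
    (by grind) a.symm

/-- Parts movable to disjoint sets that meet evenly are disjoint. -/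
theorem Movable.inter_eq_empty {R' : Set V} (hS : Movable G m Q R S) (hS' : Movable G m Q R' S')
    (hR : Disjoint R R') (hp : TightCuts.par h (S ∩ S') = 0) : S ∩ S' = ∅ := by
  have h1 := par_sdiff_inter_sdiff h hQ hS hS'
  rw [hp, add_zero] at h1
  have h2 := union_tight h hS.2.1 hS'.2.1 h1
  rw [show (Q \ S) ∪ (Q \ S') = Q \ (S ∩ S') by grind] at h2
  refine eq_empty_of_nbr_subset h hQ (by have := hS.1; grind) h2 fun x hx z a => ?_
  have := hS.2.2 x hx.1 z a
  have := hS'.2.2 x hx.2 z a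
  grind

/-- If two movable parts meet oddly, what remains has no edges to the outside. -/
theorem Movable.no_edge_of_odd {R' : Set V} (hS : Movable G m Q R S) (hS' : Movable G m Q R' S')
    (hp : TightCuts.par h (S ∩ S') = 1) {x y : V} (hx : x ∈ Q) (hxS : x ∉ S) (hxS' : x ∉ S')
    (hy : y ∉ Q) : ¬ G.Adj x y := by
  have h1 := par_sdiff_inter_sdiff h hQ hS hS'
  rw [hp] at h1
  exact no_edge_of_sdiff h hS.2.1 hS'.2.1 (h1.trans (by decide)) ⟨hx, hxS⟩ ⟨hx, hxS'⟩
    (fun h' => hy h'.1) (fun h' => hy h'.1)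

omit h in
theorem movable_empty : Movable G m Q R ∅ := ⟨Set.empty_subset _, by rwa [Set.sdiff_empty], by simp⟩

/-- Unless all edges leaving `Q` lead to `R`, movable sets are closed under unions. -/
theorem Movable.union {u w : V} (hu : u ∈ Q) (hw : w ∉ Q ∪ R) (a : G.Adj u w)
    (hS : Movable G m Q R S) (hS' : Movable G m Q R S') : Movable G m Q R (S ∪ S') := by
  refine ⟨Set.union_subset hS.1 hS'.1, ?_, ?_⟩
  · have h1 : TightCuts.par h (S ∩ S') = 0 := by
      refine (ZMod2.eq_zero_or_one _).resolve_right fun hp => ?_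
      refine hS.no_edge_of_odd h hQ hS' hp hu ?_ ?_ (fun h' => hw (Or.inl h')) a
      · exact fun h' => hw (hS.2.2 u h' w a)
      · exact fun h' => hw (hS'.2.2 u h' w a)
    have h2 := par_sdiff_inter_sdiff h hQ hS hS'
    rw [h1, add_zero] at h2
    have h3 := inter_tight h hS.2.1 hS'.2.1 h2
    rwa [show (Q \ S) ∩ (Q \ S') = Q \ (S ∪ S') by grind] at h3
  · rintro x (hx | hx)
    · exact hS.2.2 x hx
    · exact hS'.2.2 x hx

/-- The largest movable part of `Q` is movable itself, unless all edges leaving `Q` lead to `R`. -/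
theorem movable_mov {u w : V} (hu : u ∈ Q) (hw : w ∉ Q ∪ R) (a : G.Adj u w) :
    Movable G m Q R (mov G m Q R) := by
  refine ⟨mov_subset, ?_, fun x hx z => mov_nbr hx⟩
  refine tight_of_le_one h ⟨u, hu, fun h' => hw (mov_nbr h' a)⟩ (z := w)
    (fun h' => hw (Or.inl h'.1)) ?_
  -- two crossings of the complement of the union are crossings of the complement of one set
  have key : ∀ y, y ∉ Q \ mov G m Q R → ∃ S, Movable G m Q R S ∧ y ∉ Q \ S := by
    intro y hy
    by_cases hyQ : y ∈ Q
    · obtain ⟨S, hS, hyS⟩ : y ∈ mov G m Q R := by by_contra h'; exact hy ⟨hyQ, h'⟩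
      exact ⟨S, hS, fun h' => h'.2 hyS⟩
    · exact ⟨∅, movable_empty hQ, fun h' => hyQ h'.1⟩
  intro f hf x hx hfx y hy hfy
  obtain ⟨S, hS, hxS⟩ := key _ hfx
  obtain ⟨S', hS', hyS⟩ := key _ hfy
  have hU := hS.union h hQ hu hw a hS'
  have h1 := hU.subset_mov
  exact hU.2.1.unique hf ⟨hx.1, fun h' => hx.2 (h1 h')⟩ (by grind)
    ⟨hy.1, fun h' => hy.2 (h1 h')⟩ (by grind)

end Movable

section Core

variable {V ι : Type*} {G : SimpleGraph V} {m : V → V} {K : SimpleGraph ι} {q : ι → Set V}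

/-- What remains of `q i` when everything that can be moved to other members of the partition has
been removed. -/
def core (G : SimpleGraph V) (m : V → V) (q : ι → Set V) (i : ι) : Set V :=
  q i \ ⋃ j, mov G m (q i) (q j)

/-- All that can be moved between `q i` and `q j`. -/
def coreEdge (G : SimpleGraph V) (m : V → V) (q : ι → Set V) (i j : ι) : Set V :=
  mov G m (q i) (q j) ∪ mov G m (q j) (q i)

/-- No member of the partition has a part that can be moved to either of two other members. -/
def NoOverlap (G : SimpleGraph V) (m : V → V) (q : ι → Set V) : Prop :=
  ∀ i j k, j ≠ k → Disjoint (mov G m (q i) (q j)) (mov G m (q i) (q k))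

variable (h : MatchCov G m) (F : IsFrame G m K q fun _ _ => ∅)

include h F

omit h in
theorem IsFrame.adj_of_edge {i j : ι} (hij : i ≠ j) {x y : V} (hx : x ∈ q i) (hy : y ∈ q j)
    (a : G.Adj x y) : K.Adj i j :=
  by_contra fun hn => F.no_edge i j hij hn x hx y hy a

omit h in
theorem IsFrame.exists_mem_part (x : V) : ∃ i, x ∈ q i := by
  simpa using F.cover x

variable (h2 : ∀ i j, ∃ k, K.Adj i k ∧ k ≠ j)

include h2

theorem IsFrame.movable_mov (i j : ι) : Movable G m (q i) (q j) (mov G m (q i) (q j)) := by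
  obtain ⟨k, hk, hkj⟩ := h2 i j
  obtain ⟨x, hx, y, hy, a⟩ := F.edge i k hk
  refine TightCuts.movable_mov h (F.tight i) (u := x) (w := y) (by simpa using hx) ?_ a
  rintro (h' | h')
  · exact hk.ne (F.eq_of_mem _ _ _ h' hy)
  · exact hkj (F.eq_of_mem _ _ _ hy h')

omit h2 in
/-- Only adjacent members have parts that can be moved between them. -/
theorem IsFrame.adj_of_mem_mov {i j : ι} {x : V} (hx : x ∈ mov G m (q i) (q j)) : K.Adj i j := by
  by_contra hn
  by_cases hij : i = j
  · subst hij
    obtain ⟨S, hS, hx⟩ := hx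
    rw [eq_empty_of_nbr_subset h (F.tight i) hS.1 hS.2.1 fun x hx z a => by
      simpa using hS.2.2 x hx z a] at hx
    exact hx
  · rw [mov_eq_empty_of_no_edge h (F.tight i) (F.no_edge i j hij hn)] at hx
    exact hx

/-- An overlap occurs only at members with at most two neighbours. -/
theorem IsFrame.nbr_of_overlap {i j k : ι} (hjk : j ≠ k)
    (ho : ¬ Disjoint (mov G m (q i) (q j)) (mov G m (q i) (q k))) :
    par h (mov G m (q i) (q j) ∩ mov G m (q i) (q k)) = 1 ∧ ∀ l, K.Adj i l → l = j ∨ l = k := by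
  have hj := F.movable_mov h h2 i j
  have hk := F.movable_mov h h2 i k
  have hp : par h (mov G m (q i) (q j) ∩ mov G m (q i) (q k)) = 1 := by
    refine ZMod2.eq_one_of_ne fun hp => ho ?_
    rw [Set.disjoint_iff_inter_eq_empty]
    refine hj.inter_eq_empty h (F.tight i) hk ?_ hp
    exact F.disjoint_vert hjk
  refine ⟨hp, fun l hl => ?_⟩
  obtain ⟨x, hx, y, hy, a⟩ := F.edge i l hl
  have hx : x ∈ q i := by simpa using hx
  have hyi : y ∉ q i := fun h' => hl.ne (F.eq_of_mem _ _ _ h' hy)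
  by_cases hxj : x ∈ mov G m (q i) (q j)
  · left
    exact F.eq_of_mem _ _ _ hy ((mov_nbr hxj a).resolve_left hyi)
  by_cases hxk : x ∈ mov G m (q i) (q k)
  · right
    exact F.eq_of_mem _ _ _ hy ((mov_nbr hxk a).resolve_left hyi)
  exact absurd a (hj.no_edge_of_odd h (F.tight i) hk hp hx hxj hxk hyi)

variable (ho : NoOverlap G m q)

include ho

omit F h2 ho h in
theorem core_subset (i : ι) : core G m q i ⊆ q i := Set.sdiff_subset

theorem IsFrame.no_edge_mov {i j k : ι} (hjk : j ≠ k) {x y : V} (hx : x ∈ mov G m (q i) (q j))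
    (hy : y ∈ mov G m (q i) (q k)) : ¬ G.Adj x y :=
  (F.movable_mov h h2 i j).no_edge h (F.tight i) (F.movable_mov h h2 i k) (ho i j k hjk) hx hy

/-- If `f` leaves `q i` from a movable part, then it also matches a vertex of this part to the
core. -/
theorem IsFrame.exists_cross_mov {f : V → V} (hf : f ∈ Mates G m) {i j : ι} {x : V}
    (hx : x ∈ mov G m (q i) (q j)) (hfx : f x ∉ q i) :
    ∃ z ∈ core G m q i, f z ∈ mov G m (q i) (q j) := by
  have hm := F.movable_mov h h2 i j
  obtain ⟨z, hz, hfz, hzx⟩ := exists_cross_ne h hf (hm.par h (F.tight i)) hx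
    (fun h' => hfx (mov_subset h'))
  have hfz' : f z ∈ q i := by
    by_contra h'
    exact hzx ((F.tight i).unique hf (mov_subset hz) h' (mov_subset hx) hfx)
  refine ⟨f z, ⟨hfz', ?_⟩, by rwa [hf.2.1]⟩
  simp only [Set.mem_iUnion, not_exists]
  intro k hk
  by_cases hjk : j = k
  · subst hjk; exact hfz hk
  · exact F.no_edge_mov h h2 ho hjk hz hk (hf.1 z)

theorem IsFrame.core_nonempty (i : ι) : (core G m q i).Nonempty := by
  obtain ⟨c, hc, hfc, -⟩ := (F.tight i).cross h.mem
  by_cases hcc : c ∈ core G m q i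
  · exact ⟨c, hcc⟩
  · have : c ∈ ⋃ j, mov G m (q i) (q j) := by by_contra h'; exact hcc ⟨hc, h'⟩
    obtain ⟨j, hj⟩ := Set.mem_iUnion.1 this
    obtain ⟨z, hz, -⟩ := F.exists_cross_mov h h2 ho h.mem hj hfc
    exact ⟨z, hz⟩

theorem IsFrame.core_tight (i : ι) : Tight G m (core G m q i) :=
  sdiff_iUnion_tight h (F.tight i) (fun _ => mov_subset) (fun j => (F.movable_mov h h2 i j).2.1)
    (ho i) (F.core_nonempty h h2 ho i)

theorem IsFrame.core_union_tight (i j : ι) : Tight G m (core G m q i ∪ coreEdge G m q i j) := by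
  have h1 : Tight G m (core G m q i ∪ mov G m (q i) (q j)) := by
    have e : core G m q i ∪ mov G m (q i) (q j) =
        q i \ ⋃ k : {k // k ≠ j}, mov G m (q i) (q k) := by
      ext x
      have h1 : x ∈ mov G m (q i) (q j) → x ∈ q i := fun h' => mov_subset h'
      have h2 : ∀ k, x ∈ mov G m (q i) (q j) → x ∈ mov G m (q i) (q k) → k = j := fun k h1 h2 =>
        by_contra fun h' => Set.disjoint_left.1 (ho i k j h') h2 h1
      simp only [core, Set.mem_union, Set.mem_sdiff, Set.mem_iUnion, Subtype.exists, exists_prop]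
      grind
    rw [e]
    refine sdiff_iUnion_tight h (F.tight i) (fun _ => mov_subset)
      (fun j => (F.movable_mov h h2 i j).2.1) 
      (fun k l hkl => ho i k l fun h' => hkl (Subtype.ext h')) ?_
    rw [← e]
    exact (F.core_nonempty h h2 ho i).mono Set.subset_union_left
  by_cases a : K.Adj i j
  swap
  · have e : mov G m (q j) (q i) = ∅ := Set.eq_empty_of_forall_notMem fun x hx =>
      a (F.adj_of_mem_mov h hx).symm
    rwa [coreEdge, e, Set.union_empty]
  have hm := F.movable_mov h h2 j i
  rw [coreEdge, ← Set.union_assoc]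
  refine union_tight_of_nbr_subset h (F.tight j) hm.1 hm.2.1 h1 ?_ ?_
  · refine Set.disjoint_left.2 fun x hx hx' => a.ne (F.eq_of_mem _ _ x ?_ hx')
    exact hx.elim (fun h' => h'.1) (fun h' => mov_subset h')
  · intro x hx z hxz
    refine (mov_nbr hx hxz).imp_right fun hz => ?_
    by_contra hz'
    have : z ∈ ⋃ k, mov G m (q i) (q k) := by
      by_contra h'; exact hz' (Or.inl ⟨hz, h'⟩)
    obtain ⟨k, hk⟩ := Set.mem_iUnion.1 this
    have hxj := mov_subset hx
    rcases mov_nbr hk hxz.symm with h3 | h3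
    · exact a.ne (F.eq_of_mem _ _ _ h3 hxj)
    · obtain rfl := F.eq_of_mem _ _ _ h3 hxj
      exact hz' (Or.inr hk)

/-- A matching edge between two members gives one between the corresponding core and the other
core together with the edge set. -/
theorem IsFrame.exists_core_cross {f : V → V} (hf : f ∈ Mates G m) {i j : ι} (hij : i ≠ j) {x : V}
    (hx : x ∈ q i) (hfx : f x ∈ q j) :
    ∃ z ∈ core G m q i, f z ∈ core G m q j ∪ coreEdge G m q i j := by
  have hfi : f x ∉ q i := fun h' => hij (F.eq_of_mem _ _ _ h' hfx)
  have hxj : x ∉ q j := fun h' => hij (F.eq_of_mem _ _ _ hx h')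
  have key : ∀ i j, ∀ x, x ∈ q i → f x ∈ q j → f x ∉ q i →
      x ∈ core G m q i ∨ x ∈ mov G m (q i) (q j) := by
    intro i j x hx hfx hfi
    by_cases hc : x ∈ core G m q i
    · exact Or.inl hc
    · have : x ∈ ⋃ k, mov G m (q i) (q k) := by by_contra h'; exact hc ⟨hx, h'⟩
      obtain ⟨k, hk⟩ := Set.mem_iUnion.1 this
      obtain rfl := F.eq_of_mem _ _ _ hfx ((mov_nbr hk (hf.1 x)).resolve_left hfi)
      exact Or.inr hk
  rcases key i j x hx hfx hfi with h1 | h1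
  · refine ⟨x, h1, ?_⟩
    rcases key j i (f x) hfx (by rwa [hf.2.1]) (by rwa [hf.2.1]) with h3 | h3
    · exact Or.inl h3
    · exact Or.inr (Or.inr h3)
  · obtain ⟨z, hz, hfz⟩ := F.exists_cross_mov h h2 ho hf h1 hfi
    exact ⟨z, hz, Or.inr (Or.inl hfz)⟩

/-- The cores of the members of a partition and the sets that can be moved between them form a
frame. -/
theorem IsFrame.core_isFrame : IsFrame G m K (core G m q) (coreEdge G m q) := by
  have hmem : ∀ i j x, x ∈ coreEdge G m q i j → x ∈ mov G m (q i) (q j) ∨ x ∈ mov G m (q j) (q i) :=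
    fun _ _ _ h => h
  have hmov : ∀ i j k l x, x ∈ mov G m (q i) (q j) → x ∈ mov G m (q k) (q l) → i = k ∧ j = l := by
    intro i j k l x hx hy
    obtain rfl := F.eq_of_mem _ _ _ (mov_subset hx) (mov_subset hy)
    exact ⟨rfl, by_contra fun h' => Set.disjoint_left.1 (ho i j l h') hx hy⟩
  have hcm : ∀ i k l x, x ∈ core G m q i → x ∉ mov G m (q k) (q l) := by
    intro i k l x hx hy
    obtain rfl := F.eq_of_mem _ _ _ hx.1 (mov_subset hy)
    exact hx.2 (Set.mem_iUnion.2 ⟨l, hy⟩)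
  refine ⟨F.core_tight h h2 ho, fun i j _ => F.core_union_tight h h2 ho i j,
    fun i j => Set.union_comm _ _, ?_, fun i j x hx hy => F.eq_of_mem i j x hx.1 hy.1, ?_, ?_, ?_,
    ?_, fun i j hij ha x hx y hy => F.no_edge i j hij ha x hx.1 y hy.1⟩
  · rintro i j x (hx | hx)
    · exact F.adj_of_mem_mov h hx
    · exact (F.adj_of_mem_mov h hx).symm
  · rintro i j k x hx (hy | hy) <;> exact hcm _ _ _ _ hx hy
  · rintro i j k l x (hx | hx) (hy | hy) <;> obtain ⟨rfl, rfl⟩ := hmov _ _ _ _ _ hx hy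
    · rfl
    · exact Sym2.eq_swap
    · exact Sym2.eq_swap
    · rfl
  · intro x
    obtain ⟨i, hi⟩ := F.exists_mem_part x
    by_cases hc : x ∈ core G m q i
    · exact Or.inl ⟨i, hc⟩
    · have : x ∈ ⋃ k, mov G m (q i) (q k) := by by_contra h'; exact hc ⟨hi, h'⟩
      obtain ⟨k, hk⟩ := Set.mem_iUnion.1 this
      exact Or.inr ⟨i, k, Or.inl hk⟩
  · intro i j a
    obtain ⟨f, hf, -, x, hx, hfx⟩ := F.exists_uses_of_adj h a.symm
    obtain ⟨z, hz, hfz⟩ := F.exists_core_cross h h2 ho hf a.ne.symm hx (by simpa using hfx)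
    exact ⟨f z, by rwa [coreEdge, Set.union_comm (mov G m (q i) (q j))], z, hz, (hf.1 z).symm⟩

theorem IsFrame.core_induces {f : V → V} (hf : f ∈ Mates G m) {g : ι → ι}
    (hg : Induces K q (fun _ _ => ∅) f g) : Induces K (core G m q) (coreEdge G m q) f g := by
  intro i
  obtain ⟨a, x, hx, hfx⟩ := hg i
  exact ⟨a, F.exists_core_cross h h2 ho hf a.ne hx (by simpa using hfx)⟩

/-- The cores are irreducible. -/
theorem IsFrame.core_irred : Irred G m K (core G m q) (coreEdge G m q) := by
  have F' := F.core_isFrame h h2 ho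
  intro i j a S hS hiS hN
  have hm := F.movable_mov h h2 i j
  have hju := F'.tight_union j i a.symm
  rw [F'.symm j i] at hju
  have hd : Disjoint (core G m q j ∪ coreEdge G m q i j) (core G m q i) := by
    refine Set.disjoint_left.2 fun x hx hxi => ?_
    rcases hx with hx | hx
    · exact a.ne (F'.eq_of_mem _ _ _ hxi hx)
    · exact F'.notMem _ _ _ _ hxi hx
  have h1 := union_tight_of_nbr_subset h (F'.tight i) hS hiS hju hd hN
  have hSm : ∀ x ∈ S, x ∉ mov G m (q i) (q j) := fun x hx hx' =>
    (hS hx).2 (Set.mem_iUnion.2 ⟨j, hx'⟩)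
  have hpS : par h S = 0 := by
    have := par_split h (core G m q i) S
    rw [(F'.tight i).par h, hiS.par h, Set.inter_eq_right.2 hS] at this
    grind
  have e : q i ∩ (core G m q j ∪ coreEdge G m q i j ∪ S) = S ∪ mov G m (q i) (q j) := by
    ext x
    have h1 : x ∈ mov G m (q i) (q j) → x ∈ q i := fun h' => mov_subset h'
    have h3 : x ∈ mov G m (q j) (q i) → x ∈ q j := fun h' => mov_subset h'
    have h4 : x ∈ core G m q j → x ∈ q j := fun h' => h'.1
    have h5 : x ∈ S → x ∈ q i := fun h' => (hS h').1
    have h6 : x ∈ q i → x ∉ q j := fun h' h'' => a.ne (F.eq_of_mem _ _ _ h' h'')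
    simp only [coreEdge, Set.mem_inter_iff, Set.mem_union]
    grind
  have hp : par h (q i ∩ (core G m q j ∪ coreEdge G m q i j ∪ S)) = 0 := by
    rw [e, par_union h (Set.disjoint_left.2 hSm), hpS, hm.par h (F.tight i), add_zero]
  have h3 := sdiff_tight h (F.tight i) h1 hp
  have h4 : Movable G m (q i) (q j) (S ∪ mov G m (q i) (q j)) := by
    refine ⟨?_, ?_, ?_⟩
    · rw [← e]; exact Set.inter_subset_left
    · rwa [← e, Set.sdiff_self_inter]
    · rintro x (hx | hx) z hxz
      · rcases hN x hx z hxz with h5 | h5 | h5 | h5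
        · exact Or.inl h5.1
        · exact Or.inr h5.1
        · exact Or.inl (mov_subset h5)
        · exact Or.inr (mov_subset h5)
      · exact mov_nbr hx hxz
  exact Set.eq_empty_of_forall_notMem fun x hx => hSm x hx (h4.subset_mov (Or.inl hx))

end Core

/-! ### Cores of cycles -/

section Cycles

variable {V ι : Type*} {G : SimpleGraph V} {m : V → V} {K : SimpleGraph ι} {q : ι → Set V}
  {H : SimpleGraph ι} {v : ι → Set V} {E : ι → ι → Set V}

theorem Deg2.other (hd : Deg2 H) {i j : ι} (a : H.Adj i j) :
    ∃ k, k ≠ j ∧ H.Adj i k ∧ ∀ l, H.Adj i l → l = j ∨ l = k := by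
  obtain ⟨b, c, hbc, h1, h2, h3⟩ := hd i
  rcases h3 j a with rfl | rfl
  · exact ⟨c, hbc.symm, h2, h3⟩
  · exact ⟨b, hbc, h1, fun l hl => (h3 l hl).symm⟩

theorem Deg2.exists_ne (hd : Deg2 H) (i j : ι) : ∃ k, H.Adj i k ∧ k ≠ j := by
  obtain ⟨k, l, hkl, hk, hl, -⟩ := hd i
  by_cases hj : k = j
  · exact ⟨l, hl, fun h' => hkl (hj.trans h'.symm)⟩
  · exact ⟨k, hk, hj⟩

variable (h : MatchCov G m)

include h

theorem par_inter_union {A B C : Set V} (hd : Disjoint B C) :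
    par h (A ∩ (B ∪ C)) = par h (A ∩ B) + par h (A ∩ C) := by
  rw [Set.inter_union_distrib_left, 
    par_union h (hd.mono Set.inter_subset_right Set.inter_subset_right)]

theorem par_eq_add {A B C D : Set V} (h1 : Disjoint B C) (h2 : Disjoint B D) (h3 : Disjoint C D)
    (hA : A ⊆ B ∪ C ∪ D) : par h A = par h (A ∩ B) + par h (A ∩ C) + par h (A ∩ D) := by
  rw [← par_inter_union h h1, ← par_inter_union h (Set.disjoint_union_left.2 ⟨h2, h3⟩),
    Set.inter_eq_left.2 hA]

/-- An irreducible cycle without lengthwise cut edges is maximal. -/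
theorem cycleMax_of_noSplit (F : IsFrame G m H v E) (hd : Deg2 H) (hI : Irred G m H v E)
    (hS : NoSplit h H v E) : CycleMax G m H v E := by
  rintro i j k a b hik ⟨P₁, P₂, P₃, t1, t2, t3, d12, d13, d23, hU, hZ', hZ⟩
  have hdis : ∀ i j, i ≠ j → Disjoint (v i) (v j) := fun i j hij =>
    F.disjoint_vert hij
  have hdE : ∀ i j k, Disjoint (v i) (E j k) := fun i j k => Set.disjoint_left.2 (F.notMem i j k)
  -- a tight set containing one neighbour of `j` and missing the other is even on both edge sets
  have key : ∀ i k, H.Adj i j → H.Adj j k → i ≠ k → ∀ Z, Tight G m Z → v k ⊆ Z → v i ∩ Z = ∅ →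
      par h (E i j ∩ Z) = 0 ∧ par h (E j k ∩ Z) = 0 := by
    intro i k a b hik Z hZ hk hi
    have hki := hdis _ _ hik
    have hkj := hdis _ _ b.ne
    have hij := hdis _ _ a.ne
    have hEi := hdE k i j
    have hEk := hdE i j k
    obtain ⟨x, hx⟩ := (F.tight k).nonempty h
    obtain ⟨y, hy⟩ := (F.tight i).nonempty h
    have hpi : par h (v i ∩ Z) = 0 := by rw [hi, par_empty]
    have hpk : par h (v k ∩ Z) = 1 := by rw [Set.inter_eq_left.2 hk, (F.tight k).par h]
    constructor
    · refine (ZMod2.eq_zero_or_one _).resolve_right fun hE => ?_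
      rcases ZMod2.eq_zero_or_one (par h (v j ∩ Z)) with hj | hj
      · have := F.subset_of_odd h a hZ hpi hj hE
        grind
      · exact hS j i a.symm Z hZ (by rwa [F.symm j i]) hj hpi
    · refine (ZMod2.eq_zero_or_one _).resolve_right fun hE => ?_
      rcases ZMod2.eq_zero_or_one (par h (v j ∩ Z)) with hj | hj
      · exact hS k j b.symm Z hZ (by rwa [F.symm k j]) hpk hj
      · have := F.subset_of_odd h b hZ.compl
          (by rw [par_compl_inter, (F.tight j).par h, hj]; decide)
          (by rw [par_compl_inter, (F.tight k).par h, hpk]; decide)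
          (by rw [par_compl_inter, F.par_edge h, hE]; decide)
        have hyZ : y ∈ Zᶜ := fun h' => Set.eq_empty_iff_forall_notMem.1 hi y ⟨hy, h'⟩
        rcases this hyZ with (h' | h') | h'
        · exact Set.disjoint_left.1 hij hy h'
        · exact Set.disjoint_left.1 hki hy h'
        · exact Set.disjoint_left.1 hEk hy h'
  have hki := hdis _ _ hik
  have hkj := hdis _ _ b.ne
  have hij := hdis _ _ a.ne
  have e1 := hdE k i j
  have e2 := hdE i j k
  have e3 := hdE i i j
  have e4 := hdE j i j
  have e5 := hdE j j k
  have e6 := hdE k j k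
  have e7 : Disjoint (E i j) (E j k) := by
    refine Set.disjoint_left.2 fun x hx hy => ?_
    have h1 := F.edge_eq_of_mem _ _ _ _ _ hx hy
    rcases Sym2.eq_iff.1 h1 with ⟨h1, -⟩ | ⟨h1, -⟩
    · exact a.ne h1
    · exact hik h1
  have hm : ∀ x, x ∈ P₁ ∨ x ∈ P₂ ∨ x ∈ P₃ ↔ x ∈ E i j ∨ x ∈ v j ∨ x ∈ E j k := by
    intro x
    have : x ∈ P₁ ∪ P₂ ∪ P₃ ↔ x ∈ E i j ∪ v j ∪ E j k := by rw [hU]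
    simpa [or_assoc] using this
  have hiP : ∀ x, x ∈ v i → x ∉ P₁ ∧ x ∉ P₂ ∧ x ∉ P₃ := by
    clear key
    intro x hx
    have := (hm x).1
    grind
  have hkP : ∀ x, x ∈ v k → x ∉ P₁ ∧ x ∉ P₂ ∧ x ∉ P₃ := by
    clear key
    intro x hx
    have := (hm x).1
    grind
  have hiZ : v i ∩ (P₂ ∪ P₃ ∪ v k) = ∅ := by
    ext x; have := hiP x; grind
  have hkZ : v k ∩ (v i ∪ P₁ ∪ P₂) = ∅ := by
    ext x; have := hkP x; grind
  obtain ⟨k1, k2⟩ := key i k a b hik _ hZ Set.subset_union_right hiZ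
  obtain ⟨k3, k4⟩ := key k i b.symm a.symm hik.symm _ hZ'
    (Set.subset_union_left.trans Set.subset_union_left) hkZ
  clear key
  rw [F.symm k j] at k3
  rw [F.symm j i] at k4
  have hsub : ∀ A, (∀ x ∈ A, x ∈ E i j ∨ x ∈ v j ∨ x ∈ E j k) → A ⊆ P₁ ∪ P₂ ∪ P₃ := by
    intro A hA x hx
    rw [hU]; simpa [or_assoc] using hA x hx
  -- an edge set is even on each of the three parts
  have even3 : ∀ A, Disjoint A (v i) → Disjoint A (v k) → A ⊆ P₁ ∪ P₂ ∪ P₃ → par h A = 0 →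
      par h (A ∩ (P₂ ∪ P₃ ∪ v k)) = 0 → par h (A ∩ (v i ∪ P₁ ∪ P₂)) = 0 →
      par h (A ∩ P₁) = 0 ∧ par h (A ∩ P₂) = 0 ∧ par h (A ∩ P₃) = 0 := by
    intro A hAi hAk hA hA0 h1 h2
    rw [Set.inter_union_distrib_left, hAk.inter_eq, Set.union_empty, par_inter_union h d23] at h1
    rw [Set.union_assoc, Set.inter_union_distrib_left, hAi.inter_eq, Set.empty_union,
      par_inter_union h d12] at h2
    have h3 := par_eq_add h d12 d13 d23 hA
    grind
  obtain ⟨a1, a2, a3⟩ := even3 (E i j) e3.symm e1.symm (hsub _ fun x hx => Or.inl hx)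
    (F.par_edge h i j) k1 k4
  obtain ⟨b1, b2, b3⟩ := even3 (E j k) e2.symm e6.symm (hsub _ fun x hx => Or.inr (Or.inr hx))
    (F.par_edge h j k) k2 k3
  have hv : ∀ P, Tight G m P → P ⊆ P₁ ∪ P₂ ∪ P₃ → par h (E i j ∩ P) = 0 →
      par h (E j k ∩ P) = 0 → par h (v j ∩ P) = 1 := by
    intro P hP hPs h1 h2
    have h3 := par_eq_add h e4.symm e7 e5 (hU ▸ hPs)
    rw [hP.par h, Set.inter_comm, h1, Set.inter_comm P (E j k), h2, Set.inter_comm] at h3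
    grind
  have c2 := hv P₂ t2 (Set.subset_union_right.trans Set.subset_union_left) a2 b2
  have c3 := hv P₃ t3 Set.subset_union_right a3 b3
  have c4 : par h (v j ∩ (P₂ ∪ P₃ ∪ v k)) = 0 := by
    rw [Set.inter_union_distrib_left, hkj.inter_eq, Set.union_empty, par_inter_union h d23, c2, c3]
    decide
  have hnb : ∀ l, H.Adj j l → l = i ∨ l = k := by
    obtain ⟨l, hl, -, h1⟩ := hd.other a.symm
    intro l' hl'
    rcases h1 l' hl' with h3 | h3 <;> rcases h1 k b with h4 | h4
    · exact Or.inl h3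
    · exact Or.inl h3
    · exact absurd h4.symm hik
    · exact Or.inr (h3.trans h4.symm)
  have h3 := inter_vert_eq_empty h F hI a.symm b hnb hZ c4 (by rw [hiZ, par_empty])
    (by rwa [F.symm j i])
  have h4 : v j ∩ P₂ = ∅ := Set.eq_empty_of_subset_empty (h3 ▸ Set.inter_subset_inter_right _
    (Set.subset_union_left.trans Set.subset_union_left))
  rw [h4, par_empty] at c2
  exact absurd c2 (by decide)

variable (F : IsFrame G m K q fun _ _ => ∅) (h2 : ∀ i j, ∃ k, K.Adj i k ∧ k ≠ j)
  (ho : NoOverlap G m q)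

include F h2 ho

/-- If the edge set of `ij` were cut lengthwise, then everything in `q i` apart from one half of the
part that can be moved to `q j` could be moved to the other neighbour of `q i`. -/
theorem IsFrame.core_noSplit (hd : Deg2 K) : NoSplit h K (core G m q) (coreEdge G m q) := by
  have F' := F.core_isFrame h h2 ho
  have key : ∀ i j, K.Adj i j → ∀ Z, Tight G m Z → par h (coreEdge G m q i j ∩ Z) = 1 →
      par h (core G m q i ∩ Z) = 1 → par h (core G m q j ∩ Z) = 0 →
      par h (mov G m (q i) (q j) ∩ Z) = 1 → par h (mov G m (q j) (q i) ∩ Z) = 0 → False := by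
    intro i j a Z hZ hE hi hj hr hr'
    obtain ⟨hP2, hP1, hno⟩ := split_facts h F' a hZ hE hi hj
    obtain ⟨-, -, hno'⟩ := split_facts h F' a.symm hZ.compl
      (by rw [par_compl_inter, F'.par_edge h, F'.symm, hE]; decide)
      (by rw [par_compl_inter, (F'.tight j).par h, hj]; decide)
      (by rw [par_compl_inter, (F'.tight i).par h, hi]; decide)
    obtain ⟨l, hlj, al, hl⟩ := hd.other a
    have hij : ∀ x, x ∈ q i → x ∉ q j := fun x hx hy => a.ne (F.eq_of_mem _ _ _ hx hy)
    have hci : ∀ x, x ∈ core G m q i → x ∈ q i := fun x hx => hx.1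
    have hri : ∀ x, x ∈ mov G m (q i) (q j) → x ∈ q i := fun x hx => mov_subset hx
    have hrj : ∀ x, x ∈ mov G m (q j) (q i) → x ∈ q j := fun x hx => mov_subset hx
    have hE' : ∀ x, x ∈ coreEdge G m q i j ↔ x ∈ mov G m (q i) (q j) ∨ x ∈ mov G m (q j) (q i) :=
      fun _ => Iff.rfl
    have hcE : ∀ x, x ∈ core G m q i → x ∉ coreEdge G m q i j := F'.notMem i i j
    have hpr := (F.movable_mov h h2 i j).par h (F.tight i)
    have hpr' := (F.movable_mov h h2 j i).par h (F.tight j)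
    have p2R : par h ((coreEdge G m q i j ∩ Z) ∩ q j) = 0 := by
      rw [← hr']; congr 1; ext x
      have := hri x; have := hrj x; have := hij x; have := hE' x; grind
    have p1R : par h ((coreEdge G m q i j \ Z) ∩ q j) = 0 := by
      have := par_split h (mov G m (q j) (q i)) Z
      rw [hpr', hr', zero_add] at this
      rw [this]; congr 1; ext x
      have := hri x; have := hrj x; have := hij x; have := hE' x; grind
    have e1 : (coreEdge G m q i j \ Z) ∩ q i = mov G m (q i) (q j) \ Z := by
      ext x
      have := hri x; have := hrj x; have := hij x; have := hE' x; grind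
    have p1Q : par h ((coreEdge G m q i j \ Z) ∩ q i) = 1 := by
      have := par_split h (mov G m (q i) (q j)) Z
      rw [e1]; grind
    have tP1 := inter_tight h hP1 (F.tight i) p1Q
    have tP2 := sdiff_tight h hP2 (F.tight j) p2R
    have no1 : ∀ x ∈ core G m q i, ∀ y ∈ mov G m (q j) (q i), y ∈ Z → ¬ G.Adj x y := by
      intro x hx y hy hyZ hxy
      have := hri x; have := hrj x; have := hij x; have := hcE x hx; have := hci x hx
      refine no_edge_of_sdiff h hP2 (F.tight j) p2R (x := y) (y := x) ?_ (mov_subset hy) ?_ ?_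
        hxy.symm
      · exact ⟨Or.inr hy, hyZ⟩
      · grind
      · grind
    have hmv : Movable G m (q i) (q l) (q i \ (mov G m (q i) (q j) \ Z)) := by
      refine ⟨Set.sdiff_subset, ?_, ?_⟩
      · rw [e1] at tP1
        rwa [show q i \ (q i \ (mov G m (q i) (q j) \ Z)) = mov G m (q i) (q j) \ Z by
          ext x; have := hri x; grind]
      · rintro x ⟨hx, hxr⟩ y hxy
        by_contra hy
        have hyi : y ∉ q i := fun h' => hy (Or.inl h')
        have hyl : y ∉ q l := fun h' => hy (Or.inr h')
        have hyj : y ∈ q j := by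
          obtain ⟨b, hb⟩ := F.exists_mem_part y
          have hib : i ≠ b := by rintro rfl; exact hyi hb
          rcases hl b (F.adj_of_edge hib hx hb hxy) with rfl | rfl
          · exact hb
          · exact absurd hb hyl
        have hxj := hij x hx
        have hyc : y ∈ core G m q j ∨ y ∈ mov G m (q j) (q i) := by
          by_contra! hc
          have : y ∈ ⋃ k, mov G m (q j) (q k) := by
            by_contra h'; exact hc.1 ⟨hyj, h'⟩
          obtain ⟨k, hk⟩ := Set.mem_iUnion.1 this
          obtain rfl := F.eq_of_mem _ _ _ hx ((mov_nbr hk hxy.symm).resolve_left hxj)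
          exact hc.2 hk
        by_cases hxc : x ∈ core G m q i
        · rcases hyc with hyc | hyc
          · exact hno x hxc y (Or.inl hyc) hxy
          · by_cases hyZ : y ∈ Z
            · exact no1 x hxc y hyc hyZ hxy
            · exact hno x hxc y (Or.inr ⟨Or.inr hyc, hyZ⟩) hxy
        · have : x ∈ ⋃ k, mov G m (q i) (q k) := by
            by_contra h'; exact hxc ⟨hx, h'⟩
          obtain ⟨k, hk⟩ := Set.mem_iUnion.1 this
          obtain rfl := F.eq_of_mem _ _ _ hyj ((mov_nbr hk hxy).resolve_left hyi)
          have hxZ : x ∈ Z := by by_contra h'; exact hxr ⟨hk, h'⟩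
          rcases hyc with hyc | hyc
          · exact hno' y hyc x (Or.inr ⟨Or.inr hk, fun h' => h' hxZ⟩) hxy.symm
          · by_cases hyZ : y ∈ Z
            · obtain ⟨f, hf, rfl⟩ := h.cov x y hxy
              obtain ⟨z, hz, hfz⟩ := F.exists_core_cross h h2 ho hf a.ne hx hyj
              have hfz' : f z ∈ mov G m (q i) (q j) ∧ f z ∈ Z := by
                have n1 := fun h' => hno z hz (f z) h' (hf.1 z)
                have n2 := fun h1 h' => no1 z hz (f z) h1 h' (hf.1 z)
                have := hE' (f z)
                grind
              have hff := hf.2.1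
              have hzi := hci z hz
              have hzE := hcE z hz
              have := tP2.unique hf (x := f z) (y := x)
                ⟨⟨Or.inl hfz'.1, hfz'.2⟩, hij _ (hri _ hfz'.1)⟩ (by rw [hff]; grind)
                ⟨⟨Or.inl hk, hxZ⟩, hxj⟩ (fun h' => h'.2 hyj)
              rw [← this, hff] at hyi
              exact hyi hzi
            · refine no_edge_of_sdiff h hP1 (F.tight j) p1R (x := y) (y := x)
                ⟨Or.inr hyc, hyZ⟩ hyj (fun h' => h'.2 hxZ) hxj hxy.symm
    obtain ⟨x, hx, -⟩ := exists_cross h h.mem hr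
    exact Set.disjoint_left.1 (ho i j l hlj.symm) hx.1
      (hmv.subset_mov ⟨hri x hx.1, fun h' => h'.2 hx.2⟩)
  intro i j a Z hZ hE hi hj
  have hd' : Disjoint (mov G m (q i) (q j)) (mov G m (q j) (q i)) :=
    Set.disjoint_left.2 fun x hx hy => a.ne (F.eq_of_mem _ _ _ (mov_subset hx) (mov_subset hy))
  have hsum : par h (coreEdge G m q i j ∩ Z) =
      par h (mov G m (q i) (q j) ∩ Z) + par h (mov G m (q j) (q i) ∩ Z) := by
    rw [← par_union h (by grind), coreEdge, Set.union_inter_distrib_right]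
  have hpr := (F.movable_mov h h2 i j).par h (F.tight i)
  have hpr' := (F.movable_mov h h2 j i).par h (F.tight j)
  rcases ZMod2.eq_zero_or_one (par h (mov G m (q i) (q j) ∩ Z)) with h0 | h0
  · refine key j i a.symm Zᶜ hZ.compl ?_ ?_ ?_ ?_ ?_ <;> rw [par_compl_inter]
    · rw [F'.par_edge h, F'.symm, hE]; decide
    · rw [(F'.tight j).par h, hj]; decide
    · rw [(F'.tight i).par h, hi]; decide
    · grind
    · grind
  · exact key i j a Z hZ hE hi hj h0 (by grind)

end Cycles

/-! ### The torsoid of a frame -/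

section OfFrame

variable {V ι : Type*} {G : SimpleGraph V} {m : V → V} {M : G.Subgraph} {H : SimpleGraph ι}
  {v : ι → Set V} {E : ι → ι → Set V}

/-- The pre-torsoid with the vertices, edges and edge sets of a frame. -/
def PreTorsoid.ofFrame (H : SimpleGraph ι) (v : ι → Set V) (E : ι → ι → Set V) : PreTorsoid V where
  verts := Set.range v
  graph :=
    { Adj := fun A B => A ≠ B ∧ ∃ i j, v i = A.1 ∧ v j = B.1 ∧ H.Adj i j
      symm := ⟨fun _ _ ⟨hne, i, j, hi, hj, a⟩ => ⟨hne.symm, j, i, hj, hi, a.symm⟩⟩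
      loopless := ⟨fun _ h => h.1 rfl⟩ }
  edgeFn := fun e => {x | ∃ A B : Set.range v, ∃ i j, e.1 = s(A, B) ∧ v i = A.1 ∧ v j = B.1 ∧
    x ∈ E i j}

/-- The vertex of `PreTorsoid.ofFrame` that belongs to a vertex of the frame. -/
def vertOf (H : SimpleGraph ι) (v : ι → Set V) (E : ι → ι → Set V) (i : ι) :
    (PreTorsoid.ofFrame H v E).verts := ⟨v i, i, rfl⟩

theorem exists_vertOf (A : (PreTorsoid.ofFrame H v E).verts) : ∃ i, vertOf H v E i = A := by
  obtain ⟨-, i, rfl⟩ := A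
  exact ⟨i, rfl⟩

variable (h : MatchCov G m) (F : IsFrame G m H v E)

include h F

theorem IsFrame.injective : Function.Injective v := by
  intro i j hij
  obtain ⟨x, hx⟩ := (F.tight i).nonempty h
  exact F.eq_of_mem _ _ _ hx (hij ▸ hx)

theorem IsFrame.vertOf_injective : Function.Injective (vertOf H v E) :=
  fun _ _ hij => F.injective h (congrArg Subtype.val hij)

theorem IsFrame.ofFrame_adj (i j : ι) :
    (PreTorsoid.ofFrame H v E).graph.Adj (vertOf H v E i) (vertOf H v E j) ↔ H.Adj i j := by
  constructor
  · rintro ⟨-, k, l, hk, hl, a⟩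
    rwa [F.injective h hk, F.injective h hl] at a
  · exact fun a => ⟨fun h' => a.ne (F.vertOf_injective h h'), i, j, rfl, rfl, a⟩

theorem IsFrame.ofFrame_edgeSets (i j : ι) :
    (PreTorsoid.ofFrame H v E).edgeSets (vertOf H v E i) (vertOf H v E j) = E i j := by
  ext x
  constructor
  · rintro ⟨a, A, B, k, l, he, hk, hl, hx⟩
    rcases Sym2.eq_iff.1 (he : s(vertOf H v E i, vertOf H v E j) = s(A, B)) with ⟨h1, h2⟩ | ⟨h1, h2⟩ <;>
      subst h1 <;> subst h2 <;>
      rw [F.injective h hk, F.injective h hl] at hx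
    · exact hx
    · rwa [F.symm]
  · intro hx
    exact ⟨(F.ofFrame_adj h i j).2 (F.adj_of_mem _ _ _ hx), _, _, i, j, rfl, rfl, rfl, hx⟩

theorem IsFrame.ofFrame_isFrame : IsFrame G m (PreTorsoid.ofFrame H v E).graph Subtype.val
    (PreTorsoid.ofFrame H v E).edgeSets := by
  have hA := F.ofFrame_adj h
  have hE := F.ofFrame_edgeSets h
  refine ⟨?_, ?_, PreTorsoid.edgeSets_symm _, ?_, ?_, ?_, ?_, ?_, ?_, ?_⟩
  · intro A
    obtain ⟨i, rfl⟩ := exists_vertOf A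
    exact F.tight i
  · intro A B a
    obtain ⟨i, rfl⟩ := exists_vertOf A
    obtain ⟨j, rfl⟩ := exists_vertOf B
    rw [hE]
    exact F.tight_union i j ((hA i j).1 a)
  · rintro A B x ⟨a, -⟩
    exact a
  · intro A B x hx hy
    obtain ⟨i, rfl⟩ := exists_vertOf A
    obtain ⟨j, rfl⟩ := exists_vertOf B
    rw [F.eq_of_mem i j x hx hy]
  · intro A B C x hx
    obtain ⟨i, rfl⟩ := exists_vertOf A
    obtain ⟨j, rfl⟩ := exists_vertOf B
    obtain ⟨k, rfl⟩ := exists_vertOf C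
    rw [hE]
    exact F.notMem i j k x hx
  · intro A B C D x
    obtain ⟨i, rfl⟩ := exists_vertOf A
    obtain ⟨j, rfl⟩ := exists_vertOf B
    obtain ⟨k, rfl⟩ := exists_vertOf C
    obtain ⟨l, rfl⟩ := exists_vertOf D
    rw [hE, hE]
    intro hx hy
    exact congrArg (Sym2.map (vertOf H v E)) (F.edge_eq_of_mem i j k l x hx hy)
  · intro x
    rcases F.cover x with ⟨i, hi⟩ | ⟨i, j, hx⟩
    · exact Or.inl ⟨vertOf H v E i, hi⟩
    · exact Or.inr ⟨vertOf H v E i, vertOf H v E j, by rwa [hE]⟩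
  · intro A B a
    obtain ⟨i, rfl⟩ := exists_vertOf A
    obtain ⟨j, rfl⟩ := exists_vertOf B
    rw [hE]
    exact F.edge i j ((hA i j).1 a)
  · intro A B hne ha
    obtain ⟨i, rfl⟩ := exists_vertOf A
    obtain ⟨j, rfl⟩ := exists_vertOf B
    exact F.no_edge i j (fun h' => hne (by rw [h'])) (fun h' => ha ((hA i j).2 h'))

theorem IsFrame.ofFrame_uses (f : V → V) (i j : ι) :
    Uses (PreTorsoid.ofFrame H v E).graph Subtype.val (PreTorsoid.ofFrame H v E).edgeSets f
      (vertOf H v E i) (vertOf H v E j) ↔ Uses H v E f i j := by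
  simp only [Uses, F.ofFrame_adj h, F.ofFrame_edgeSets h]
  rfl

theorem IsFrame.ofFrame_isCycleGraph :
    IsCycleGraph (PreTorsoid.ofFrame H v E).graph ↔ IsCycleGraph H := by
  let e : H ≃g (PreTorsoid.ofFrame H v E).graph :=
    { toEquiv := Equiv.ofBijective (vertOf H v E) ⟨F.vertOf_injective h, exists_vertOf⟩
      map_rel_iff' := F.ofFrame_adj h _ _ }
  exact ⟨fun ⟨n, hn, ⟨φ⟩⟩ => ⟨n, hn, ⟨e.trans φ⟩⟩, fun ⟨n, hn, ⟨φ⟩⟩ => ⟨n, hn, ⟨e.symm.trans φ⟩⟩⟩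

variable (hM : IsMate M m)

include hM

theorem IsFrame.isTorsoid_ofFrame (h4 : 4 ≤ ENat.card ι) {μ : ι → ι} (hμ : Induces H v E m μ)
    (hB : (∀ X, Tight H μ X → (∃ w, X = {w}) ∨ ∃ w, Xᶜ = {w}) ∨ IsCycleGraph H)
    (hI : Irred G m H v E) (hC : IsCycleGraph H → CycleMax G m H v E) :
    IsTorsoid G M (PreTorsoid.ofFrame H v E) := by
  have F' := F.ofFrame_isFrame h
  have hU := F.ofFrame_uses h
  have hE := F.ofFrame_edgeSets h
  have hA := F.ofFrame_adj h
  obtain ⟨μ', hμ'⟩ := F'.exists_induces h h.mem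
  refine isTorsoid_of_isFrame h hM F' ?_ hμ' ?_ ?_ ?_
  · change 4 ≤ (Set.range v).encard
    rwa [← Set.image_univ, (F.injective h).encard_image, Set.encard_univ]
  · rw [F.ofFrame_isCycleGraph h]
    refine hB.imp_left fun hB X hX => ?_
    have hX' : Tight H μ (vertOf H v E ⁻¹' X) := by
      rw [F.tight_iff h hμ]
      rw [F'.tight_iff h hμ'] at hX
      intro f hf g hg
      obtain ⟨g', hg'⟩ := F'.exists_induces h hf
      have hgg : ∀ i, g' (vertOf H v E i) = vertOf H v E (g i) := fun i =>
        (F'.uses_iff hf hg' _ _).1 ((hU f i (g i)).2 (hg i))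
      obtain ⟨A, ⟨hA1, hA2⟩, hA3⟩ := hX f hf g' hg'
      obtain ⟨i, rfl⟩ := exists_vertOf A
      refine ⟨i, ⟨hA1, by rwa [Set.mem_preimage, ← hgg]⟩, fun j hj => F.vertOf_injective h ?_⟩
      exact hA3 _ ⟨hj.1, by rw [hgg]; exact hj.2⟩
    have hsing : ∀ Y, ∀ w, vertOf H v E ⁻¹' Y = {w} → Y = {vertOf H v E w} := by
      intro Y w hw
      ext A
      obtain ⟨i, rfl⟩ := exists_vertOf A
      have : i ∈ vertOf H v E ⁻¹' Y ↔ i ∈ ({w} : Set ι) := by rw [hw]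
      simpa [(F.vertOf_injective h).eq_iff] using this
    rcases hB _ hX' with ⟨w, hw⟩ | ⟨w, hw⟩
    · exact Or.inl ⟨_, hsing _ _ hw⟩
    · exact Or.inr ⟨_, hsing _ _ hw⟩
  · intro A B a
    obtain ⟨i, rfl⟩ := exists_vertOf A
    obtain ⟨j, rfl⟩ := exists_vertOf B
    rw [hE]
    exact hI i j ((hA i j).1 a)
  · rw [F.ofFrame_isCycleGraph h]
    intro hc A B C a b hne
    obtain ⟨i, rfl⟩ := exists_vertOf A
    obtain ⟨j, rfl⟩ := exists_vertOf B
    obtain ⟨k, rfl⟩ := exists_vertOf C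
    rw [hE, hE]
    exact hC hc i j k ((hA i j).1 a) ((hA j k).1 b) fun h' => hne (by rw [h'])

omit F in
/-- A tight set partition without overlap of which the collapse is a brick, a brace or a cycle
cleaves a torsoid. -/
theorem IsFrame.isTorsoid_core {K : SimpleGraph ι} {q : ι → Set V}
    (F : IsFrame G m K q fun _ _ => ∅) (h2 : ∀ i j, ∃ k, K.Adj i k ∧ k ≠ j) (ho : NoOverlap G m q)
    (h4 : 4 ≤ ENat.card ι) {μ : ι → ι} (hμ : Induces K q (fun _ _ => ∅) m μ)
    (hB : (∀ X, Tight K μ X → (∃ w, X = {w}) ∨ ∃ w, Xᶜ = {w}) ∨ IsCycleGraph K) :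
    IsTorsoid G M (PreTorsoid.ofFrame K (core G m q) (coreEdge G m q)) := by
  have F' := F.core_isFrame h h2 ho
  have hI := F.core_irred h h2 ho
  refine F'.isTorsoid_ofFrame h hM h4 (F.core_induces h h2 ho h.mem hμ) hB hI fun hc => ?_
  have hd := (deg2_of_isCycleGraph hc).2
  exact cycleMax_of_noSplit h F' hd hI (F.core_noSplit h h2 ho hd)

end OfFrame

/-! ### Frames met by a tight set -/

section Frames

variable {V κ : Type*} {G : SimpleGraph V} {m : V → V} {H : SimpleGraph κ} {y : κ → Set V}
  {E : κ → κ → Set V} {μ : κ → κ}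

/-- If all degrees are two, two perfect matchings that differ somewhere differ everywhere. -/
theorem Deg2.ne_of_ne (hH : MatchCov H μ) (hd : Deg2 H) {ν : κ → κ} (hν : ν ∈ Mates H μ) {i₀ : κ}
    (h0 : μ i₀ ≠ ν i₀) (i : κ) : μ i ≠ ν i := by
  have hμμ := hH.mem.2.1
  have hνν := hν.2.1
  have hcl := eq_empty_of_closed hH (X := {j | μ j = ν j}) (z := i₀) ?_ h0
  · intro hi
    have : i ∈ {j | μ j = ν j} := hi
    rw [hcl] at this
    exact this
  · intro j hj k hk
    by_contra hk'
    have hj : μ j = ν j := hj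
    have h3 : j = μ k ∨ j = ν k := by
      obtain ⟨l, -, -, h1⟩ := hd.other (hH.mem.1 k)
      rcases h1 j hk.symm with h2 | h2
      · exact Or.inl h2
      · rcases h1 _ (hν.1 k) with h3 | h3
        · exact absurd h3.symm hk'
        · exact Or.inr (h2.trans h3.symm)
    apply hk'
    change μ k = ν k
    rcases h3 with rfl | rfl
    · rw [hμμ] at hj
      have h4 := congrArg ν hj
      rw [hνν] at h4
      exact h4.symm
    · rw [hνν] at hj
      have h4 := congrArg μ hj
      rw [hμμ] at h4
      exact h4.symm

/-- A matching covered graph with all degrees two has two disjoint perfect matchings that cover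
all edges. -/
theorem Deg2.exists_matching (hH : MatchCov H μ) (hd : Deg2 H) :
    ∃ ν ∈ Mates H μ, ∀ i, μ i ≠ ν i ∧ ∀ l, H.Adj i l → l = μ i ∨ l = ν i := by
  obtain ⟨i₀⟩ := hH.conn.nonempty
  obtain ⟨l, hl, a, -⟩ := hd.other (hH.mem.1 i₀)
  obtain ⟨ν, hν, rfl⟩ := hH.cov _ _ a
  refine ⟨ν, hν, fun i => ⟨hd.ne_of_ne hH hν hl.symm i, fun l hl' => ?_⟩⟩
  obtain ⟨k, -, -, h1⟩ := hd.other (hH.mem.1 i)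
  rcases h1 l hl' with h2 | h2
  · exact Or.inl h2
  · rcases h1 _ (hν.1 i) with h3 | h3
    · exact absurd h3.symm (hd.ne_of_ne hH hν hl.symm i)
    · exact Or.inr (h2.trans h3.symm)

variable (h : MatchCov G m) (F : IsFrame G m H y E)

include h F

/-- A tight set that meets all edge sets evenly meets some vertex set oddly. -/
theorem IsFrame.exists_odd {X : Set V} (hX : Tight G m X) (hE : ∀ i j, par h (E i j ∩ X) = 0) :
    ∃ i, par h (y i ∩ X) = 1 := by
  by_contra! hc
  have hv : ∀ i, par h (y i ∩ X) = 0 := fun i => (ZMod2.eq_zero_or_one _).resolve_right (hc i)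
  have hf := h.mem
  obtain ⟨c, hcX, hfc, hcu⟩ := hX.cross hf
  have hue : ∀ i j, par h ((y i ∪ E i j) ∩ X) = 0 := by
    intro i j
    rw [Set.inter_comm, par_inter_union h (Set.disjoint_left.2 (F.notMem i i j)),
      Set.inter_comm, hv, Set.inter_comm, hE, add_zero]
  rcases F.cover c with ⟨i, hi⟩ | ⟨i, j, hij⟩
  · have hfi : m c ∈ y i := by
      by_contra hn
      exact no_edge_of_sdiff h (F.tight i) hX (hv i) hi hcX hn hfc (hf.1 c)
    obtain ⟨z, hz, hfz, hzc⟩ := exists_cross_ne h hf (hv i) (x := c) ⟨hi, hcX⟩ (fun h' => hfc h'.2)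
    have hfzX : m z ∈ X := by_contra fun hn => hzc (hcu z hz.2 hn)
    have hfzi : m z ∉ y i := fun hn => hfz ⟨hn, hfzX⟩
    have ht := sdiff_tight h hX (F.tight i) (by rw [Set.inter_comm]; exact hv i)
    rcases F.nbr_vert h hz.1 (hf.1 z) with h1 | ⟨j, a, h1⟩
    · exact hfzi h1
    · have hzj : z ∉ y j ∪ E j i := by
        rintro (h' | h')
        · exact a.ne (F.eq_of_mem _ _ _ hz.1 h')
        · exact F.notMem _ _ _ _ hz.1 h'
      rw [← F.symm j i] at h1
      refine no_edge_of_sdiff h ht (F.tight_union j i a.symm) ?_ ⟨hfzX, hfzi⟩ h1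
        (fun h' => h'.2 hz.1) hzj (hf.1 z).symm
      rw [show X \ y i ∩ (y j ∪ E j i) = (y j ∪ E j i) ∩ X by
        ext x
        have h1 := F.notMem i j i x
        have h2 : x ∈ y i → x ∉ y j := fun h1 h2 => a.ne (F.eq_of_mem _ _ _ h1 h2)
        simp only [Set.mem_inter_iff, Set.mem_sdiff, Set.mem_union]
        grind, hue]
  · have a := F.adj_of_mem _ _ _ hij
    have hfe : m c ∈ E i j := by
      have h1 : m c ∈ y i ∪ E i j := by
        by_contra hn
        exact no_edge_of_sdiff h (F.tight_union i j a) hX (hue i j) (Or.inr hij) hcX hn hfc (hf.1 c)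
      have h2 : m c ∈ y j ∪ E j i := by
        by_contra hn
        exact no_edge_of_sdiff h (F.tight_union j i a.symm) hX (hue j i)
          (Or.inr (F.symm i j ▸ hij)) hcX hn hfc (hf.1 c)
      rcases h1 with h1 | h1
      · rcases h2 with h2 | h2
        · exact absurd (F.eq_of_mem _ _ _ h1 h2) a.ne
        · rwa [F.symm]
      · exact h1
    obtain ⟨z, hz, hfz, hzc⟩ := exists_cross_ne h hf (hE i j) (x := c) ⟨hij, hcX⟩
      (fun h' => hfc h'.2)
    have hfzX : m z ∈ X := by_contra fun hn => hzc (hcu z hz.2 hn)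
    have hfzE : m z ∉ E i j := fun hn => hfz ⟨hn, hfzX⟩
    have key : ∀ i j, H.Adj i j → z ∈ E i j → m z ∈ y i → False := by
      intro i j a hzE hi
      have ht := sdiff_tight h hX (F.tight_union j i a.symm)
        (by rw [Set.inter_comm]; exact hue j i)
      have hzi : z ∉ y i := fun h' => F.notMem _ _ _ _ h' hzE
      refine no_edge_of_sdiff h ht (F.tight i) ?_ (x := m z) (y := z) ⟨hfzX, ?_⟩ hi
        (fun h' => h'.2 (Or.inr (F.symm i j ▸ hzE))) hzi (hf.1 z).symm
      · rw [show X \ (y j ∪ E j i) ∩ y i = y i ∩ X by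
          ext x
          have h1 := F.notMem i j i x
          have h2 : x ∈ y i → x ∉ y j := fun h1 h2 => a.ne (F.eq_of_mem _ _ _ h1 h2)
          simp only [Set.mem_inter_iff, Set.mem_sdiff, Set.mem_union]
          grind, hv]
      · rintro (h' | h')
        · exact a.ne (F.eq_of_mem _ _ _ hi h')
        · exact F.notMem _ _ _ _ hi h'
    rcases F.nbr_edge h hz.1 (hf.1 z) with h1 | h1 | h1
    · exact key i j a hz.1 h1
    · exact key j i a.symm (F.symm i j ▸ hz.1) h1
    · exact hfzE h1

/-- A tight set that contains some vertex set and misses another meets all edge sets evenly. -/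
theorem IsFrame.par_edge_inter (hS : NoSplit h H y E) {Z : Set V} (hZ : Tight G m Z) {x₀ x₁ : κ}
    (h0 : y x₀ ⊆ Z) (h1 : y x₁ ⊆ Zᶜ) (i j : κ) : par h (E i j ∩ Z) = 0 := by
  refine (ZMod2.eq_zero_or_one _).resolve_right fun hE => ?_
  obtain ⟨e, he, -⟩ := exists_cross h h.mem hE
  have a := F.adj_of_mem _ _ _ he.1
  have key : ∀ Z, Tight G m Z → ∀ x₀, y x₀ ⊆ Z → par h (E i j ∩ Z) = 1 → par h (y i ∩ Z) = 0 →
      par h (y j ∩ Z) = 0 → False := by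
    intro Z hZ x₀ h0 hE hi hj
    obtain ⟨x, hx⟩ := (F.tight x₀).nonempty h
    have hx0 : par h (y x₀ ∩ Z) = 1 := by rw [Set.inter_eq_left.2 h0, (F.tight x₀).par h]
    rcases F.subset_of_odd h a hZ hi hj hE (h0 hx) with (h' | h') | h'
    · rw [F.eq_of_mem _ _ _ hx h', hi] at hx0; exact absurd hx0 (by decide)
    · rw [F.eq_of_mem _ _ _ hx h', hj] at hx0; exact absurd hx0 (by decide)
    · exact F.notMem _ _ _ _ hx h'
  rcases ZMod2.eq_zero_or_one (par h (y i ∩ Z)) with hi | hi <;>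
    rcases ZMod2.eq_zero_or_one (par h (y j ∩ Z)) with hj | hj
  · exact key Z hZ x₀ h0 hE hi hj
  · exact hS j i a.symm Z hZ (by rwa [F.symm]) hj hi
  · exact hS i j a Z hZ hE hi hj
  · refine key Zᶜ hZ.compl x₁ h1 ?_ ?_ ?_ <;> rw [par_compl_inter]
    · rw [F.par_edge h, hE]; decide
    · rw [(F.tight i).par h, hi]; decide
    · rw [(F.tight j).par h, hj]; decide

/-- The vertices of the frame met oddly by a tight set form a tight set of the frame. -/
theorem IsFrame.odd_tight (hμ : Induces H y E m μ) {Z : Set V} (hZ : Tight G m Z)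
    (hE : ∀ i j, par h (E i j ∩ Z) = 0) {x₀ x₁ : κ} (h0 : par h (y x₀ ∩ Z) = 1)
    (h1 : par h (y x₁ ∩ Z) = 0) : Tight H μ {i | par h (y i ∩ Z) = 1} := by
  have hx1 : x₁ ∉ {i | par h (y i ∩ Z) = 1} := fun h' => by
    rw [Set.mem_ofPred_eq, h1] at h'; exact absurd h' (by decide)
  refine tight_of_le_one (F.matchCov h hμ) ⟨x₀, h0⟩ hx1 ?_
  intro g hg i hi hgi j hj hgj
  obtain ⟨f, hf, hfg⟩ := F.exists_lift h hμ hg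
  have hbad : ∀ i, par h (y i ∩ Z) = 1 → ¬ par h (y (g i) ∩ Z) = 1 → Bad h H y E f Z i (g i) := by
    intro i hi hgi
    have a := (hfg i).1
    refine Or.inr ⟨hfg i, ?_⟩
    have hdij : Disjoint (y i) (y (g i)) :=
      F.disjoint_vert a.ne
    have := (ZMod2.eq_zero_or_one _).resolve_right hgi
    rw [Set.inter_comm, par_inter_union h (Set.disjoint_union_left.2
      ⟨Set.disjoint_left.2 (F.notMem i i _), Set.disjoint_left.2 (F.notMem _ i _)⟩),
      par_inter_union h hdij, Set.inter_comm Z, Set.inter_comm Z, Set.inter_comm Z, hE, hi, this]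
    decide
  rcases Sym2.eq_iff.1 (F.bad_unique h hf hZ (hbad i hi hgi) (hbad j hj hgj)) with ⟨h2, -⟩ | ⟨h2, -⟩
  · exact h2
  · rw [h2] at hi; exact absurd hi hgj

/-- In a cycle, a tight set that contains some vertex set and misses another contains all
vertex sets that it meets oddly. -/
theorem IsFrame.subset_of_odd_vert (hd : Deg2 H) (hI : Irred G m H y E) (hS : NoSplit h H y E)
    {Z : Set V} (hZ : Tight G m Z) {x₀ x₁ : κ} (h0 : y x₀ ⊆ Z) (h1 : y x₁ ⊆ Zᶜ) {a : κ}
    (ha : par h (y a ∩ Z) = 1) : y a ⊆ Z := by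
  by_cases hax : a = x₀
  · rw [hax]; exact h0
  have hE := F.par_edge_inter h hS hZ h0 h1
  obtain ⟨μ, hμ⟩ := F.exists_induces h h.mem
  have hH := F.matchCov h hμ
  have h0' : par h (y x₀ ∩ Z) = 1 := by rw [Set.inter_eq_left.2 h0, (F.tight x₀).par h]
  have h1' : par h (y x₁ ∩ Z) = 0 := by
    rw [(Set.subset_compl_iff_disjoint_right.1 h1).inter_eq, par_empty]
  have hO := F.odd_tight h hμ hZ hE h0' h1'
  set O := {i | par h (y i ∩ Z) = 1}
  have hx1 : x₁ ∉ O := fun h' => by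
    rw [Set.mem_ofPred_eq, h1'] at h'; exact absurd h' (by decide)
  -- otherwise every matching of the cycle leaves the set of odd vertices at `a`
  obtain ⟨b, hb, hbO⟩ : ∃ b, H.Adj a b ∧ b ∈ O := by
    by_contra! hc
    have hcl := eq_empty_of_closed hH (X := O \ {a}) (z := x₁) ?_ (fun h' => hx1 h'.1)
    · have : x₀ ∈ O \ {a} := ⟨h0', fun h' => hax h'.symm⟩
      rw [hcl] at this
      exact this
    · intro i hi j hij
      obtain ⟨g, hg, rfl⟩ := hH.cov i j hij
      refine ⟨by_contra fun hn => hi.2 ?_, fun h' => hc i ?_ hi.1⟩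
      · exact hO.unique hg hi.1 hn ha (hc _ (hg.1 a))
      · rw [Set.mem_singleton_iff] at h'
        rw [← h']; exact hij.symm
  obtain ⟨c, -, hc, hnb⟩ := hd.other hb
  have h3 := inter_vert_eq_empty h F hI hb hc hnb hZ.compl
    (by rw [par_compl_inter, (F.tight a).par h, ha]; decide)
    (by rw [par_compl_inter, (F.tight b).par h, hbO]; decide)
    (by rw [par_compl_inter, F.par_edge h, hE]; decide)
  intro x hx
  by_contra hn
  exact Set.eq_empty_iff_forall_notMem.1 h3 x ⟨hx, hn⟩

end Frames

/-! ### Cleaved frames: one vertex for each member of the partition -/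

section Cleaving

variable {V ι κ : Type*} {G : SimpleGraph V} {m : V → V} {K : SimpleGraph ι} {q : ι → Set V}
  {H : SimpleGraph κ} {y : κ → Set V} {E : κ → κ → Set V} {x : ι → κ} {μ : κ → κ}

variable (h : MatchCov G m) (F : IsFrame G m K q fun _ _ => ∅) (F' : IsFrame G m H y E)
  (hx : ∀ i, y (x i) ⊆ q i)

include h F F' hx

omit h F' in
theorem IsFrame.subset_compl_part {i j : ι} (hij : j ≠ i) : y (x j) ⊆ (q i)ᶜ :=
  fun _ hz hz' => hij (F.eq_of_mem _ _ _ (hx j hz) hz')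

omit F in
theorem IsFrame.par_vert_part (i : ι) : par h (y (x i) ∩ q i) = 1 := by
  rw [Set.inter_eq_left.2 (hx i), (F'.tight _).par h]

variable (h4 : ∀ a b c : ι, ∃ d, d ≠ a ∧ d ≠ b ∧ d ≠ c) (hS : NoSplit h H y E)

include h4 hS

/-- A member of the partition meets all edge sets evenly. -/
theorem IsFrame.par_edge_part (i : ι) (a b : κ) : par h (E a b ∩ q i) = 0 := by
  obtain ⟨j, hj, -⟩ := h4 i i i
  exact F'.par_edge_inter h hS (F.tight i) (hx i) (F.subset_compl_part hx hj) a b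

/-- The vertices met oddly by a member of the partition form a tight set of the cleaved frame. -/
theorem IsFrame.odd_part_tight (hμ : Induces H y E m μ) (i : ι) :
    Tight H μ {a | par h (y a ∩ q i) = 1} := by
  obtain ⟨j, hj, -⟩ := h4 i i i
  refine F'.odd_tight h hμ (F.tight i) (F.par_edge_part h F' hx h4 hS i)
    (F'.par_vert_part h hx i) (x₁ := x j) ?_
  rw [(Set.subset_compl_iff_disjoint_right.1 (F.subset_compl_part hx hj)).inter_eq, par_empty]

/-- If a brick or brace is cleaved, every member of the partition meets only one vertex set
oddly. -/
theorem IsFrame.eq_of_par_eq_one_of_brickOrBrace (hμ : Induces H y E m μ)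
    (hB : ∀ X, Tight H μ X → (∃ w, X = {w}) ∨ ∃ w, Xᶜ = {w}) {i : ι} {a : κ}
    (ha : par h (y a ∩ q i) = 1) : a = x i := by
  have hO := F.odd_part_tight h F' hx h4 hS hμ i
  have hxO : x i ∈ {a | par h (y a ∩ q i) = 1} := F'.par_vert_part h hx i
  have ha : a ∈ {a | par h (y a ∩ q i) = 1} := ha
  rcases hB _ hO with ⟨w, hw⟩ | ⟨w, hw⟩
  · rw [hw] at ha hxO
    exact ha.trans hxO.symm
  · exfalso
    have key : ∀ j, j ≠ i → x j = w := by
      intro j hj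
      have : x j ∈ {a | par h (y a ∩ q i) = 1}ᶜ := by
        rw [Set.mem_compl_iff, Set.mem_ofPred_eq,
          (Set.subset_compl_iff_disjoint_right.1 (F.subset_compl_part hx hj)).inter_eq, par_empty]
        decide
      rwa [hw] at this
    obtain ⟨j, hj, -⟩ := h4 i i i
    obtain ⟨k, hk, hkj, -⟩ := h4 i j j
    obtain ⟨z, hz⟩ := (F'.tight (x j)).nonempty h
    have hz' : z ∈ y (x k) := by rwa [key k hk, ← key j hj]
    exact hkj (F.eq_of_mem _ _ _ (hx k hz') (hx j hz))

/-- If a cycle is cleaved and there is no overlap, every member of the partition meets only one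
vertex set oddly. Otherwise the odd vertex sets of a member form a longer segment of the cycle; all
but one end of it could be moved across the other end, and vice versa. -/
theorem IsFrame.eq_of_par_eq_one_of_deg2 (h2 : ∀ i j, ∃ k, K.Adj i k ∧ k ≠ j)
    (ho : NoOverlap G m q) (hd : Deg2 H) (hI : Irred G m H y E) {i : ι} {a₀ : κ}
    (ha₀ : par h (y a₀ ∩ q i) = 1) : a₀ = x i := by
  by_contra hne
  obtain ⟨μ, hμ⟩ := F'.exists_induces h h.mem
  have hH := F'.matchCov h hμ
  have hO := F.odd_part_tight h F' hx h4 hS hμ i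
  have hE := F.par_edge_part h F' hx h4 hS
  have hxO : x i ∈ {a | par h (y a ∩ q i) = 1} := F'.par_vert_part h hx i
  have hx0 := hx i
  obtain ⟨j, hj, -⟩ := h4 i i i
  have hx1 := F.subset_compl_part hx hj
  have hsub : ∀ k a, par h (y a ∩ q k) = 1 → y a ⊆ q k := by
    intro k a ha
    obtain ⟨l, hl, -⟩ := h4 k k k
    exact F'.subset_of_odd_vert h hd hI hS (F.tight k) (hx k) (F.subset_compl_part hx hl) ha
  have hin : ∀ a ∈ {a | par h (y a ∩ q i) = 1}, y a ⊆ q i := fun a ha => hsub i a ha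
  have hout : ∀ a ∉ {a | par h (y a ∩ q i) = 1}, Disjoint (y a) (q i) := by
    intro a ha
    rw [← Set.subset_compl_iff_disjoint_right]
    refine F'.subset_of_odd_vert h hd hI hS (F.tight i).compl hx1 (by rwa [compl_compl]) ?_
    rw [par_compl_inter, (F'.tight a).par h, (ZMod2.eq_zero_or_one _).resolve_right ha]
    decide
  have hxj : x j ∉ {a | par h (y a ∩ q i) = 1} := by
    rw [Set.mem_ofPred_eq, (Set.subset_compl_iff_disjoint_right.1 hx1).inter_eq, par_empty]
    decide
  set O := {a | par h (y a ∩ q i) = 1} with hOdef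
  have hEin : ∀ a b, a ∈ O → b ∈ O → E a b ⊆ q i := by
    intro a b ha hb z hz
    by_contra hn
    refine Set.eq_empty_iff_forall_notMem.1 (F'.inter_edge_eq_empty h (F'.adj_of_mem _ _ _ hz)
      (F.tight i).compl ?_ ?_ ?_) z ⟨hz, hn⟩
    · exact Set.disjoint_left.2 fun z hz h' => h' (hin a ha hz)
    · exact Set.disjoint_left.2 fun z hz h' => h' (hin b hb hz)
    · rw [par_compl_inter, F'.par_edge h, hE]; decide
  have hEout : ∀ a b, a ∉ O → b ∉ O → ∀ z ∈ E a b, z ∉ q i := by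
    intro a b ha hb z hz hn
    exact Set.eq_empty_iff_forall_notMem.1 (F'.inter_edge_eq_empty h (F'.adj_of_mem _ _ _ hz)
      (F.tight i) (hout a ha) (hout b hb) (hE i a b)) z ⟨hz, hn⟩
  -- the two edges of the cycle that leave the segment
  obtain ⟨ν, hν, hμν⟩ := hd.exists_matching hH
  obtain ⟨a, haO, haO', hau⟩ := hO.cross hH.mem
  obtain ⟨d, hdO, hdO', hdu⟩ := hO.cross hν
  have hleave : ∀ o ∈ O, ∀ o' ∉ O, H.Adj o o' → (o = a ∧ o' = μ a) ∨ (o = d ∧ o' = ν d) := by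
    intro o ho o' ho' hoo
    rcases (hμν o).2 o' hoo with rfl | rfl
    · obtain rfl := hau o ho ho'
      exact Or.inl ⟨rfl, rfl⟩
    · obtain rfl := hdu o ho ho'
      exact Or.inr ⟨rfl, rfl⟩
  have had : a ≠ d := by
    rintro rfl
    have hcl := eq_empty_of_closed hH (X := O \ {a}) (z := x j) ?_ (fun h' => hxj h'.1)
    · have h5 : ∀ b ∈ O, b = a := by
        intro b hb
        by_contra hn
        have : b ∈ O \ {a} := ⟨hb, hn⟩
        rw [hcl] at this
        exact this
      exact hne ((h5 a₀ ha₀).trans (h5 (x i) hxO).symm)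
    · intro o ho o' hoo
      refine ⟨by_contra fun hn => ho.2 ?_, fun h' => ?_⟩
      · rcases hleave o ho.1 o' hn hoo with h' | h' <;> exact h'.1
      · rw [Set.mem_singleton_iff] at h'
        subst h'
        rcases (hμν o').2 o hoo.symm with rfl | rfl
        · exact haO' ho.1
        · exact hdO' ho.1
  have hblock : ∀ b ∉ O, ∃ k, k ≠ i ∧ y b ⊆ q k := by
    intro b hb
    obtain ⟨k, hk⟩ := F.exists_odd h (F'.tight b) (fun i j => by
      rw [Set.empty_inter, par_empty])
    rw [Set.inter_comm] at hk
    refine ⟨k, ?_, hsub k b hk⟩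
    rintro rfl
    exact hb hk
  obtain ⟨ia, hia, hyia⟩ := hblock _ haO'
  obtain ⟨id, hid, hyid⟩ := hblock _ hdO'
  have hEq : ∀ o o' k, o ∈ O → k ≠ i → y o' ⊆ q k → E o o' ⊆ q i ∪ q k := by
    intro o o' k ho hk ho' z hz
    obtain ⟨l, hl⟩ := F.exists_mem_part z
    by_cases hli : l = i
    · exact Or.inl (hli ▸ hl)
    by_cases hlk : l = k
    · exact Or.inr (hlk ▸ hl)
    · exfalso
      refine Set.eq_empty_iff_forall_notMem.1 (F'.inter_edge_eq_empty h (F'.adj_of_mem _ _ _ hz)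
        (F.tight l) ?_ ?_ (hE l o o')) z ⟨hz, hl⟩
      · exact Set.disjoint_left.2 fun z hz h' => hli (F.eq_of_mem _ _ _ h' (hin o ho hz))
      · exact Set.disjoint_left.2 fun z hz h' => hlk (F.eq_of_mem _ _ _ h' (ho' hz))
  -- everything but the end `d` of the segment can be moved across the other end
  have key : ∀ a a' d d' k, a ∈ O → d ∈ O → d' ∉ O → k ≠ i → y a' ⊆ q k → a ≠ d → a' ∉ O →
      (∀ o ∈ O, ∀ o' ∉ O, H.Adj o o' → (o = a ∧ o' = a') ∨ (o = d ∧ o' = d')) → H.Adj d d' →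
      Movable G m (q i) (q k) (q i \ (y d ∪ E d d')) := by
    intro a a' d d' k ha hdO hd' hk hak had ha' hleave hdd
    refine ⟨Set.sdiff_subset, ?_, ?_⟩
    · rw [Set.sdiff_sdiff_right_self]
      refine inter_tight h (F.tight i) (F'.tight_union d d' hdd) ?_
      rw [par_inter_union h (Set.disjoint_left.2 (F'.notMem d d d')), Set.inter_comm,
        Set.inter_comm (q i), hE, add_zero]
      exact hdO
    · rintro z ⟨hz, hzT⟩ w hzw
      have hvert : ∀ o ∈ O, z ∈ y o → w ∈ q i ∪ q k := by
        intro o ho' hzo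
        rcases F'.nbr_vert h hzo hzw with h5 | ⟨o', hoo, h5⟩
        · exact Or.inl (hin o ho' h5)
        · by_cases ho'' : o' ∈ O
          · rcases h5 with h5 | h5
            · exact Or.inl (hin o' ho'' h5)
            · exact Or.inl (hEin o o' ho' ho'' h5)
          · rcases hleave o ho' o' ho'' hoo with ⟨rfl, rfl⟩ | ⟨rfl, rfl⟩
            · rcases h5 with h5 | h5
              · exact Or.inr (hak h5)
              · exact hEq _ _ k ho' hk hak h5
            · exact absurd (Or.inl hzo) hzT
      have hedge : ∀ o o', o ∈ O → z ∈ E o o' → w ∈ q i ∪ q k := by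
        intro o o' ho' hzo
        have hoo := F'.adj_of_mem _ _ _ hzo
        have h5 := F'.nbr_edge h hzo hzw
        by_cases ho'' : o' ∈ O
        · rcases h5 with h5 | h5 | h5
          · exact Or.inl (hin o ho' h5)
          · exact Or.inl (hin o' ho'' h5)
          · exact Or.inl (hEin o o' ho' ho'' h5)
        · rcases hleave o ho' o' ho'' hoo with ⟨rfl, rfl⟩ | ⟨rfl, rfl⟩
          · rcases h5 with h5 | h5 | h5
            · exact Or.inl (hin _ ho' h5)
            · exact Or.inr (hak h5)
            · exact hEq _ _ k ho' hk hak h5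
          · exact absurd (Or.inr hzo) hzT
      rcases F'.cover z with ⟨o, ho'⟩ | ⟨o, o', ho'⟩
      · by_cases hoO : o ∈ O
        · exact hvert o hoO ho'
        · exact absurd hz (Set.disjoint_left.1 (hout o hoO) ho')
      · by_cases hoO : o ∈ O
        · exact hedge o o' hoO ho'
        · by_cases hoO' : o' ∈ O
          · exact hedge o' o hoO' (F'.symm o o' ▸ ho')
          · exact absurd hz (hEout o o' hoO hoO' z ho')
  have ka := key a (μ a) d (ν d) ia haO hdO hdO' hia hyia had haO' hleave (hν.1 d)
  have kd := key d (ν d) a (μ a) id hdO haO haO' hid hyid had.symm hdO'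
    (fun o ho o' ho' hoo => (hleave o ho o' ho' hoo).symm) (hH.mem.1 a)
  have hdis : Disjoint (y d ∪ E d (ν d)) (y a ∪ E a (μ a)) := by
    refine Set.disjoint_left.2 fun z hz hz' => ?_
    rcases hz with hz | hz <;> rcases hz' with hz' | hz'
    · exact had (F'.eq_of_mem _ _ _ hz' hz)
    · exact F'.notMem _ _ _ _ hz hz'
    · exact F'.notMem _ _ _ _ hz' hz
    · rcases Sym2.eq_iff.1 (F'.edge_eq_of_mem _ _ _ _ _ hz hz') with ⟨h5, -⟩ | ⟨h5, -⟩
      · exact had h5.symm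
      · rw [← h5] at haO'; exact haO' hdO
  have hne' : ia ≠ id := by
    rintro rfl
    obtain ⟨k, hk, hki⟩ := h2 i ia
    obtain ⟨u, hu, w, hw, huw⟩ := F.edge i k hk
    have hu : u ∈ q i := by simpa using hu
    have : w ∈ q i ∪ q ia := by
      by_cases hT : u ∈ y d ∪ E d (ν d)
      · exact kd.2.2 u ⟨hu, Set.disjoint_left.1 hdis hT⟩ w huw
      · exact ka.2.2 u ⟨hu, hT⟩ w huw
    rcases this with h5 | h5
    · exact hk.ne (F.eq_of_mem _ _ _ h5 hw)
    · exact hki (F.eq_of_mem _ _ _ hw h5)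
  have hcov : q i ⊆ (y d ∪ E d (ν d)) ∪ (y a ∪ E a (μ a)) := by
    intro z hz
    by_contra hn
    exact Set.disjoint_left.1 (ho i ia id hne')
      (ka.subset_mov ⟨hz, fun h' => hn (Or.inl h')⟩) (kd.subset_mov ⟨hz, fun h' => hn (Or.inr h')⟩)
  have hp : par h (q i) = 0 := by
    rw [← Set.inter_eq_left.2 hcov, par_inter_union h hdis,
      par_inter_union h (Set.disjoint_left.2 (F'.notMem d d _)),
      par_inter_union h (Set.disjoint_left.2 (F'.notMem a a _)), Set.inter_comm,
      Set.inter_comm (q i),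
      Set.inter_comm (q i), Set.inter_comm (q i), hE, hE, show par h (y d ∩ q i) = 1 from hdO,
      show par h (y a ∩ q i) = 1 from haO]
    decide
  rw [(F.tight i).par h] at hp
  exact absurd hp (by decide)

end Cleaving

/-! ### The cleaved torsoid is determined by the partition -/

section Determined

variable {V ι κ : Type*} {G : SimpleGraph V} {m : V → V} {K : SimpleGraph ι} {q : ι → Set V}
  {H : SimpleGraph κ} {y : κ → Set V} {E : κ → κ → Set V} {x : ι → κ}

variable (h : MatchCov G m) (F : IsFrame G m K q fun _ _ => ∅) (F' : IsFrame G m H y E)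
  (hx : ∀ i, y (x i) ⊆ q i) (hE : ∀ i a b, par h (E a b ∩ q i) = 0)
  (hu : ∀ i a, par h (y a ∩ q i) = 1 → a = x i)

include h F F' hx hE hu

omit hx hE in
/-- The correspondence between the partition and the vertices of the cleaved frame is bijective. -/
theorem IsFrame.exists_eq_of_cleaves (a : κ) : ∃ i, x i = a := by
  obtain ⟨i, hi⟩ := F.exists_odd h (F'.tight a) (fun i j => by rw [Set.empty_inter, par_empty])
  rw [Set.inter_comm] at hi
  exact ⟨i, (hu i a hi).symm⟩

omit h F' hE hu in
theorem IsFrame.eq_of_mem_vert {i j : ι} {z : V} (hz : z ∈ q i) (hzj : z ∈ y (x j)) : j = i :=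
  F.eq_of_mem _ _ _ (hx j hzj) hz

omit hu in
theorem IsFrame.edge_subset_of_cleaves (i j : ι) : E (x i) (x j) ⊆ q i ∪ q j := by
  intro z hz
  obtain ⟨k, hk⟩ := F.exists_mem_part z
  by_cases hki : k = i
  · exact Or.inl (hki ▸ hk)
  by_cases hkj : k = j
  · exact Or.inr (hkj ▸ hk)
  exfalso
  refine Set.eq_empty_iff_forall_notMem.1 (F'.inter_edge_eq_empty h (F'.adj_of_mem _ _ _ hz)
    (F.tight k) ?_ ?_ (hE k _ _)) z ⟨hz, hk⟩
  · exact Set.disjoint_left.2 fun z hz h' => hki (F.eq_of_mem _ _ _ h' (hx i hz))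
  · exact Set.disjoint_left.2 fun z hz h' => hkj (F.eq_of_mem _ _ _ h' (hx j hz))

omit hu in
theorem IsFrame.uses_of_uses_cleaved {f : V → V} (hf : f ∈ Mates G m) {i j : ι}
    (hux : Uses H y E f (x i) (x j)) : Uses K q (fun _ _ => ∅) f i j := by
  have a := hux.1
  have hij : i ≠ j := by rintro rfl; exact a.ne rfl
  have hdij : Disjoint (y (x i)) (y (x j)) :=
    Set.disjoint_left.2 fun z hz h' => a.ne (F'.eq_of_mem _ _ _ hz h')
  have hp : par h ((y (x i) ∪ y (x j) ∪ E (x i) (x j)) ∩ q i) = 1 := by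
    rw [Set.inter_comm, par_inter_union h (Set.disjoint_union_left.2
      ⟨Set.disjoint_left.2 (F'.notMem _ _ _), Set.disjoint_left.2 (F'.notMem _ _ _)⟩),
      par_inter_union h hdij, Set.inter_comm, Set.inter_comm (q i), Set.inter_comm (q i),
      hE, F'.par_vert_part h hx,
      (Set.subset_compl_iff_disjoint_right.1 (F.subset_compl_part hx hij.symm)).inter_eq, par_empty]
    decide
  obtain ⟨c, hc, hfc⟩ := exists_cross h hf hp
  have hfB := F'.uses_closed h hf hux c hc.1
  have hfi : f c ∉ q i := fun h' => hfc ⟨hfB, h'⟩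
  have hfj : f c ∈ q j := by
    rcases hfB with (h5 | h5) | h5
    · exact absurd (hx i h5) hfi
    · exact hx j h5
    · exact (F.edge_subset_of_cleaves h F' hx hE i j h5).resolve_left hfi
  exact ⟨F.adj_of_edge hij hc.2 hfj (hf.1 c), c, hc.2, Or.inl hfj⟩

/-- The cleaved frame has the graph of the partition. -/
theorem IsFrame.adj_iff_of_cleaves (i j : ι) : H.Adj (x i) (x j) ↔ K.Adj i j := by
  constructor
  · intro a
    obtain ⟨f, hf, hux⟩ := F'.exists_uses_of_adj h a
    exact (F.uses_of_uses_cleaved h F' hx hE hf hux).1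
  · intro a
    obtain ⟨f, hf, huk⟩ := F.exists_uses_of_adj h a
    obtain ⟨b, hb⟩ := F'.exists_uses h hf (x i)
    obtain ⟨l, rfl⟩ := F.exists_eq_of_cleaves h F' hu b
    rw [F.uses_unique hf huk (F.uses_of_uses_cleaved h F' hx hE hf hb)]
    exact hb.1

theorem IsFrame.mem_part_iff_of_cleaves {i : ι} {z : V} :
    z ∈ q i ↔ z ∈ y (x i) ∨ ∃ j, z ∈ E (x i) (x j) ∧ z ∈ q i := by
  constructor
  · intro hz
    rcases F'.cover z with ⟨a, ha⟩ | ⟨a, b, hab⟩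
    · obtain ⟨k, rfl⟩ := F.exists_eq_of_cleaves h F' hu a
      obtain rfl := F.eq_of_mem_vert hx hz ha
      exact Or.inl ha
    · obtain ⟨k, rfl⟩ := F.exists_eq_of_cleaves h F' hu a
      obtain ⟨l, rfl⟩ := F.exists_eq_of_cleaves h F' hu b
      rcases F.edge_subset_of_cleaves h F' hx hE k l hab with h5 | h5
      · obtain rfl := F.eq_of_mem _ _ _ h5 hz
        exact Or.inr ⟨l, hab, hz⟩
      · obtain rfl := F.eq_of_mem _ _ _ h5 hz
        exact Or.inr ⟨k, F'.symm _ _ ▸ hab, hz⟩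
  · rintro (h5 | ⟨j, -, h5⟩)
    · exact hx i h5
    · exact h5

omit hu in
/-- The part of an edge set in `q i` is movable to the other end. -/
theorem IsFrame.edge_inter_subset_mov (i j : ι) :
    E (x i) (x j) ∩ q i ⊆ mov G m (q i) (q j) := by
  by_cases hij : H.Adj (x i) (x j)
  swap
  · rintro z ⟨hz, -⟩
    exact absurd (F'.adj_of_mem _ _ _ hz) hij
  refine Movable.subset_mov ⟨Set.inter_subset_right, ?_, ?_⟩
  · have hne : j ≠ i := by rintro rfl; exact hij.ne rfl
    have ht := sdiff_tight h (F.tight i) (F'.tight_union _ _ hij.symm) (by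
      rw [par_inter_union h (Set.disjoint_left.2 (F'.notMem _ _ _)), Set.inter_comm,
        Set.inter_comm (q i), hE,
        (Set.subset_compl_iff_disjoint_right.1 (F.subset_compl_part hx hne)).inter_eq, par_empty,
        add_zero])
    rw [show q i \ (E (x i) (x j) ∩ q i) = q i \ (y (x j) ∪ E (x j) (x i)) by
      ext z
      have := fun h1 h2 => hne (F.eq_of_mem_vert hx (i := i) (j := j) (z := z) h1 h2)
      rw [F'.symm (x j)]
      simp only [Set.mem_inter_iff, Set.mem_sdiff, Set.mem_union]
      grind]
    exact ht
  · rintro z ⟨hz, hzi⟩ w hzw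
    rcases F'.nbr_edge h hz hzw with h5 | h5 | h5
    · exact Or.inl (hx i h5)
    · exact Or.inr (hx j h5)
    · exact F.edge_subset_of_cleaves h F' hx hE i j h5

variable (h2 : ∀ i j, ∃ k, K.Adj i k ∧ k ≠ j) (ho : NoOverlap G m q) (hI : Irred G m H y E)

include h2 ho hI

/-- The vertex sets of the cleaved frame contain nothing that can be moved. -/
theorem IsFrame.mov_inter_vert (i j : ι) : mov G m (q i) (q j) ∩ y (x i) = ∅ := by
  by_cases a : K.Adj i j
  swap
  · exact Set.eq_empty_of_forall_notMem fun z hz => a (F.adj_of_mem_mov h hz.1)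
  have a' := (F.adj_iff_of_cleaves h F' hx hE hu i j).2 a
  have hm := F.movable_mov h h2 i j
  have hmov : mov G m (q i) (q j) =
      (mov G m (q i) (q j) ∩ y (x i)) ∪ (E (x i) (x j) ∩ q i) := by
    ext z
    constructor
    · intro hz
      rcases (F.mem_part_iff_of_cleaves h F' hx hE hu).1 (mov_subset hz) with h5 | ⟨k, h5, h6⟩
      · exact Or.inl ⟨hz, h5⟩
      · right
        have h7 := F.edge_inter_subset_mov h F' hx hE i k ⟨h5, h6⟩
        by_cases hjk : j = k
        · subst hjk; exact ⟨h5, h6⟩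
        · exact absurd h7 (Set.disjoint_left.1 (ho i j k hjk) hz)
    · rintro (hz | hz)
      · exact hz.1
      · exact F.edge_inter_subset_mov h F' hx hE i j hz
  have hdis : Disjoint (y (x i)) (E (x i) (x j)) := Set.disjoint_left.2 (F'.notMem _ _ _)
  have hp : par h (y (x i) ∩ mov G m (q i) (q j)) = 0 := by
    have h5 := hm.par h (F.tight i)
    rw [hmov, par_union h (hdis.mono Set.inter_subset_right Set.inter_subset_left), hE,
      add_zero] at h5
    rwa [Set.inter_comm]
  refine hI (x i) (x j) a' _ Set.inter_subset_right ?_ ?_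
  · rw [show y (x i) \ (mov G m (q i) (q j) ∩ y (x i)) = y (x i) ∩ (q i \ mov G m (q i) (q j)) by
      ext z
      have := @hx i z
      simp only [Set.mem_inter_iff, Set.mem_sdiff]
      grind]
    refine inter_tight h (F'.tight _) hm.2.1 ?_
    rw [show y (x i) ∩ (q i \ mov G m (q i) (q j)) = y (x i) \ mov G m (q i) (q j) by
      ext z
      have := @hx i z
      simp only [Set.mem_inter_iff, Set.mem_sdiff]
      grind]
    have := par_split h (y (x i)) (mov G m (q i) (q j))
    rw [(F'.tight _).par h, hp, zero_add] at this
    exact this.symm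
  · rintro z ⟨hz, hzi⟩ w hzw
    have hw := mov_nbr hz hzw
    rcases F'.nbr_vert h hzi hzw with h5 | ⟨b, hb, h5⟩
    · exact Or.inl h5
    · obtain ⟨k, rfl⟩ := F.exists_eq_of_cleaves h F' hu b
      by_cases hkj : k = j
      · subst hkj; exact Or.inr h5
      exfalso
      have hki : k ≠ i := by rintro rfl; exact hb.ne rfl
      have hwk : w ∉ q k := fun h' => hw.elim (fun h6 => hki (F.eq_of_mem _ _ _ h' h6))
        (fun h6 => hkj (F.eq_of_mem _ _ _ h' h6))
      rcases h5 with h5 | h5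
      · exact hwk (hx k h5)
      · have hwi := (F.edge_subset_of_cleaves h F' hx hE i k h5).resolve_right hwk
        exact F.no_edge_mov h h2 ho (Ne.symm hkj) hz
          (F.edge_inter_subset_mov h F' hx hE i k ⟨h5, hwi⟩) hzw

/-- The vertex sets of the cleaved frame are the cores. -/
theorem IsFrame.vert_eq_core (i : ι) : y (x i) = core G m q i := by
  ext z
  constructor
  · refine fun hz => ⟨hx i hz, fun h' => ?_⟩
    obtain ⟨j, hj⟩ := Set.mem_iUnion.1 h'
    exact Set.eq_empty_iff_forall_notMem.1 (F.mov_inter_vert h F' hx hE hu h2 ho hI i j) z ⟨hj, hz⟩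
  · intro hz
    rcases (F.mem_part_iff_of_cleaves h F' hx hE hu).1 hz.1 with h5 | ⟨k, h5, h6⟩
    · exact h5
    · exact absurd (Set.mem_iUnion.2 ⟨k, F.edge_inter_subset_mov h F' hx hE i k ⟨h5, h6⟩⟩) hz.2

/-- The edge sets of the cleaved frame consist of what can be moved. -/
theorem IsFrame.edge_eq_coreEdge (i j : ι) : E (x i) (x j) = coreEdge G m q i j := by
  have key : ∀ i j z, z ∈ mov G m (q i) (q j) → z ∈ E (x i) (x j) := by
    intro i j z hz
    rcases (F.mem_part_iff_of_cleaves h F' hx hE hu).1 (mov_subset hz) with h5 | ⟨k, h5, h6⟩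
    · exact absurd ⟨hz, h5⟩ (Set.eq_empty_iff_forall_notMem.1
        (F.mov_inter_vert h F' hx hE hu h2 ho hI i j) z)
    · have h7 := F.edge_inter_subset_mov h F' hx hE i k ⟨h5, h6⟩
      by_cases hjk : j = k
      · subst hjk; exact h5
      · exact absurd h7 (Set.disjoint_left.1 (ho i j k hjk) hz)
  ext z
  constructor
  · intro hz
    rcases F.edge_subset_of_cleaves h F' hx hE i j hz with h5 | h5
    · exact Or.inl (F.edge_inter_subset_mov h F' hx hE i j ⟨hz, h5⟩)
    · exact Or.inr (F.edge_inter_subset_mov h F' hx hE j i ⟨F'.symm _ _ ▸ hz, h5⟩)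
  · rintro (hz | hz)
    · exact key i j z hz
    · rw [F'.symm]; exact key j i z hz

end Determined

section Unique

variable {V ι : Type*} {G : SimpleGraph V} {m : V → V} {M : G.Subgraph} {K : SimpleGraph ι}
  {q : ι → Set V}

theorem exists_ne_three_of_four_le {α : Type*} (h4 : 4 ≤ ENat.card α) (a b c : α) :
    ∃ d, d ≠ a ∧ d ≠ b ∧ d ≠ c := by
  by_contra! hc
  have h1 : (Set.univ : Set α) ⊆ {a, b, c} := by
    intro d _
    have := hc d
    simp only [Set.mem_insert_iff, Set.mem_singleton_iff]
    grind
  have h2 := Set.encard_le_encard h1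
  rw [Set.encard_univ] at h2
  have h3 : ({a, b, c} : Set α).encard ≤ 3 := by
    refine (Set.encard_insert_le _ _).trans ?_
    calc ({b, c} : Set α).encard + 1 ≤ (1 + 1) + 1 := by
          gcongr
          exact (Set.encard_insert_le _ _).trans (by rw [Set.encard_singleton])
      _ = 3 := by norm_num
  exact absurd (h4.trans (h2.trans h3)) (by decide)

variable (h : MatchCov G m) (hM : IsMate M m)

include h hM

/-- A torsoid satisfies `NoSplit`, be it a brick, a brace, or a cycle. -/
theorem IsTorsoid.noSplit {T : PreTorsoid V} (hT : IsTorsoid G M T) :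
    NoSplit h T.graph Subtype.val T.edgeSets := by
  have F := hT.isFrame h hM
  have h4 := exists_ne_three_of_four_le (α := T.verts) hT.four_le
  by_cases hc : IsCycleGraph T.graph
  · exact noSplit_of_cycleMax h F (deg2_of_isCycleGraph hc).2 (hT.cycleMax hM hc)
  · obtain ⟨μ, hμ⟩ := F.exists_induces h h.mem
    have hB := hT.brickOrBrace h hM hc hμ
    refine noSplit_of_brickOrBrace h F hμ h4 hB fun i j k => ?_
    by_contra! hn
    have hH := F.matchCov h hμ
    obtain ⟨hfin, hd⟩ := deg2_of_brickOrBrace hH h4 hB (i := i) (j := j) (k := k) fun l hl => by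
      by_cases h5 : l = j
      · exact Or.inl h5
      · exact Or.inr (hn l hl h5)
    exact hc (isCycleGraph_of_deg2 hH.conn hd)

/-- The torsoid cleaved by a tight set partition without overlap is unique. -/
theorem IsTorsoid.eq_ofFrame (F : IsFrame G m K q fun _ _ => ∅)
    (h2 : ∀ i j, ∃ k, K.Adj i k ∧ k ≠ j) (ho : NoOverlap G m q) (h4 : 4 ≤ ENat.card ι)
    {T : PreTorsoid V} (hT : IsTorsoid G M T) (hc : ∀ i, ∃ v ∈ T.verts, v ⊆ q i) :
    T = PreTorsoid.ofFrame K (core G m q) (coreEdge G m q) := by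
  have F' := hT.isFrame h hM
  have h4' := exists_ne_three_of_four_le h4
  have hS := hT.noSplit h hM
  have hI := hT.irred h hM
  have hx : ∃ x : ι → T.verts, ∀ i, (x i).1 ⊆ q i := by
    choose v hv hvq using hc
    exact ⟨fun i => ⟨v i, hv i⟩, hvq⟩
  obtain ⟨x, hx⟩ := hx
  have hE := F.par_edge_part h F' hx h4' hS
  have hu : ∀ i a, par h (a.1 ∩ q i) = 1 → a = x i := by
    intro i a ha
    by_cases hcy : IsCycleGraph T.graph
    · exact F.eq_of_par_eq_one_of_deg2 h F' hx h4' hS h2 ho (deg2_of_isCycleGraph hcy).2 hI ha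
    · obtain ⟨μ, hμ⟩ := F'.exists_induces h h.mem
      exact F.eq_of_par_eq_one_of_brickOrBrace h F' hx h4' hS hμ (hT.brickOrBrace h hM hcy hμ) ha
  have hv := F.vert_eq_core h F' hx hE hu h2 ho hI
  have hcore := F.core_isFrame h h2 ho
  have hxa := F.exists_eq_of_cleaves h F' hu
  have hval : ∀ i (hm : core G m q i ∈ T.verts), (⟨_, hm⟩ : T.verts) = x i :=
    fun i hm => Subtype.ext (hv i).symm
  have hmem : ∀ A ∈ T.verts, ∃ i, A = core G m q i := by
    intro A hA
    obtain ⟨i, hi⟩ := hxa ⟨A, hA⟩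
    refine ⟨i, ?_⟩
    rw [← hv i, hi]
  refine PreTorsoid.ext_of ?_ ?_ ?_
  · ext A
    constructor
    · intro hA
      obtain ⟨i, rfl⟩ := hmem A hA
      exact ⟨i, rfl⟩
    · rintro ⟨i, rfl⟩
      rw [← hv i]; exact (x i).2
  · intro A B hA hB hA' hB'
    obtain ⟨i, rfl⟩ := hmem A hA
    obtain ⟨j, rfl⟩ := hmem B hB
    rw [hval i hA, hval j hB, F.adj_iff_of_cleaves h F' hx hE hu]
    exact (hcore.ofFrame_adj h i j).symm
  · intro A B hA hB hA' hB'
    obtain ⟨i, rfl⟩ := hmem A hA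
    obtain ⟨j, rfl⟩ := hmem B hB
    rw [hval i hA, hval j hB, F.edge_eq_coreEdge h F' hx hE hu h2 ho hI]
    exact (hcore.ofFrame_edgeSets h i j).symm

/-- A tight set partition without overlap of which the collapse is a brick, a brace or a cycle
cleaves exactly one torsoid. -/
theorem IsFrame.existsUnique_of_noOverlap (F : IsFrame G m K q fun _ _ => ∅)
    (h2 : ∀ i j, ∃ k, K.Adj i k ∧ k ≠ j) (ho : NoOverlap G m q) (h4 : 4 ≤ ENat.card ι)
    {μ : ι → ι} (hμ : Induces K q (fun _ _ => ∅) m μ)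
    (hB : (∀ X, Tight K μ X → (∃ w, X = {w}) ∨ ∃ w, Xᶜ = {w}) ∨ IsCycleGraph K) :
    ∃! T, IsTorsoid G M T ∧ ∀ i, ∃ v ∈ T.verts, v ⊆ q i := by
  refine ⟨_, ⟨F.isTorsoid_core h hM h2 ho h4 hμ hB, fun i => ⟨_, ⟨i, rfl⟩, core_subset i⟩⟩, ?_⟩
  rintro T ⟨hT, hc⟩
  exact hT.eq_ofFrame h hM F h2 ho h4 hc

end Unique

/-! ### Splitting an overlap -/

section Refine

variable {V ι : Type*} {G : SimpleGraph V} {m : V → V} {M : G.Subgraph} {K : SimpleGraph ι}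
  {q : ι → Set V}

/-- The quotient of `G` by a family of disjoint vertex sets: two members are adjacent if `G` has an
edge between them. -/
def quotGraph (G : SimpleGraph V) (q : ι → Set V) : SimpleGraph ι where
  Adj := fun i j => i ≠ j ∧ ∃ x ∈ q i, ∃ y ∈ q j, G.Adj x y
  symm := ⟨fun _ _ h =>
    ⟨h.1.symm, by obtain ⟨x, hx, y, hy, a⟩ := h.2; exact ⟨y, hy, x, hx, a.symm⟩⟩⟩
  loopless := ⟨fun _ h => h.1 rfl⟩

/-- A partition into tight sets together with its quotient graph is a frame with empty edge sets. -/
theorem isFrame_quotGraph (ht : ∀ i, Tight G m (q i)) (hd : ∀ i j x, x ∈ q i → x ∈ q j → i = j)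
    (hc : ∀ x, ∃ i, x ∈ q i) : IsFrame G m (quotGraph G q) q fun _ _ => ∅ where
  tight := ht
  tight_union i j _ := by rw [Set.union_empty]; exact ht i
  symm _ _ := rfl
  adj_of_mem _ _ _ hx := absurd hx (Set.notMem_empty _)
  eq_of_mem := hd
  notMem _ _ _ _ _ := Set.notMem_empty _
  edge_eq_of_mem _ _ _ _ _ hx := absurd hx (Set.notMem_empty _)
  cover x := Or.inl (hc x)
  edge i j a := by obtain ⟨-, x, hx, y, hy, a⟩ := a; exact ⟨x, Or.inl hx, y, hy, a⟩
  no_edge i j hij hn x hx y hy a := hn ⟨hij, x, hx, y, hy, a⟩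

theorem deg2_of_nbrs {μ : ι → ι} (hK : MatchCov K μ)
    (h4 : ∀ a b c : ι, ∃ d, d ≠ a ∧ d ≠ b ∧ d ≠ c)
    (hn : ∀ i, ∃ j k, ∀ l, K.Adj i l → l = j ∨ l = k) : Deg2 K := by
  intro i
  obtain ⟨j, k, hjk, hj, hk⟩ := exists_two_nbrs hK h4 i
  obtain ⟨j', k', hl⟩ := hn i
  refine ⟨j, k, hjk, hj, hk, fun l h => ?_⟩
  have := hl j hj
  have := hl k hk
  have := hl l h
  grind

variable (h : MatchCov G m)

include h

/-- A tight set from which overlapping parts can be moved in either direction splits into three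
tight sets in a row. -/
theorem Movable.split {Q A B S S' : Set V} (hQ : Tight G m Q) (hS : Movable G m Q A S)
    (hS' : Movable G m Q B S') (hAB : Disjoint A B) (hp : TightCuts.par h (S ∩ S') = 1) :
    Tight G m (S \ S') ∧ Tight G m (S ∩ S') ∧ Tight G m (S' \ S) ∧ Q ⊆ S ∪ S' ∧
      ∀ x ∈ S \ S', ∀ y ∈ S' \ S, ¬ G.Adj x y := by
  have hSQ := hS.1
  have hSQ' := hS'.1
  have hp0 : TightCuts.par h ((Q \ S) ∩ (Q \ S')) = 0 := by
    rw [par_sdiff_inter_sdiff h hQ hS hS', hp]; decide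
  have t1 : Tight G m (S \ S') := by
    have := sdiff_tight h hS'.2.1 hS.2.1 (by rwa [Set.inter_comm])
    rwa [show (Q \ S') \ (Q \ S) = S \ S' by grind] at this
  have t3 : Tight G m (S' \ S) := by
    have := sdiff_tight h hS.2.1 hS'.2.1 hp0
    rwa [show (Q \ S) \ (Q \ S') = S' \ S by grind] at this
  have n2 : ∀ x ∈ S ∩ S', ∀ y, G.Adj x y → y ∈ Q := by
    intro x hx y hxy
    by_contra hn
    exact Set.disjoint_left.1 hAB ((hS.2.2 x hx.1 y hxy).resolve_left hn)
      ((hS'.2.2 x hx.2 y hxy).resolve_left hn)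
  have n0 : ∀ x ∈ Q, x ∉ S → x ∉ S' → ∀ y, G.Adj x y → y ∈ Q ∧ (y ∉ S ∨ y ∉ S') := by
    intro x hx hxS hxS' y hxy
    by_contra hn
    refine no_edge_of_sdiff h hS.2.1 hS'.2.1 hp0 (x := x) (y := y) ⟨hx, hxS⟩ ⟨hx, hxS'⟩ ?_ ?_ hxy
    · grind
    · grind
  -- no matching leaves both outer sets for the interior of `Q`
  have key : ∀ f ∈ Mates G m, ∀ x ∈ S \ S', f x ∉ S \ S' → f x ∈ Q → ∀ y ∈ S' \ S, f y ∉ S' \ S →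
      f y ∉ Q := by
    intro f hf x hx hfx hfxQ y hy hfy hfyQ
    obtain ⟨c, hc, hfc, -⟩ := hQ.cross hf
    have hc1 : c ∉ S \ S' := fun h' => hfc (by
      rwa [t1.unique hf h' (fun h'' => hfc (hSQ h''.1)) hx hfx])
    have hc3 : c ∉ S' \ S := fun h' => hfc (by
      rwa [t3.unique hf h' (fun h'' => hfc (hSQ' h''.1)) hy hfy])
    have hc2 : c ∉ S ∩ S' := fun h' => hfc (n2 c h' _ (hf.1 c))
    have hc0 : ¬ (c ∉ S ∧ c ∉ S') := fun h' => hfc (n0 c hc h'.1 h'.2 _ (hf.1 c)).1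
    grind
  have hcov : Q ⊆ S ∪ S' := by
    obtain ⟨z, hz⟩ := t1.nonempty h
    have hcl := eq_empty_of_closed h (X := (Q \ S) ∩ (Q \ S')) (z := z) ?_ (by grind)
    · intro x hx
      by_contra hn
      refine Set.eq_empty_iff_forall_notMem.1 hcl x ?_
      grind
    · intro x hx y hxy
      by_contra hn
      obtain ⟨f, hf, rfl⟩ := h.cov x y hxy
      obtain ⟨w, hw, hfw, hwx⟩ := exists_cross_ne h hf hp0 hx hn
      have h1 := n0 x hx.1.1 hx.1.2 hx.2.2 _ hxy
      have h2 := n0 w hw.1.1 hw.1.2 hw.2.2 _ (hf.1 w)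
      have hff := hf.2.1
      -- the two matching edges end in different outer sets
      have hne : f w ≠ f x := fun h' => hwx (by rw [← hff w, h', hff])
      have e1 : f x ∈ S \ S' → f w ∈ S \ S' → False := fun h3 h4 =>
        hne (t1.unique hf h4 (by rw [hff]; exact fun h' => hw.1.2 h'.1) h3
          (by rw [hff]; exact fun h' => hx.1.2 h'.1))
      have e3 : f x ∈ S' \ S → f w ∈ S' \ S → False := fun h3 h4 =>
        hne (t3.unique hf h4 (by rw [hff]; exact fun h' => hw.2.2 h'.1) h3
          (by rw [hff]; exact fun h' => hx.2.2 h'.1))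
      have e4 : ∀ u v, u ∈ (Q \ S) ∩ (Q \ S') → v ∈ (Q \ S) ∩ (Q \ S') → f u ∈ S \ S' →
          f v ∈ S' \ S → False := by
        intro u v hu hv hfu hfv
        refine key f hf (f u) hfu ?_ ?_ (f v) hfv ?_ ?_ <;> rw [hff]
        · exact fun h' => hu.1.2 h'.1
        · exact hu.1.1
        · exact fun h' => hv.2.2 h'.1
        · exact hv.1.1
      have e5 := e4 x w hx hw
      have e6 := e4 w x hw hx
      grind
  have hno : ∀ x ∈ S \ S', ∀ y ∈ S' \ S, ¬ G.Adj x y := by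
    intro x hx y hy hxy
    obtain ⟨f, hf, rfl⟩ := h.cov x y hxy
    refine key f hf x hx (fun h' => h'.2 hy.1) (hSQ' hy.1) (f x) hy ?_ ?_ <;> rw [hf.2.1]
    · exact fun h' => h'.2 hx.1
    · exact hSQ hx.1
  refine ⟨t1, tight_of_par h hp fun f hf x hx hfx y hy hfy => ?_, t3, hcov, hno⟩
  by_contra hxy
  have h1 := n2 x hx _ (hf.1 x)
  have h2 := n2 y hy _ (hf.1 y)
  have hff := hf.2.1
  have hne : f x ≠ f y := fun h' => hxy (by rw [← hff x, h', hff])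
  have e1 : f x ∈ S \ S' → f y ∈ S \ S' → False := fun h3 h4 =>
    hne (t1.unique hf h3 (by rw [hff]; exact fun h' => h'.2 hx.2) h4
      (by rw [hff]; exact fun h' => h'.2 hy.2))
  have e3 : f x ∈ S' \ S → f y ∈ S' \ S → False := fun h3 h4 =>
    hne (t3.unique hf h3 (by rw [hff]; exact fun h' => h'.2 hx.1) h4
      (by rw [hff]; exact fun h' => h'.2 hy.1))
  have e4 : ∀ u v, u ∈ S ∩ S' → v ∈ S ∩ S' → f u ∈ S \ S' → f v ∈ S' \ S → False := by
    intro u v hu hv hfu hfv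
    refine key f hf (f u) hfu ?_ ?_ (f v) hfv ?_ ?_ <;> rw [hff]
    · exact fun h' => h'.2 hu.2
    · exact hSQ hu.1
    · exact fun h' => h'.2 hv.1
    · exact hSQ hv.1
  have e5 := e4 x y hx hy
  have e6 := e4 y x hy hx
  have h3 := hcov h1
  have h4 := hcov h2
  grind

end Refine

/-! ### Refining a cyclic partition -/

section Refinement

variable {V ι : Type*} {G : SimpleGraph V} {m : V → V} {M : G.Subgraph} {K : SimpleGraph ι}
  {q : ι → Set V} {i₀ a b : ι} {S S' : Set V}

open Classical in
/-- The family obtained from `q` by splitting `q i₀ = S ∪ S'` into `S ∩ S'`, which takes the place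
of `q i₀`, and the two new members `S' \ S` and `S \ S'`. -/
def refinement (q : ι → Set V) (i₀ : ι) (S S' : Set V) : Option (Option ι) → Set V
  | none => S' \ S
  | some none => S \ S'
  | some (some i) => if i = i₀ then S ∩ S' else q i

theorem refinement_self : refinement q i₀ S S' (some (some i₀)) = S ∩ S' := if_pos rfl

theorem refinement_of_ne {i : ι} (hi : i ≠ i₀) : refinement q i₀ S S' (some (some i)) = q i :=
  if_neg hi

/-- The member of the original family that contains a given member of the refinement. -/
def coarse (i₀ : ι) : Option (Option ι) → ι
  | none => i₀
  | some none => i₀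
  | some (some i) => i

theorem refinement_subset (hS : S ⊆ q i₀) (hS' : S' ⊆ q i₀) (j : Option (Option ι)) :
    refinement q i₀ S S' j ⊆ q (coarse i₀ j) := by
  rcases j with _ | _ | i
  · exact Set.sdiff_subset.trans hS'
  · exact Set.sdiff_subset.trans hS
  · by_cases hi : i = i₀
    · subst hi; rw [refinement_self]; exact Set.inter_subset_left.trans hS
    · rw [refinement_of_ne hi]; exact subset_rfl

/-- The situation in which a partition is refined at `q i₀`: this member has only the two neighbours
`q a` and `q b`, and it is the union of a part `S` that can be moved to `q a` and a part `S'` that can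
be moved to `q b`, where `S' \ S`, `S ∩ S'` and `S \ S'` are tight sets in a row. -/
structure Splits (G : SimpleGraph V) (m : V → V) (K : SimpleGraph ι) (q : ι → Set V) (i₀ a b : ι)
    (S S' : Set V) : Prop where
  ne : a ≠ b
  left : Movable G m (q i₀) (q a) S
  right : Movable G m (q i₀) (q b) S'
  nbr : ∀ l, K.Adj i₀ l → l = a ∨ l = b
  adj_left : K.Adj i₀ a
  adj_right : K.Adj i₀ b
  tight_left : Tight G m (S \ S')
  tight_inter : Tight G m (S ∩ S')
  tight_right : Tight G m (S' \ S)
  cover : q i₀ ⊆ S ∪ S'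
  no_edge : ∀ x ∈ S \ S', ∀ y ∈ S' \ S, ¬ G.Adj x y

variable (h : MatchCov G m) (F : IsFrame G m K q fun _ _ => ∅)

include h F

/-- An overlap provides a splitting. -/
theorem IsFrame.exists_splits (hd : Deg2 K) (ho : ¬ NoOverlap G m q) :
    ∃ i₀ a b S S', Splits G m K q i₀ a b S S' := by
  have h2 := hd.exists_ne
  simp only [NoOverlap, not_forall] at ho
  obtain ⟨i, a, b, hab, ho⟩ := ho
  obtain ⟨hp, hn⟩ := F.nbr_of_overlap h h2 hab ho
  have hdis : Disjoint (q a) (q b) := F.disjoint_vert hab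
  have hS := F.movable_mov h h2 i a
  have hS' := F.movable_mov h h2 i b
  obtain ⟨t1, t2, t3, hc, hno⟩ := hS.split h (F.tight i) hS' hdis hp
  obtain ⟨x, hx, -⟩ := exists_cross h h.mem hp
  exact ⟨i, a, b, _, _, hab, hS, hS', hn, F.adj_of_mem_mov h hx.1, F.adj_of_mem_mov h hx.2, t1, t2,
    t3, hc, hno⟩

variable (s : Splits G m K q i₀ a b S S')

include s

omit h in
theorem Splits.isFrame : IsFrame G m (quotGraph G (refinement q i₀ S S')) (refinement q i₀ S S')
    fun _ _ => ∅ := by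
  have hsub := refinement_subset s.left.1 s.right.1
  refine isFrame_quotGraph ?_ ?_ ?_
  · rintro (_ | _ | i)
    · exact s.tight_right
    · exact s.tight_left
    · by_cases hi : i = i₀
      · subst hi; rw [refinement_self]; exact s.tight_inter
      · rw [refinement_of_ne hi]; exact F.tight i
  · intro i j x hx hy
    have hij := F.eq_of_mem _ _ _ (hsub i hx) (hsub j hy)
    rcases i with _ | _ | i <;> rcases j with _ | _ | j <;> simp only [coarse] at hij
    · rfl
    · exact absurd hy.1 hx.2
    · subst hij; rw [refinement_self] at hy; exact absurd hy.1 hx.2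
    · exact absurd hx.1 hy.2
    · rfl
    · subst hij; rw [refinement_self] at hy; exact absurd hy.2 hx.2
    · subst hij; rw [refinement_self] at hx; exact absurd hx.1 hy.2
    · subst hij; rw [refinement_self] at hx; exact absurd hx.2 hy.2
    · rw [hij]
  · intro x
    obtain ⟨i, hi⟩ := F.exists_mem_part x
    by_cases hii : i = i₀
    · subst hii
      by_cases hS : x ∈ S <;> by_cases hS' : x ∈ S'
      · exact ⟨some (some i), by rw [refinement_self]; exact ⟨hS, hS'⟩⟩
      · exact ⟨some none, hS, hS'⟩
      · exact ⟨none, hS', hS⟩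
      · exact absurd (s.cover hi) (by simp [hS, hS'])
    · exact ⟨some (some i), by rwa [refinement_of_ne hii]⟩

omit s F h in
theorem exists_ne_three_option (h4 : ∀ a b c : ι, ∃ d, d ≠ a ∧ d ≠ b ∧ d ≠ c) [Nonempty ι]
    (a b c : Option (Option ι)) : ∃ d, d ≠ a ∧ d ≠ b ∧ d ≠ c := by
  obtain ⟨i⟩ := ‹Nonempty ι›
  obtain ⟨d, h1, h2, h3⟩ := h4 (coarse i a) (coarse i b) (coarse i c)
  refine ⟨some (some d), ?_, ?_, ?_⟩ <;> rintro rfl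
  · exact h1 rfl
  · exact h2 rfl
  · exact h3 rfl

/-- The refinement of a cycle is a cycle. -/
theorem Splits.deg2 (hd : Deg2 K) (h4 : ∀ a b c : ι, ∃ d, d ≠ a ∧ d ≠ b ∧ d ≠ c) :
    Deg2 (quotGraph G (refinement q i₀ S S')) := by
  have F' := s.isFrame F
  obtain ⟨μ, hμ⟩ := F'.exists_induces h h.mem
  have := F.connected h |>.nonempty
  refine deg2_of_nbrs (F'.matchCov h hμ) (exists_ne_three_option h4) ?_
  have hsub := refinement_subset s.left.1 s.right.1
  have ha := s.adj_left.ne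
  have hb := s.adj_right.ne
  -- where edges between members of the refinement can lead
  have hnS : ∀ x ∈ S, ∀ i, i ≠ i₀ → i ≠ a → ∀ y ∈ q i, ¬ G.Adj x y := by
    intro x hx i hi hia y hy hxy
    rcases s.left.2.2 x hx y hxy with h5 | h5
    · exact hi (F.eq_of_mem _ _ _ hy h5)
    · exact hia (F.eq_of_mem _ _ _ hy h5)
  have hnS' : ∀ x ∈ S', ∀ i, i ≠ i₀ → i ≠ b → ∀ y ∈ q i, ¬ G.Adj x y := by
    intro x hx i hi hib y hy hxy
    rcases s.right.2.2 x hx y hxy with h5 | h5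
    · exact hi (F.eq_of_mem _ _ _ hy h5)
    · exact hib (F.eq_of_mem _ _ _ hy h5)
  have hK : ∀ i j, i ≠ i₀ → j ≠ i₀ → (quotGraph G (refinement q i₀ S S')).Adj (some (some i))
      (some (some j)) → K.Adj i j := by
    rintro i j hi hj ⟨hne, x, hx, y, hy, hxy⟩
    rw [refinement_of_ne hi] at hx
    rw [refinement_of_ne hj] at hy
    exact F.adj_of_edge (fun h' => hne (by rw [h'])) hx hy hxy
  rintro (_ | _ | i)
  · refine ⟨some (some i₀), some (some b), ?_⟩
    rintro (_ | _ | l) ⟨hne, x, hx, y, hy, hxy⟩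
    · exact absurd rfl hne
    · exact absurd hxy.symm (s.no_edge y hy x hx)
    · by_cases hl : l = i₀
      · exact Or.inl (by rw [hl])
      · rw [refinement_of_ne hl] at hy
        refine Or.inr ?_
        by_contra hlb
        exact hnS' x hx.1 l hl (fun h' => hlb (by rw [h'])) y hy hxy
  · refine ⟨some (some i₀), some (some a), ?_⟩
    rintro (_ | _ | l) ⟨hne, x, hx, y, hy, hxy⟩
    · exact absurd hxy (s.no_edge x hx y hy)
    · exact absurd rfl hne
    · by_cases hl : l = i₀
      · exact Or.inl (by rw [hl])
      · rw [refinement_of_ne hl] at hy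
        refine Or.inr ?_
        by_contra hla
        exact hnS x hx.1 l hl (fun h' => hla (by rw [h'])) y hy hxy
  · by_cases hi : i = i₀
    · subst hi
      refine ⟨none, some none, ?_⟩
      rintro (_ | _ | l) ⟨hne, x, hx, y, hy, hxy⟩
      · exact Or.inl rfl
      · exact Or.inr rfl
      · have hl : l ≠ i := fun h' => hne (by rw [h'])
        rw [refinement_self] at hx
        rw [refinement_of_ne hl] at hy
        by_cases hla : l = a
        · exact absurd hxy (hnS' x hx.2 l hl (fun h' => s.ne (hla.symm.trans h')) y hy)
        · exact absurd hxy (hnS x hx.1 l hl hla y hy)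
    · -- the only new member with an edge to `q i` is the one on its side
      have hside : ∀ w, (∀ l, K.Adj i l → l = i₀ ∨ l = w) → ∀ e : Option (Option ι),
          (∀ e', (∀ j, j ≠ i₀ → e' ≠ some (some j)) → e' ≠ e →
            ¬ (quotGraph G (refinement q i₀ S S')).Adj (some (some i)) e') →
          ∀ l, (quotGraph G (refinement q i₀ S S')).Adj (some (some i)) l →
            l = e ∨ l = some (some w) := by
        intro w hw e he l hl
        by_cases hle : l = e
        · exact Or.inl hle
        by_cases hj : ∀ j, j ≠ i₀ → l ≠ some (some j)
        · exact absurd hl (he l hj hle)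
        · push Not at hj
          obtain ⟨j, hj, rfl⟩ := hj
          rcases hw j (hK i j hi hj hl) with h5 | h5
          · exact absurd h5 hj
          · exact Or.inr (by rw [h5])
      by_cases hia : i = a
      · obtain ⟨w, -, -, hw⟩ := hd.other (hia ▸ s.adj_left.symm : K.Adj i i₀)
        refine ⟨some none, some (some w), hside w hw _ ?_⟩
        rintro (_ | _ | l) hj hne ⟨-, x, hx, y, hy, hxy⟩ <;> rw [refinement_of_ne hi] at hx
        · exact hnS' y hy.1 i hi (fun h' => s.ne (hia.symm.trans h')) x hx hxy.symm
        · exact hne rfl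
        · have hl : l = i₀ := by by_contra h'; exact hj l h' rfl
          subst hl
          rw [refinement_self] at hy
          exact hnS' y hy.2 i hi (fun h' => s.ne (hia.symm.trans h')) x hx hxy.symm
      by_cases hib : i = b
      · obtain ⟨w, -, -, hw⟩ := hd.other (hib ▸ s.adj_right.symm : K.Adj i i₀)
        refine ⟨none, some (some w), hside w hw _ ?_⟩
        rintro (_ | _ | l) hj hne ⟨-, x, hx, y, hy, hxy⟩ <;> rw [refinement_of_ne hi] at hx
        · exact hne rfl
        · exact hnS y hy.1 i hi hia x hx hxy.symm
        · have hl : l = i₀ := by by_contra h'; exact hj l h' rfl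
          subst hl
          rw [refinement_self] at hy
          exact hnS y hy.1 i hi hia x hx hxy.symm
      obtain ⟨j, k, -, -, -, hjk⟩ := hd i
      refine ⟨some (some j), some (some k), fun l hl => ?_⟩
      obtain ⟨-, x, hx, y, hy, hxy⟩ := id hl
      rw [refinement_of_ne hi] at hx
      have hKl : K.Adj i (coarse i₀ l) := by
        refine F.adj_of_edge ?_ hx (hsub l hy) hxy
        rintro h'
        rcases l with _ | _ | l
        · exact hi h'
        · exact hi h'
        · exact hl.1 (by rw [show i = l from h'])
      have hli : coarse i₀ l ≠ i₀ := fun h' => by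
        rcases s.nbr i (h' ▸ hKl.symm) with h5 | h5
        · exact hia h5
        · exact hib h5
      rcases l with _ | _ | l
      · exact absurd rfl hli
      · exact absurd rfl hli
      · exact (hjk l hKl).imp (fun h' => by rw [h']) (fun h' => by rw [h'])

/-- A torsoid is cleaved by the refinement if it is cleaved by the original partition. -/
theorem Splits.cleaves (hM : IsMate M m) [Finite ι] (hd : Deg2 K)
    (h4 : ∀ a b c : ι, ∃ d, d ≠ a ∧ d ≠ b ∧ d ≠ c) {T : PreTorsoid V} (hT : IsTorsoid G M T)
    (hc : ∀ i, ∃ v ∈ T.verts, v ⊆ q i) (j : Option (Option ι)) :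
    ∃ v ∈ T.verts, v ⊆ refinement q i₀ S S' j := by
  have F' := hT.isFrame h hM
  have hS := hT.noSplit h hM
  have hI := hT.irred h hM
  obtain ⟨x, hx⟩ : ∃ x : ι → T.verts, ∀ i, (x i).1 ⊆ q i := by
    choose v hv hvq using hc
    exact ⟨fun i => ⟨v i, hv i⟩, hvq⟩
  have hE := F.par_edge_part h F' hx h4 hS
  -- the torsoid is a cycle
  have hcy : IsCycleGraph T.graph := by
    by_contra hcy
    obtain ⟨μ, hμ⟩ := F'.exists_induces h h.mem
    have hu : ∀ i a, par h (a.1 ∩ q i) = 1 → a = x i := fun i a ha =>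
      F.eq_of_par_eq_one_of_brickOrBrace h F' hx h4 hS hμ (hT.brickOrBrace h hM hcy hμ) ha
    have hinj : Function.Injective x := by
      intro i j hij
      obtain ⟨z, hz⟩ := (F'.tight (x i)).nonempty h
      exact F.eq_of_mem _ _ _ (hx i hz) (hx j (hij ▸ hz))
    let e : K ≃g T.graph :=
      { toEquiv := Equiv.ofBijective x ⟨hinj, F.exists_eq_of_cleaves h F' hu⟩
        map_rel_iff' := F.adj_iff_of_cleaves h F' hx hE hu _ _ }
    obtain ⟨n, hn, ⟨φ⟩⟩ := isCycleGraph_of_deg2 (F.connected h) hd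
    exact hcy ⟨n, hn, ⟨e.symm.trans φ⟩⟩
  have hd' := (deg2_of_isCycleGraph hcy).2
  -- every vertex is on one side of each tight set
  have hside : ∀ Z, Tight G m Z → ∀ i j, (x i).1 ⊆ Z → (x j).1 ⊆ Zᶜ →
      ∀ v : T.verts, v.1 ⊆ Z ∨ v.1 ⊆ Zᶜ := by
    intro Z hZ i j hi hj v
    rcases ZMod2.eq_zero_or_one (par h (v.1 ∩ Z)) with h5 | h5
    · right
      refine F'.subset_of_odd_vert h hd' hI hS hZ.compl hj (by rwa [compl_compl]) ?_
      rw [par_compl_inter, (F'.tight v).par h, h5]; decide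
    · exact Or.inl (F'.subset_of_odd_vert h hd' hI hS hZ hi hj h5)
  have hdis : ∀ i j, i ≠ j → ∀ z, z ∈ q i → z ∉ q j := fun i j hij z hz hz' =>
    hij (F.eq_of_mem _ _ _ hz hz')
  have key : ∀ a b S, a ≠ b → a ≠ i₀ → b ≠ i₀ → Movable G m (q i₀) (q a) S →
      (∀ c d, par h (T.edgeSets c d ∩ S) = 0) ∧
        ∀ v : T.verts, v.1 ⊆ q i₀ → v.1 ⊆ S ∨ v.1 ⊆ Sᶜ := by
    intro a b S hab ha hb hSm
    have hZ : Tight G m (q a ∪ S) :=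
      union_tight_of_nbr_subset h (F.tight i₀) hSm.1 hSm.2.1 (F.tight a)
        (Set.disjoint_left.2 (hdis a i₀ ha)) hSm.2.2
    have hxa : (x a).1 ⊆ q a ∪ S := (hx a).trans Set.subset_union_left
    have hxb : (x b).1 ⊆ (q a ∪ S)ᶜ := by
      rintro z hz (h5 | h5)
      · exact hdis a b hab z h5 (hx b hz)
      · exact hdis b i₀ hb z (hx b hz) (hSm.1 h5)
    have hdS : Disjoint (q a) S := Set.disjoint_left.2 fun z hz hz' => hdis a i₀ ha z hz (hSm.1 hz')
    refine ⟨fun c d => ?_, fun v hv => ?_⟩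
    · have h5 := F'.par_edge_inter h hS hZ hxa hxb c d
      rwa [par_inter_union h hdS, hE, zero_add] at h5
    · rcases hside _ hZ a b hxa hxb v with h5 | h5
      · exact Or.inl fun z hz => (h5 hz).resolve_left fun h6 => hdis a i₀ ha z h6 (hv hz)
      · exact Or.inr fun z hz h6 => h5 hz (Or.inr h6)
  have ha := s.adj_left.ne.symm
  have hb := s.adj_right.ne.symm
  obtain ⟨k1, k2⟩ := key a b S s.ne ha hb s.left
  obtain ⟨k3, k4⟩ := key b a S' s.ne.symm hb ha s.right
  have hcovq : q i₀ = S ∪ S' := Set.Subset.antisymm s.cover (Set.union_subset s.left.1 s.right.1)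
  have hfind : ∀ P, Tight G m P → P ⊆ q i₀ → (∀ c d, par h (T.edgeSets c d ∩ P) = 0) →
      ∃ v : T.verts, v.1 ⊆ q i₀ ∧ (v.1 ∩ P).Nonempty := by
    intro P hP hPq hPE
    obtain ⟨v, hv⟩ := F'.exists_odd h hP hPE
    obtain ⟨z, hz, -⟩ := exists_cross h h.mem hv
    refine ⟨v, ?_, z, hz⟩
    refine (hside _ (F.tight i₀) i₀ a (hx i₀) (F.subset_compl_part hx ha) v).resolve_right ?_
    exact fun h5 => h5 hz.1 (hPq hz.2)
  have hpar : ∀ c d, par h (T.edgeSets c d ∩ (S ∩ S')) = 0 ∧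
      par h (T.edgeSets c d ∩ (S \ S')) = 0 ∧ par h (T.edgeSets c d ∩ (S' \ S)) = 0 := by
    intro c d
    have h5 := hE i₀ c d
    rw [hcovq, ← Set.union_sdiff_self, par_inter_union h Set.disjoint_sdiff_right, k1] at h5
    have h6 := k3 c d
    rw [← Set.inter_union_sdiff S' S, par_inter_union h Set.disjoint_sdiff_inter.symm,
      Set.inter_comm S' S] at h6
    have h7 := k1 c d
    rw [← Set.inter_union_sdiff S S', par_inter_union h Set.disjoint_sdiff_inter.symm] at h7
    grind
  rcases j with _ | _ | i
  · obtain ⟨v, hv, z, hz⟩ := hfind (S' \ S) s.tight_right (Set.sdiff_subset.trans s.right.1)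
      fun c d => (hpar c d).2.2
    refine ⟨v.1, v.2, fun w hw => ⟨?_, ?_⟩⟩
    · exact (k4 v hv).resolve_right (fun h5 => h5 hz.1 hz.2.1) hw
    · exact (k2 v hv).resolve_left (fun h5 => hz.2.2 (h5 hz.1)) hw
  · obtain ⟨v, hv, z, hz⟩ := hfind (S \ S') s.tight_left (Set.sdiff_subset.trans s.left.1)
      fun c d => (hpar c d).2.1
    refine ⟨v.1, v.2, fun w hw => ⟨?_, ?_⟩⟩
    · exact (k2 v hv).resolve_right (fun h5 => h5 hz.1 hz.2.1) hw
    · exact (k4 v hv).resolve_left (fun h5 => hz.2.2 (h5 hz.1)) hw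
  · by_cases hi : i = i₀
    · subst hi
      rw [refinement_self]
      obtain ⟨v, hv, z, hz⟩ := hfind (S ∩ S') s.tight_inter (Set.inter_subset_left.trans s.left.1)
        fun c d => (hpar c d).1
      refine ⟨v.1, v.2, fun w hw => ⟨?_, ?_⟩⟩
      · exact (k2 v hv).resolve_right (fun h5 => h5 hz.1 hz.2.1) hw
      · exact (k4 v hv).resolve_right (fun h5 => h5 hz.1 hz.2.2) hw
    · rw [refinement_of_ne hi]
      exact hc i

omit h F in
theorem Splits.cleaves_of_refinement {A : Set (Set V)}
    (hc : ∀ j, ∃ v ∈ A, v ⊆ refinement q i₀ S S' j) (i : ι) : ∃ v ∈ A, v ⊆ q i := by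
  obtain ⟨v, hv, hvq⟩ := hc (some (some i))
  exact ⟨v, hv, hvq.trans (refinement_subset s.left.1 s.right.1 _)⟩

end Refinement

/-! ### Existence and uniqueness of the cleaved torsoid -/

section Main

universe u w

variable {V : Type u} {ι : Type w} {G : SimpleGraph V} {m : V → V} {M : G.Subgraph}
  {K : SimpleGraph ι} {q : ι → Set V}

variable (h : MatchCov G m)

include h

/-- If two matchings induce different matchings of a cycle, then they differ on every vertex of the
cycle, which bounds its length. -/
theorem IsFrame.card_le (F : IsFrame G m K q fun _ _ => ∅) (hd : Deg2 K) {f : V → V}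
    (hf : f ∈ Mates G m) {μ ν : ι → ι} (hμ : Induces K q (fun _ _ => ∅) m μ)
    (hν : Induces K q (fun _ _ => ∅) f ν) {i₀ : ι} (h0 : μ i₀ ≠ ν i₀) :
    Nat.card ι ≤ {x | f x ≠ m x}.ncard := by
  have hne := hd.ne_of_ne (F.matchCov h hμ) (F.induces_mem_mates h hμ hf hν) h0
  have hc : ∀ i, ∃ c ∈ q i, f c ≠ m c := by
    intro i
    obtain ⟨a, c, hc, hmc⟩ := hμ i
    refine ⟨c, hc, fun he => hne i ?_⟩
    exact ((F.uses_iff hf hν _ _).1 ⟨a, c, hc, he ▸ hmc⟩).symm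
  choose c hcq hcf using hc
  have := hf.2.2.to_subtype
  rw [← Nat.card_coe_set_eq]
  refine Nat.card_le_card_of_injective (fun i => ⟨c i, hcf i⟩) fun i j hij => ?_
  have hij : c i = c j := congrArg Subtype.val hij
  exact F.eq_of_mem _ _ _ (hcq i) (hij ▸ hcq j)

variable (hM : IsMate M m)

include hM

/-- If there is an overlap, a partition with a cycle as quotient can be refined without changing the
torsoids that it cleaves. -/
theorem IsFrame.exists_refinement [Finite ι] (F : IsFrame G m K q fun _ _ => ∅) (hd : Deg2 K)
    (h4 : ∀ a b c : ι, ∃ d, d ≠ a ∧ d ≠ b ∧ d ≠ c) (ho : ¬ NoOverlap G m q) {f : V → V}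
    (hf : f ∈ Mates G m) {μ ν : ι → ι} (hμ : Induces K q (fun _ _ => ∅) m μ)
    (hν : Induces K q (fun _ _ => ∅) f ν) {i₀ : ι} (h0 : μ i₀ ≠ ν i₀) :
    ∃ (K' : SimpleGraph (Option (Option ι))) (q' : Option (Option ι) → Set V)
      (μ' ν' : Option (Option ι) → Option (Option ι)) (j₀ : Option (Option ι)),
      IsFrame G m K' q' (fun _ _ => ∅) ∧ Deg2 K' ∧ Induces K' q' (fun _ _ => ∅) m μ' ∧
        Induces K' q' (fun _ _ => ∅) f ν' ∧ μ' j₀ ≠ ν' j₀ ∧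
          ∀ T, IsTorsoid G M T →
            ((∀ i, ∃ v ∈ T.verts, v ⊆ q i) ↔ ∀ j, ∃ v ∈ T.verts, v ⊆ q' j) := by
  obtain ⟨i, a, b, S, S', s⟩ := F.exists_splits h hd ho
  have F' := s.isFrame F
  obtain ⟨μ', hμ'⟩ := F'.exists_induces h h.mem
  obtain ⟨ν', hν'⟩ := F'.exists_induces h hf
  refine ⟨_, _, μ', ν', some (some a), F', s.deg2 h F hd h4, hμ', hν', fun he => ?_, fun T hT =>
    ⟨s.cleaves h F hM hd h4 hT, s.cleaves_of_refinement⟩⟩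
  -- partners of `q a` in the refinement lie in different members of the original partition
  have key : ∀ g ∈ Mates G m, ∀ j, Uses (quotGraph G (refinement q i S S')) (refinement q i S S')
      (fun _ _ => ∅) g (some (some a)) j → Uses K q (fun _ _ => ∅) g a (coarse i j) := by
    rintro g hg j ⟨hj, x, hx, hgx⟩
    have hsub := refinement_subset s.left.1 s.right.1
    rw [refinement_of_ne s.adj_left.ne.symm] at hx
    rw [Set.union_empty] at hgx
    refine ⟨F.adj_of_edge ?_ hx (hsub j hgx) (hg.1 x), x, hx, Or.inl (hsub j hgx)⟩
    intro h'
    rcases j with _ | _ | l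
    · exact s.adj_left.ne h'.symm
    · exact s.adj_left.ne h'.symm
    · exact hj.1 (by rw [show a = l from h'])
  have h5 := (F.uses_iff h.mem hμ _ _).1 (key m h.mem _ (hμ' (some (some a))))
  have h6 := (F.uses_iff hf hν _ _).1 (key f hf _ (hν' (some (some a))))
  refine hd.ne_of_ne (F.matchCov h hμ) (F.induces_mem_mates h hμ hf hν) h0 a ?_
  rw [h5, h6, he]

/-- A tight set partition with a cycle as quotient cleaves exactly one torsoid: while there is an
overlap, the partition can be refined. The number `n` bounds the room left for refinements. -/
theorem existsUnique_of_deg2_of_ncard_le {f : V → V} (hf : f ∈ Mates G m) (n : ℕ) :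
    ∀ {ι : Type w} [Finite ι] {K : SimpleGraph ι} {q : ι → Set V} {μ ν : ι → ι} {i₀ : ι}
      (_ : IsFrame G m K q fun _ _ => ∅) (_ : Deg2 K) (_ : 4 ≤ ENat.card ι)
      (_ : Induces K q (fun _ _ => ∅) m μ) (_ : Induces K q (fun _ _ => ∅) f ν) (_ : μ i₀ ≠ ν i₀)
      (_ : {x | f x ≠ m x}.ncard ≤ Nat.card ι + n),
      ∃! T, IsTorsoid G M T ∧ ∀ i, ∃ v ∈ T.verts, v ⊆ q i := by
  induction n with
  | zero =>
    intro ι _ K q μ ν i₀ F hd h4 hμ hν h0 hn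
    by_cases ho : NoOverlap G m q
    · exact F.existsUnique_of_noOverlap h hM hd.exists_ne ho h4 hμ
        (Or.inr (isCycleGraph_of_deg2 (F.connected h) hd))
    · exfalso
      obtain ⟨K', q', μ', ν', j₀, F', hd', hμ', hν', h0', -⟩ :=
        F.exists_refinement h hM hd (exists_ne_three_of_four_le h4) ho hf hμ hν h0
      have h5 := F'.card_le h hd' hf hμ' hν' h0'
      rw [Finite.card_option, Finite.card_option] at h5
      omega
  | succ n ih =>
    intro ι _ K q μ ν i₀ F hd h4 hμ hν h0 hn
    by_cases ho : NoOverlap G m q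
    · exact F.existsUnique_of_noOverlap h hM hd.exists_ne ho h4 hμ
        (Or.inr (isCycleGraph_of_deg2 (F.connected h) hd))
    · obtain ⟨K', q', μ', ν', j₀, F', hd', hμ', hν', h0', hT⟩ :=
        F.exists_refinement h hM hd (exists_ne_three_of_four_le h4) ho hf hμ hν h0
      have h6 : 4 ≤ ENat.card (Option (Option ι)) :=
        h4.trans (ENat.card_le_card_of_injective
          ((Option.some_injective _).comp (Option.some_injective _)))
      have h7 := ih F' hd' h6 hμ' hν' h0' (by
        rw [Finite.card_option, Finite.card_option]; omega)
      have h8 : ∀ T, (IsTorsoid G M T ∧ ∀ i, ∃ v ∈ T.verts, v ⊆ q i) ↔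
          (IsTorsoid G M T ∧ ∀ j, ∃ v ∈ T.verts, v ⊆ q' j) := fun T =>
        and_congr_right fun h => hT T h
      simpa only [h8] using h7

/-- A tight set partition with a finite cycle as quotient cleaves exactly one torsoid. The two
disjoint perfect matchings of the cycle lift to matchings of `G`, of which the finite difference
bounds all refinements. -/
theorem IsFrame.existsUnique_of_deg2 [Finite ι] (F : IsFrame G m K q fun _ _ => ∅) (hd : Deg2 K)
    (h4 : 4 ≤ ENat.card ι) : ∃! T, IsTorsoid G M T ∧ ∀ i, ∃ v ∈ T.verts, v ⊆ q i := by
  obtain ⟨μ, hμ⟩ := F.exists_induces h h.mem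
  have hK := F.matchCov h hμ
  obtain ⟨ν, hν, hne⟩ := hd.exists_matching hK
  obtain ⟨f, hf, hfν⟩ := F.exists_lift h hμ hν
  obtain ⟨i⟩ := hK.conn.nonempty
  exact existsUnique_of_deg2_of_ncard_le h hM hf {x | f x ≠ m x}.ncard F hd h4 hμ hfν (hne i).1
    (Nat.le_add_left _ _)

/-- A tight set partition with at least four members of which the collapse is a brick or a brace
cleaves exactly one torsoid. -/
theorem IsFrame.existsUnique_of_brickOrBrace (F : IsFrame G m K q fun _ _ => ∅)
    (h4 : 4 ≤ ENat.card ι) {μ : ι → ι} (hμ : Induces K q (fun _ _ => ∅) m μ)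
    (hB : ∀ X, Tight K μ X → (∃ w, X = {w}) ∨ ∃ w, Xᶜ = {w}) :
    ∃! T, IsTorsoid G M T ∧ ∀ i, ∃ v ∈ T.verts, v ⊆ q i := by
  have h4' := exists_ne_three_of_four_le h4
  have hK := F.matchCov h hμ
  by_cases hn : ∃ i j k, ∀ l, K.Adj i l → l = j ∨ l = k
  · obtain ⟨i, j, k, hn⟩ := hn
    obtain ⟨hfin, hd⟩ := deg2_of_brickOrBrace hK h4' hB hn
    exact F.existsUnique_of_deg2 h hM hd h4
  · have h2 : ∀ i j, ∃ k, K.Adj i k ∧ k ≠ j := by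
      intro i j
      by_contra! hc
      exact hn ⟨i, j, j, fun l hl => Or.inl (hc l hl)⟩
    refine F.existsUnique_of_noOverlap h hM h2 (fun i j k hjk => ?_) h4 hμ (Or.inl hB)
    by_contra ho
    exact hn ⟨i, j, k, (F.nbr_of_overlap h h2 hjk ho).2⟩

omit h hM in
/-- The collapse of a tight set partition with at least four members cleaves exactly one torsoid if
it is a brick or a brace. -/
theorem IsTightSetPartition.existsUnique_cleaves (hG : IsMatchingCovered G M) {P : Set (Set V)}
    (hP : IsTightSetPartition G M P) (h4 : 4 ≤ P.encard)
    (hB : IsBrickOrBrace (collapse G P).graph (collapseMatching M P)) :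
    ∃! T : PreTorsoid V, IsTorsoid G M T ∧ Cleaves (collapse G P) T := by
  obtain ⟨m, hM⟩ := exists_isMate hG.isPerfectMatching
  have h := (isMatchingCovered_iff hM).1 hG
  have F : IsFrame G m (collapse G P).graph Subtype.val fun _ _ => ∅ := by
    refine isFrame_quotGraph (q := fun X : P => X.1) ?_ ?_ ?_
    · exact fun X => (isTight_iff hM _).1 (hP.2 _ X.2)
    · intro X Y x hx hy
      exact Subtype.ext ((hP.1.2 x).unique ⟨X.2, hx⟩ ⟨Y.2, hy⟩)
    · intro x
      obtain ⟨X, ⟨hX, hx⟩, -⟩ := hP.1.2 x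
      exact ⟨⟨X, hX⟩, hx⟩
  obtain ⟨μ, hμ⟩ := F.exists_induces h h.mem
  have hmate : IsMate (collapseMatching M P) μ := by
    refine ⟨rfl, fun X Y => ?_⟩
    rw [← F.uses_iff h.mem hμ]
    constructor
    · rintro ⟨hne, x, hx, y, hy, hxy⟩
      exact ⟨⟨hne, x, hx, y, hy, hxy.adj_sub⟩, x, hx, Or.inl ((hM.2 _ _).1 hxy ▸ hy)⟩
    · rintro ⟨a, x, hx, hy⟩
      rw [Set.union_empty] at hy
      exact ⟨a.1, x, hx, m x, hy, (hM.2 _ _).2 rfl⟩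
  have hB' : ∀ X, Tight (collapse G P).graph μ X → (∃ w, X = {w}) ∨ ∃ w, Xᶜ = {w} :=
    fun X hX => hB X ((isTight_iff hmate X).2 hX)
  have key := F.existsUnique_of_brickOrBrace h hM h4 hμ hB'
  have hiff : ∀ T : PreTorsoid V, Cleaves (collapse G P) T ↔
      ∀ X : (collapse G P).verts, ∃ v ∈ T.verts, v ⊆ X.1 :=
    fun T => ⟨fun hc X => hc X.1 X.2, fun hc X hX => hc ⟨X, hX⟩⟩
  simpa only [hiff] using key

end Main

end TightCuts

theorem mainTheorem2 {V : Type*} (G : SimpleGraph V) (M : G.Subgraph)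
    (hG : TightCuts.IsMatchingCovered G M) (S : TightCuts.SetGraph V)
    (hS : TightCuts.IsTorso G M S) :
    ∃! T : TightCuts.PreTorsoid V, TightCuts.IsTorsoid G M T ∧ TightCuts.Cleaves S T := by
  obtain ⟨𝒞, -, P, hP, rfl⟩ := hS
  exact hP.isTightSetPartition.existsUnique_cleaves hG hP.four_le hP.isBrickOrBrace
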